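/- Setting. Fix $n\in\mathbb N$ orthonormal one-particle states, an inverse temperature $\beta>0$, and a statistics (bosons or fermions). Let $\mathcal F$ be the corresponding bosonic/fermionic Fock space over $\mathbb C^n$, with the orthonormal number basis $|k_1\dots k_n\rangle$ ($k_i\in\mathbb N$, and $k_i\le 1$ for fermions), let $\mathcal F_0\subseteq\mathcal F$ be the dense subspace of finite linear combinations of number states, and let $a_i,a_i^\dagger$ be the annihilation and creation operators on $\mathcal F_0$, $N=\sum_i a_i^\dagger a_i$. Let $H$ be a hermitian linear combination of products of at most $2m$ creation and annihilation operators ($m\ge1$; $H$ need not conserve the particle number). For bosons assume in addition that the highest-order interaction is strictly positive in the sense that there are $K>0$ and $C\in\mathbb R$ with $\langle\varphi|H\varphi\rangle\ge K\langle\varphi|N^m\varphi\rangle-C\|\varphi\|^2$ for all $\varphi\in\mathcal F_0$. A hermitian operator on $\mathcal F_0$ that is bounded from below is identified with its Friedrichs extension. For a hermitian $n\times n$ matrix $v$ put $H_v=H+\sum_{ij}v_{ij}a_i^\dagger a_j$. Let $\mathcal V$ be the set of those $v$ for which $H_v$ is bounded from below and $Z[v]=\operatorname{Tr}e^{-\beta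 H_v}<\infty$, and for $v\in\mathcal V$ let $\rho_v=e^{-\beta H_v}/Z[v]$ be the Gibbs state. A density-matrix operator is a positive semidefinite operator $\rho$ on $\mathcal F$ with $\operatorname{Tr}\rho=1$; write $\rho\to\gamma$ if its one-body reduced density matrix (1RDM) $\gamma_{ij}=\operatorname{Tr}\{\rho\,a_j^\dagger a_i\}$ is finite, and $v\mapsto\gamma$ if $v\in\mathcal V$ and $\rho_v\to\gamma$. The set of ensemble $N$-representable 1RDMs is $$\Gamma=\{\gamma=\gamma^\dagger\in\mathbb C^{n\times n}:\ \gamma\ge0,\ \text{and } \gamma^2\le\gamma\text{ for fermions}\},$$ $\operatorname{int}\Gamma$ is its interior in the real vector space of hermitian matrices, and the set of $v$-representable 1RDMs is $\{\gamma\in\Gamma:\exists v\in\mathcal V,\ v\mapsto\gamma\}$. The universal functional is $$F[\gamma]=\inf_{\rho\to\gamma}\operatorname{Tr}\{\rho\,(H+\beta^{-1}\ln\rho)\},$$ where the infimum is over the density-matrix operators $\rho\to\gamma$ of finite energy $\operatorname{Tr}\{\rho H\}$ and finite entropy $-\operatorname{Tr}\{\rho\ln\rho\}$, and $F[\gamma]=+\infty$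 if there are none. Theorem. (i) Assume that for every $\gamma\in\Gamma$ with $F[\gamma]<\infty$ the infimum defining $F[\gamma]$ is attained. Then: a) $\operatorname{int}\Gamma$ equals the set of $v$-representable 1RDMs; b) $F$ is real-valued and differentiable on $\operatorname{int}\Gamma$, and whenever $v\mapsto\gamma_v$ its gradient with respect to the pairing $\langle h,\gamma\rangle=\operatorname{tr}\{h\gamma\}$ is $\nabla F[\gamma_v]=-v$; c) $v\mapsto\gamma_v$ is a bijection of $\mathcal V$ onto $\operatorname{int}\Gamma$: every $v\in\mathcal V$ has exactly one 1RDM $\gamma_v\in\operatorname{int}\Gamma$, and every $\gamma\in\operatorname{int}\Gamma$ comes from exactly one $v\in\mathcal V$. (ii) For fermions the assumption in (i) always holds. -/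

import Mathlib

open Filter Topology
open scoped ComplexOrder

namespace RDM

noncomputable section

/-- The two kinds of indistinguishable particles. -/
inductive Statistics : Type
  | boson
  | fermion

/-- Occupation numbers `(k₁, …, kₙ)` of the `n` orthonormal one-particle states; for fermions every
state is occupied at most once. They label the orthonormal number basis of Fock space. -/
abbrev Occ (s : Statistics) (n : ℕ) : Type :=
  {k : Fin n → ℕ // s = Statistics.fermion → ∀ i, k i ≤ 1}

/-- The bosonic / fermionic Fock space over `ℂⁿ`, in the occupation-number representation: the
Hilbert space of square-summable families indexed by the occupation numbers. -/
abbrev Fock (s : Statistics) (n : ℕ) : Type := lp (fun _ : Occ s n => ℂ) 2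

/-- The pre-Fock space: vectors of finite length (since every particle-number sector is
finite-dimensional, these are the finite linear combinations of number states). -/
abbrev PreFock (s : Statistics) (n : ℕ) : Type := Occ s n →₀ ℂ

/-- The normalised number state `|k₁ … kₙ⟩`. -/
def ket {s : Statistics} {n : ℕ} (k : Occ s n) : Fock s n :=
  lp.single 2 k (1 : ℂ)

/-- The inclusion of the pre-Fock space in the Fock space. -/
def toFock {s : Statistics} {n : ℕ} : PreFock s n →ₗ[ℂ] Fock s n :=
  Finsupp.linearCombination ℂ (ket (s := s) (n := n))

/-- The phase of a ladder operator on a number state: `1` for bosons, and for fermions `(-1)` to the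
number of particles in the states after `i` (`|k⟩` is `a†_{i₁} ⋯ a†_{i_N}` applied to the vacuum in
the order in which the creation operators append a particle at the end). -/
def phase {n : ℕ} : (s : Statistics) → (Fin n → ℕ) → Fin n → ℂ
  | Statistics.boson, _, _ => 1
  | Statistics.fermion, k, i => (-1) ^ (∑ j ∈ Finset.univ.filter (fun j => i < j), k j)

/-- Remove a particle from the state `i` (nothing happens if there is none). -/
def lowerOcc {s : Statistics} {n : ℕ} (k : Occ s n) (i : Fin n) : Occ s n :=
  ⟨Function.update k.1 i (k.1 i - 1), by
    intro h j
    have hk := k.2 h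
    by_cases hj : j = i
    · subst hj
      simpa using (hk j).trans (Nat.le_succ 1)
    · simpa [Function.update_of_ne hj] using hk j⟩

/-- The occupation number after adding one particle (for fermions it can only become `1`). -/
def raiseNumber : Statistics → ℕ → ℕ
  | Statistics.boson, m => m + 1
  | Statistics.fermion, _ => 1

/-- The modulus of the coefficient when adding a particle to a state that holds `m` particles:
`√(m + 1)` for bosons; for fermions `1` if the state is empty and `0` if it is occupied. -/
def raiseCoeff : Statistics → ℕ → ℝ
  | Statistics.boson, m => Real.sqrt (m + 1)
  | Statistics.fermion, m => if m = 0 then 1 else 0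

/-- Add a particle to the state `i`. -/
def raiseOcc {s : Statistics} {n : ℕ} (k : Occ s n) (i : Fin n) : Occ s n :=
  ⟨Function.update k.1 i (raiseNumber s (k.1 i)), by
    intro h j
    have hk := k.2 h
    by_cases hj : j = i
    · subst hj
      subst h
      simp [raiseNumber]
    · simpa [Function.update_of_ne hj] using hk j⟩

/-- The annihilation operator `a_i` on the pre-Fock space:
`a_i |k⟩ = phase · √(k_i) |k - e_i⟩` (zero if `k_i = 0`). -/
def annih (s : Statistics) (n : ℕ) (i : Fin n) : Module.End ℂ (PreFock s n) :=
  Finsupp.linearCombination ℂ fun k : Occ s n =>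
    Finsupp.single (lowerOcc k i) (phase s k.1 i * (Real.sqrt (k.1 i) : ℂ))

/-- The creation operator `a†_i` on the pre-Fock space. -/
def create (s : Statistics) (n : ℕ) (i : Fin n) : Module.End ℂ (PreFock s n) :=
  Finsupp.linearCombination ℂ fun k : Occ s n =>
    Finsupp.single (raiseOcc k i) (phase s k.1 i * (raiseCoeff s (k.1 i) : ℂ))

/-- The number operator `N = ∑ a†_i a_i`. -/
def numberOp (s : Statistics) (n : ℕ) : Module.End ℂ (PreFock s n) :=
  ∑ i, create s n i * annih s n i

/-- The linear combinations of products of at most `d` creation and annihilation operators. -/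
def ladderPoly (s : Statistics) (n d : ℕ) : Submodule ℂ (Module.End ℂ (PreFock s n)) :=
  Submodule.span ℂ {A | ∃ l : List (Fin n ⊕ Fin n), l.length ≤ d ∧
    A = (l.map (Sum.elim (annih s n) (create s n))).prod}

/-- The sesquilinear form `⟨φ|A ψ⟩` of an operator on the pre-Fock space. -/
def form {s : Statistics} {n : ℕ} (A : Module.End ℂ (PreFock s n)) (φ ψ : PreFock s n) : ℂ :=
  inner ℂ (toFock φ) (toFock (A ψ))

/-- The expectation value `⟨φ|A φ⟩`. -/
def quad {s : Statistics} {n : ℕ} (A : Module.End ℂ (PreFock s n)) (φ : PreFock s n) : ℝ :=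
  (form A φ φ).re

/-- `A` is hermitian: `⟨φ|A ψ⟩ = ⟨A φ|ψ⟩` on the pre-Fock space. -/
def IsHermitianOp {s : Statistics} {n : ℕ} (A : Module.End ℂ (PreFock s n)) : Prop :=
  ∀ φ ψ, form A φ ψ = inner ℂ (toFock (A φ)) (toFock ψ)

/-- `A` is bounded from below. -/
def IsBoundedBelow {s : Statistics} {n : ℕ} (A : Module.End ℂ (PreFock s n)) : Prop :=
  ∃ C : ℝ, ∀ φ, -C * ‖toFock φ‖ ^ 2 ≤ quad A φ

/-- The highest-order interaction, of order `m`, is strictly positive: up to a constant the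
Hamiltonian dominates a positive multiple of `N ^ m`. -/
def IsCoercive {s : Statistics} {n : ℕ} (m : ℕ) (A : Module.End ℂ (PreFock s n)) : Prop :=
  ∃ K : ℝ, 0 < K ∧ ∃ C : ℝ, ∀ φ, K * quad (numberOp s n ^ m) φ ≤ quad A φ + C * ‖toFock φ‖ ^ 2

/-- `ψ` lies in the domain of the closure of the quadratic form of `A` (the form domain of its
Friedrichs extension), and the closed form takes the value `e` at `ψ`. -/
def HasFormValue {s : Statistics} {n : ℕ} (A : Module.End ℂ (PreFock s n)) (ψ : Fock s n)
    (e : ℝ) : Prop :=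
  ∃ φ : ℕ → PreFock s n,
    Tendsto (fun l => toFock (φ l)) atTop (𝓝 ψ) ∧
    Tendsto (fun p : ℕ × ℕ => quad A (φ p.1 - φ p.2)) atTop (𝓝 0) ∧
    Tendsto (fun l => quad A (φ l)) atTop (𝓝 e)

/-- The graph of the Friedrichs extension `Â` of a hermitian operator `A` that is bounded from
below: `ψ ∈ dom Â` and `Â ψ = χ` if and only if `ψ` is in the form domain and
`⟨A φ|ψ⟩ = ⟨φ|χ⟩` for all `φ` in the pre-Fock space. -/
def FriedrichsGraph {s : Statistics} {n : ℕ} (A : Module.End ℂ (PreFock s n))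
    (ψ χ : Fock s n) : Prop :=
  (∃ e, HasFormValue A ψ e) ∧ ∀ φ, inner ℂ (toFock (A φ)) ψ = inner ℂ (toFock φ) χ

/-- The orthonormal basis `b` consists of eigenvectors of the Friedrichs extension of `A`, with
eigenvalues `E`. -/
def IsEnergyBasis {s : Statistics} {n : ℕ} (A : Module.End ℂ (PreFock s n))
    (b : HilbertBasis (Occ s n) ℂ (Fock s n)) (E : Occ s n → ℝ) : Prop :=
  ∀ k, FriedrichsGraph A (b k) ((E k : ℂ) • b k)

/-- The partition function `Z = Tr e^{-βA}` is finite: `A` is bounded from below, its Friedrichs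
extension has an orthonormal basis of eigenvectors, and `∑ e^{-βE_k} < ∞`. -/
def PartitionFinite {s : Statistics} {n : ℕ} (β : ℝ) (A : Module.End ℂ (PreFock s n)) : Prop :=
  IsBoundedBelow A ∧ ∃ b E, IsEnergyBasis A b E ∧ Summable fun k => Real.exp (-β * E k)

/-- `ρ` is the Gibbs state `e^{-βA} / Tr e^{-βA}` (with finite partition function). -/
def IsGibbsState {s : Statistics} {n : ℕ} (β : ℝ) (A : Module.End ℂ (PreFock s n))
    (ρ : Fock s n →L[ℂ] Fock s n) : Prop :=
  IsBoundedBelow A ∧ ∃ b E, IsEnergyBasis A b E ∧ (Summable fun k => Real.exp (-β * E k)) ∧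
    ∀ k, ρ (b k) = ((Real.exp (-β * E k) / ∑' l, Real.exp (-β * E l) : ℝ) : ℂ) • b k

/-- Density-matrix operators: positive semidefinite (hence self-adjoint) with trace `1`. -/
def IsDensityOp {s : Statistics} {n : ℕ} (ρ : Fock s n →L[ℂ] Fock s n) : Prop :=
  ρ.IsPositive ∧ HasSum (fun k : Occ s n => (inner ℂ (ket k) (ρ (ket k))).re) 1

/-- `ρ = ∑ w_k |b_k⟩⟨b_k|` for the orthonormal basis `b`. -/
def IsSpectralDecomp {s : Statistics} {n : ℕ} (ρ : Fock s n →L[ℂ] Fock s n)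
    (b : HilbertBasis (Occ s n) ℂ (Fock s n)) (w : Occ s n → ℝ) : Prop :=
  ∀ k, ρ (b k) = (w k : ℂ) • b k

/-- The energy `Tr{ρ A} = ∑ w_k ⟨b_k|A|b_k⟩` is finite and equal to `E`, where
`ρ = ∑ w_k |b_k⟩⟨b_k|` and the expectation values are those of the Friedrichs extension of `A`. -/
def HasEnergy {s : Statistics} {n : ℕ} (A : Module.End ℂ (PreFock s n))
    (ρ : Fock s n →L[ℂ] Fock s n) (E : ℝ) : Prop :=
  ∃ b w, IsSpectralDecomp ρ b w ∧ ∃ e : Occ s n → ℝ,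
    (∀ k, w k ≠ 0 → HasFormValue A (b k) (e k)) ∧ HasSum (fun k => w k * e k) E

/-- The entropy `-Tr{ρ ln ρ} = -∑ w_k ln w_k` is finite and equal to `S`. -/
def HasEntropy {s : Statistics} {n : ℕ} (ρ : Fock s n →L[ℂ] Fock s n) (S : ℝ) : Prop :=
  ∃ b w, IsSpectralDecomp ρ b w ∧ HasSum (fun k => Real.negMulLog (w k)) S

/-- `ρ` is in the domain of the grand potential, whose value `Tr{ρ A} - β⁻¹ S[ρ]` is `ω`. -/
def HasGrandPotential {s : Statistics} {n : ℕ} (β : ℝ) (A : Module.End ℂ (PreFock s n))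
    (ρ : Fock s n →L[ℂ] Fock s n) (ω : ℝ) : Prop :=
  ∃ E S, HasEnergy A ρ E ∧ HasEntropy ρ S ∧ ω = E - β⁻¹ * S

/-- The real vector space of hermitian `n × n` matrices. -/
abbrev HermMat (n : ℕ) : Type := selfAdjoint (Matrix (Fin n) (Fin n) ℂ)

/-- `ρ → γ`: the one-body reduced density matrix `γ_ij = Tr{ρ a†_j a_i}` is finite and equal
to `γ`. -/
def HasOneRDM {s : Statistics} {n : ℕ} (ρ : Fock s n →L[ℂ] Fock s n) (γ : HermMat n) : Prop :=
  ∀ i j, HasSum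
    (fun k : Occ s n =>
      inner ℂ (ket k) (ρ (toFock (create s n j (annih s n i (Finsupp.single k 1))))))
    ((γ : Matrix (Fin n) (Fin n) ℂ) i j)

/-- The ensemble `N`-representable one-body reduced density matrices: `γ ≥ 0`, and `γ² ≤ γ` for
fermions. -/
def NRep (s : Statistics) (n : ℕ) : Set (HermMat n) :=
  {γ | (γ : Matrix (Fin n) (Fin n) ℂ).PosSemidef ∧
    (s = Statistics.fermion →
      ((γ : Matrix (Fin n) (Fin n) ℂ) - (γ : Matrix (Fin n) (Fin n) ℂ) ^ 2).PosSemidef)}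

/-- The one-body potential `V_v = ∑ v_ij a†_i a_j`. -/
def potential (s : Statistics) {n : ℕ} (v : HermMat n) : Module.End ℂ (PreFock s n) :=
  ∑ i, ∑ j, (v : Matrix (Fin n) (Fin n) ℂ) i j • (create s n i * annih s n j)

/-- The potentials `v` with finite partition function `Z[v]` of `H + V_v`. -/
def finitePotentials {s : Statistics} {n : ℕ} (β : ℝ) (H : Module.End ℂ (PreFock s n)) :
    Set (HermMat n) :=
  {v | PartitionFinite β (H + potential s v)}

/-- `v ↦ γ`: the Gibbs state of `H + V_v` has the one-body reduced density matrix `γ`. -/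
def Generates {s : Statistics} {n : ℕ} (β : ℝ) (H : Module.End ℂ (PreFock s n))
    (v γ : HermMat n) : Prop :=
  ∃ ρ, IsGibbsState β (H + potential s v) ρ ∧ HasOneRDM ρ γ

/-- The `v`-representable one-body reduced density matrices. -/
def VRep {s : Statistics} {n : ℕ} (β : ℝ) (H : Module.End ℂ (PreFock s n)) : Set (HermMat n) :=
  {γ | γ ∈ NRep s n ∧ ∃ v ∈ finitePotentials β H, Generates β H v γ}

/-- The values of the grand potential on the density-matrix operators `ρ → γ` in its domain. -/
def grandPotentialValues {s : Statistics} {n : ℕ} (β : ℝ) (H : Module.End ℂ (PreFock s n))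
    (γ : HermMat n) : Set ℝ :=
  {ω | ∃ ρ, IsDensityOp ρ ∧ HasOneRDM ρ γ ∧ HasGrandPotential β H ρ ω}

/-- The universal functional `F[γ] = inf_{ρ → γ} Tr{ρ (H + β⁻¹ ln ρ)}`, which is `+∞` if the
infimum is over the empty set. -/
def universalFunctional {s : Statistics} {n : ℕ} (β : ℝ) (H : Module.End ℂ (PreFock s n))
    (γ : HermMat n) : EReal :=
  sInf ((fun ω : ℝ => (ω : EReal)) '' grandPotentialValues β H γ)

/-- The infimum in the universal functional is attained for every `N`-representable `γ` (there is
nothing to attain where the functional is `+∞`). -/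
def IsAttained {s : Statistics} {n : ℕ} (β : ℝ) (H : Module.End ℂ (PreFock s n)) : Prop :=
  ∀ γ ∈ NRep s n, universalFunctional β H γ ≠ ⊤ →
    ∃ ω ∈ grandPotentialValues β H γ, universalFunctional β H γ = (ω : EReal)

/-- The pairing `γ ↦ tr{v γ}` of hermitian matrices, as a continuous real-linear functional. -/
def tracePairing {n : ℕ} (v : HermMat n) : HermMat n →L[ℝ] ℝ where
  toFun γ := ((v : Matrix (Fin n) (Fin n) ℂ) * (γ : Matrix (Fin n) (Fin n) ℂ)).trace.re
  map_add' x y := by simp [mul_add, Matrix.trace_add]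
  map_smul' c x := by simp [Matrix.trace_smul]
  cont := by
    refine Complex.continuous_re.comp (Continuous.matrix_trace ?_)
    exact continuous_const.matrix_mul continuous_subtype_val

end

end RDM

namespace RDM

noncomputable section

/-! The proof is convex duality on the finite-dimensional space of hermitian matrices. `F` is
convex. Given attainment, a potential `v` generates a point `γ` of `int Γ` exactly when `-v` is a
subgradient of `F` at `γ`, and only one `v` does so. A convex function with a single subgradient at
an interior point is differentiable there, so the gradient inverts `v ↦ γ`. The work lies in
carrying this out with unbounded operators and their quadratic forms.

The basic estimate is `DominatesNumber`: up to a constant, the Hamiltonian bounds a positive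
multiple of the number operator. Klein's inequality against the free state `e^{-xN}` then bounds the
entropy by the energy. Finite energy thus implies finite entropy, and the grand potential is bounded
below. For `H` the estimate is coercivity, or finite dimension for fermions. For bosonic `H + V_v`
with `m ≥ 2` it holds because `N` is infinitesimally small relative to `N ^ m`. For `m = 1` the
potential is of the same order as `H`, and finiteness of `Z[v]` must be used: if the coefficient
matrix of the quadratic Hamiltonian were not positive definite, there would be an orthonormal
sequence of bounded energy (`PartitionFinite.dominatesNumber_of_quadratic`).

Convexity of `F` has two sources. The energy of a state is the trace of an operator on the form
domain, and these operators mix linearly (`HasEnergy.mix`). The entropy is concave by Klein's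
inequality.

Gibbs states minimise the grand potential of `H + V_v` (`IsGibbsState.minimal`), so the potential
supports `F` at the density matrix it generates. Conversely, if `-v` is a subgradient at `γ`, the
state attaining `F[γ]` minimises the grand potential over all states. Admixing a little of a pure
state gives `H + V_v - Ω ≥ -β⁻¹ ln ρ` as forms. The expectations of both sides in `ρ` agree, so
equality holds on each eigenvector of `ρ`, and `ρ` is the Gibbs state (`isGibbsState_of_minimal`).
As `ρ` determines `H + V_v` up to a constant, and the vacuum and the one-particle states determine
the constant and `v`, the subgradient is unique.

It remains to identify the domain. The density matrices of finite vectors lie in the convex domain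
of `F` and already have the lower support function of `Γ`: put many bosons in one mode, or fill the
negative eigenvalues of `v` with fermions. Hence `int Γ` lies in the interior of the domain
(`interior_NRep_subset`). A Gibbs state has full rank, so it leaves no mode empty and, for fermions,
none full (`IsGibbsState.mem_interior_NRep`). For fermions attainment is compactness in finite
dimension (`isAttained_of_finite`). -/

theorem _root_.HasSum.of_fun_eq {ι M : Type*} [AddCommMonoid M] [TopologicalSpace M] {f g : ι → M}
    {a : M} (h : HasSum f a) (e : ∀ k, g k = f k) : HasSum g a := by
  rwa [funext e]

/-! ### Double series and Klein's inequality -/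

section DoubleSums

variable {ι κ : Type*}

theorem hasSum_uncurry_of_nonneg {g : κ → ι → ℝ} (hg : ∀ k i, 0 ≤ g k i) {r : κ → ℝ} {R : ℝ}
    (hr : ∀ k, HasSum (g k) (r k)) (hR : HasSum r R) :
    HasSum (fun p : κ × ι => g p.1 p.2) R := by
  have hs : Summable (fun p : κ × ι => g p.1 p.2) := by
    refine (summable_prod_of_nonneg (fun p => hg p.1 p.2)).2 ⟨fun k => (hr k).summable, ?_⟩
    simpa only [(hr _).tsum_eq] using hR.summable
  have h := hs.hasSum.prod_fiberwise hr
  rw [hR.unique h]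
  exact hs.hasSum

theorem hasSum_of_uncurry {g : κ → ι → ℝ} {c : ι → ℝ} {R : ℝ}
    (hR : HasSum (fun p : κ × ι => g p.1 p.2) R) (hc : ∀ i, HasSum (fun k => g k i) (c i)) :
    HasSum c R := by
  have h2 : HasSum (fun p : ι × κ => g p.2 p.1) R :=
    (Equiv.prodComm ι κ).hasSum_iff.2 hR
  exact h2.prod_fiberwise hc

/-- Tonelli for double series of non-negative numbers. -/
theorem hasSum_swap {g : κ → ι → ℝ} (hg : ∀ k i, 0 ≤ g k i) {r : κ → ℝ} {c : ι → ℝ} {R : ℝ}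
    (hr : ∀ k, HasSum (g k) (r k)) (hR : HasSum r R) (hc : ∀ i, HasSum (fun k => g k i) (c i)) :
    HasSum c R :=
  hasSum_of_uncurry (hasSum_uncurry_of_nonneg hg hr hR) hc

/-- Klein's inequality for two probability distributions that are connected by doubly stochastic
weights `g`. -/
theorem klein_inequality {g : κ → ι → ℝ} (hg : ∀ k i, 0 ≤ g k i)
    (hrow : ∀ k, HasSum (g k) 1) (hcol : ∀ i, HasSum (fun k => g k i) 1)
    {w : κ → ℝ} (hw0 : ∀ k, 0 ≤ w k) (hw : HasSum w 1)
    {l : ι → ℝ} (hl0 : ∀ i, 0 ≤ l i) (hl : HasSum l 1)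
    (hsupp : ∀ k i, g k i ≠ 0 → w k ≠ 0 → l i ≠ 0) {T : ℝ}
    (hT : HasSum (fun p : κ × ι => g p.1 p.2 * (w p.1 * -Real.log (l p.2))) T) :
    Summable (fun k => Real.negMulLog (w k)) ∧ ∑' k, Real.negMulLog (w k) ≤ T := by
  have h1 : HasSum (fun p : κ × ι => g p.1 p.2 * w p.1) 1 :=
    hasSum_uncurry_of_nonneg (fun k i => mul_nonneg (hg k i) (hw0 k))
      (fun k => by simpa using (hrow k).mul_right (w k)) hw
  have h2 : HasSum (fun p : κ × ι => g p.1 p.2 * l p.2) 1 := by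
    have := hasSum_uncurry_of_nonneg (g := fun i k => g k i * l i)
      (fun k i => mul_nonneg (hg i k) (hl0 k))
      (fun i => by simpa using (hcol i).mul_right (l i)) hl
    exact (Equiv.prodComm κ ι).hasSum_iff.2 this
  have h3 := (hT.sub h1).add h2
  have hw1 : ∀ k, w k ≤ 1 := fun k => le_hasSum hw k (fun j _ => hw0 j)
  -- The corrections `-w` and `+l` come from `log x ≤ x - 1` at `x = l / w`; weighted with `g` each
  -- sums to `1`, so they cancel in the total.
  have hpt : ∀ k i, g k i * Real.negMulLog (w k) ≤
      g k i * (w k * -Real.log (l i)) - g k i * w k + g k i * l i := by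
    intro k i
    rcases eq_or_ne (g k i) 0 with h0 | h0
    · simp [h0]
    rcases eq_or_ne (w k) 0 with hk | hk
    · simpa [hk] using mul_nonneg (hg k i) (hl0 i)
    -- `hsupp` excludes `l i = 0`, where the convention `Real.log 0 = 0` would hide an infinite
    -- cross term.
    have hlp : 0 < l i := lt_of_le_of_ne (hl0 i) (Ne.symm (hsupp k i h0 hk))
    have hwp : 0 < w k := lt_of_le_of_ne (hw0 k) (Ne.symm hk)
    have hlog := Real.log_le_sub_one_of_pos (div_pos hlp hwp)
    rw [Real.log_div hlp.ne' hwp.ne'] at hlog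
    have h5 : w k * (Real.log (l i) - Real.log (w k)) ≤ l i - w k := by
      calc _ ≤ w k * (l i / w k - 1) := mul_le_mul_of_nonneg_left hlog hwp.le
        _ = l i - w k := by field_simp
    have h6 : Real.negMulLog (w k) ≤ w k * -Real.log (l i) - w k + l i := by
      rw [Real.negMulLog]; linarith
    calc _ ≤ g k i * (w k * -Real.log (l i) - w k + l i) :=
          mul_le_mul_of_nonneg_left h6 (hg k i)
      _ = _ := by ring
  have hsum : Summable (fun p : κ × ι => g p.1 p.2 * Real.negMulLog (w p.1)) :=
    Summable.of_nonneg_of_le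
      (fun p => mul_nonneg (hg _ _) (Real.negMulLog_nonneg (hw0 _) (hw1 _)))
      (fun p => hpt p.1 p.2) h3.summable
  have h7 : HasSum (fun k => Real.negMulLog (w k))
      (∑' p : κ × ι, g p.1 p.2 * Real.negMulLog (w p.1)) :=
    hsum.hasSum.prod_fiberwise (fun k => by simpa using (hrow k).mul_right (Real.negMulLog (w k)))
  refine ⟨h7.summable, ?_⟩
  rw [h7.tsum_eq]
  have := hasSum_le (fun p : κ × ι => hpt p.1 p.2) hsum.hasSum h3
  linarith

end DoubleSums

/-! ### Hilbert bases and diagonal operators -/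

section Hilbert

variable {ι κ E : Type*} [NormedAddCommGroup E] [InnerProductSpace ℂ E]

theorem inner_self_eq_ofReal (x : E) : inner ℂ x x = ((‖x‖ ^ 2 : ℝ) : ℂ) := by
  rw [inner_self_eq_norm_sq_to_K]
  simp

theorem hasSum_normSq_inner (b : HilbertBasis ι ℂ E) (x : E) :
    HasSum (fun k => ‖inner ℂ (b k) x‖ ^ 2) (‖x‖ ^ 2) := by
  have h := b.hasSum_inner_mul_inner x x
  have h2 := Complex.hasSum_re h
  convert h2 using 1
  · funext k
    rw [← inner_conj_symm x (b k), ← Complex.normSq_eq_conj_mul_self, Complex.ofReal_re,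
      Complex.normSq_eq_norm_sq]
  · rw [inner_self_eq_norm_sq_to_K]; norm_cast

theorem hasSum_normSq_inner_right (b : HilbertBasis ι ℂ E) (x : E) :
    HasSum (fun k => ‖inner ℂ x (b k)‖ ^ 2) (‖x‖ ^ 2) := by
  simpa only [norm_inner_symm] using hasSum_normSq_inner b x

/-- By Parseval, the squared overlaps of two Hilbert bases form a doubly stochastic matrix. These
are the weights to which `klein_inequality` is applied. -/
theorem hasSum_overlap_left (b : HilbertBasis ι ℂ E) (b' : HilbertBasis κ ℂ E) (j : κ) :
    HasSum (fun k => ‖inner ℂ (b k) (b' j)‖ ^ 2) 1 := by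
  simpa [b'.orthonormal.1 j] using hasSum_normSq_inner b (b' j)

theorem hasSum_overlap_right (b : HilbertBasis ι ℂ E) (b' : HilbertBasis κ ℂ E) (k : ι) :
    HasSum (fun j => ‖inner ℂ (b k) (b' j)‖ ^ 2) 1 := by
  simpa [b.orthonormal.1 k] using hasSum_normSq_inner_right b' (b k)

theorem hasSum_inner_smul (b : HilbertBasis ι ℂ E) (x : E) :
    HasSum (fun k => inner ℂ (b k) x • b k) x :=
  (b.hasSum_repr x).of_fun_eq fun k => by rw [b.repr_apply_apply]

/-- An operator that is diagonal in a Hilbert basis. -/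
def IsDiag (ρ : E →L[ℂ] E) (b : HilbertBasis ι ℂ E) (w : ι → ℝ) : Prop :=
  ∀ k, ρ (b k) = (w k : ℂ) • b k

theorem IsDiag.hasSum_apply {ρ : E →L[ℂ] E} {b : HilbertBasis ι ℂ E} {w : ι → ℝ}
    (h : IsDiag ρ b w) (x : E) :
    HasSum (fun k => ((w k : ℂ) * inner ℂ (b k) x) • b k) (ρ x) := by
  refine ((hasSum_inner_smul b x).mapL ρ).of_fun_eq fun k => ?_
  rw [map_smul, h k, smul_smul, mul_comm]

theorem IsDiag.hasSum_inner {ρ : E →L[ℂ] E} {b : HilbertBasis ι ℂ E} {w : ι → ℝ}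
    (h : IsDiag ρ b w) (x y : E) :
    HasSum (fun k => (w k : ℂ) * inner ℂ x (b k) * inner ℂ (b k) y) (inner ℂ x (ρ y)) := by
  have h1 := (h.hasSum_apply y).mapL (innerSL ℂ x)
  refine h1.of_fun_eq fun k => ?_
  simp only [innerSL_apply_apply, inner_smul_right]
  ring

theorem IsDiag.hasSum_quad {ρ : E →L[ℂ] E} {b : HilbertBasis ι ℂ E} {w : ι → ℝ}
    (h : IsDiag ρ b w) (x : E) :
    HasSum (fun k => w k * ‖inner ℂ (b k) x‖ ^ 2) (inner ℂ x (ρ x)).re := by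
  convert Complex.hasSum_re (h.hasSum_inner x x) using 1
  funext k
  rw [← inner_conj_symm x (b k), mul_assoc, ← Complex.normSq_eq_conj_mul_self,
    Complex.normSq_eq_norm_sq]
  norm_cast

theorem IsDiag.inner_apply {ρ : E →L[ℂ] E} {b : HilbertBasis ι ℂ E} {w : ι → ℝ}
    (h : IsDiag ρ b w) (k : ι) : (inner ℂ (b k) (ρ (b k))).re = w k := by
  rw [h k, inner_smul_right, inner_self_eq_norm_sq_to_K, b.orthonormal.1 k]
  simp

theorem IsDiag.inner_apply_left {ρ : E →L[ℂ] E} {b : HilbertBasis ι ℂ E} {w : ι → ℝ}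
    (h : IsDiag ρ b w) (k : ι) (x : E) : inner ℂ (b k) (ρ x) = (w k : ℂ) * inner ℂ (b k) x := by
  classical
  have h1 := h.hasSum_inner (b k) x
  have h2 : HasSum (fun j => (w j : ℂ) * inner ℂ (b k) (b j) * inner ℂ (b j) x)
      ((w k : ℂ) * inner ℂ (b k) (b k) * inner ℂ (b k) x) := by
    apply hasSum_single
    intro j hj
    rw [b.orthonormal.2 (Ne.symm hj)]; simp
  rw [h1.unique h2, inner_self_eq_norm_sq_to_K, b.orthonormal.1 k]
  simp

theorem IsDiag.isPositive {ρ : E →L[ℂ] E} {b : HilbertBasis ι ℂ E} {w : ι → ℝ}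
    (h : IsDiag ρ b w) (hw : ∀ k, 0 ≤ w k) : ρ.IsPositive := by
  rw [ContinuousLinearMap.isPositive_def]
  refine ⟨fun x y => ?_, fun x => ?_⟩
  · have h1 := h.hasSum_inner x y
    have h2 := (h.hasSum_inner y x).star
    simp only [ContinuousLinearMap.coe_coe]
    rw [← inner_conj_symm]
    refine h2.unique (h1.of_fun_eq fun k => ?_)
    simp only [star_mul', RCLike.star_def, inner_conj_symm, Complex.conj_ofReal]
    ring
  · rw [ContinuousLinearMap.reApplyInnerSelf_apply]
    have := (h.hasSum_quad x).nonneg (fun k => mul_nonneg (hw k) (sq_nonneg _))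
    rw [← inner_conj_symm]
    simpa only [RCLike.re_to_complex, Complex.conj_re] using this

theorem IsDiag.nonneg {ρ : E →L[ℂ] E} {b : HilbertBasis ι ℂ E} {w : ι → ℝ}
    (h : IsDiag ρ b w) (hρ : ρ.IsPositive) (k : ι) : 0 ≤ w k := by
  rw [← h.inner_apply k]
  exact hρ.re_inner_nonneg_right _

/-- Tonelli for `w k * ‖⟨b k, f j⟩‖ ^ 2`, summed by rows or by columns: the trace of a positive
operator does not depend on the basis. -/
theorem IsDiag.hasSum_trace_iff {ρ : E →L[ℂ] E} {b : HilbertBasis ι ℂ E} {w : ι → ℝ}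
    (h : IsDiag ρ b w) (hw : ∀ k, 0 ≤ w k) (f : HilbertBasis κ ℂ E) (t : ℝ) :
    HasSum (fun j => (inner ℂ (f j) (ρ (f j))).re) t ↔ HasSum w t := by
  constructor
  · intro ht
    refine hasSum_swap (g := fun j k => w k * ‖inner ℂ (b k) (f j)‖ ^ 2)
      (fun j k => mul_nonneg (hw k) (sq_nonneg _)) (fun j => h.hasSum_quad (f j)) ht (fun k => ?_)
    simpa using (hasSum_overlap_right b f k).mul_left (w k)
  · intro ht
    refine hasSum_swap (g := fun k j => w k * ‖inner ℂ (b k) (f j)‖ ^ 2)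
      (fun k j => mul_nonneg (hw k) (sq_nonneg _)) (fun k => ?_) ht (fun j => h.hasSum_quad (f j))
    simpa using (hasSum_overlap_right b f k).mul_left (w k)

/-- Two diagonalisations of the same operator have the same eigenvalues with multiplicities. -/
theorem IsDiag.eq_of_inner_ne_zero {ρ : E →L[ℂ] E} {b : HilbertBasis ι ℂ E} {w : ι → ℝ}
    {b' : HilbertBasis κ ℂ E} {w' : κ → ℝ} (h : IsDiag ρ b w) (h' : IsDiag ρ b' w')
    {k : ι} {j : κ} (hkj : inner ℂ (b k) (b' j) ≠ 0) : w k = w' j := by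
  have h1 := h.inner_apply_left k (b' j)
  rw [h' j, inner_smul_right] at h1
  exact_mod_cast (mul_right_cancel₀ hkj h1).symm

/-- The doubly stochastic overlaps carry one series into the other. This makes entropy and partition
function independent of the chosen eigenbasis, which degeneracy leaves undetermined. -/
theorem hasSum_of_overlap_eq {b : HilbertBasis ι ℂ E} {b' : HilbertBasis κ ℂ E}
    {f : ι → ℝ} {f' : κ → ℝ} (hf : ∀ k, 0 ≤ f k)
    (h : ∀ k j, inner ℂ (b k) (b' j) ≠ 0 → f k = f' j) {S : ℝ} (hS : HasSum f S) :
    HasSum f' S := by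
  have hff : ∀ k j, f k * ‖inner ℂ (b k) (b' j)‖ ^ 2 = f' j * ‖inner ℂ (b k) (b' j)‖ ^ 2 := by
    intro k j
    by_cases hkj : inner ℂ (b k) (b' j) = 0
    · simp [hkj]
    · rw [h k j hkj]
  refine hasSum_swap (g := fun k j => f k * ‖inner ℂ (b k) (b' j)‖ ^ 2)
    (fun k j => mul_nonneg (hf k) (sq_nonneg _))
    (fun k => by simpa using (hasSum_overlap_right b b' k).mul_left (f k)) hS (fun j => ?_)
  simp only [hff]
  simpa using (hasSum_overlap_left b b' j).mul_left (f' j)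

theorem IsDiag.hasSum_negMulLog {ρ : E →L[ℂ] E} {b : HilbertBasis ι ℂ E} {w : ι → ℝ}
    {b' : HilbertBasis κ ℂ E} {w' : κ → ℝ} (h : IsDiag ρ b w) (h' : IsDiag ρ b' w')
    (hw : ∀ k, 0 ≤ w k) (hw1 : ∀ k, w k ≤ 1) {S : ℝ}
    (hS : HasSum (fun k => Real.negMulLog (w k)) S) :
    HasSum (fun k => Real.negMulLog (w' k)) S :=
  hasSum_of_overlap_eq (b := b) (b' := b') (fun k => Real.negMulLog_nonneg (hw k) (hw1 k))
    (fun _ _ hkj => by rw [h.eq_of_inner_ne_zero h' hkj]) hS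

end Hilbert

end

end RDM

namespace RDM

noncomputable section

/-! ### Spectral theorem for positive trace-class operators -/

section Spectral

variable {ι κ E F : Type*} [NormedAddCommGroup E] [InnerProductSpace ℂ E]
  [NormedAddCommGroup F] [InnerProductSpace ℂ F]

theorem exists_sqrt [CompleteSpace E] {ρ : E →L[ℂ] E} (hρ : ρ.IsPositive) :
    ∃ S : E →L[ℂ] E, (∀ x, ρ x = S (S x)) ∧ (∀ x y, inner ℂ (S x) y = inner ℂ x (S y)) ∧
      ∀ x y, inner ℂ x (ρ y) = inner ℂ (S x) (S y) := by
  have h0 : 0 ≤ ρ := (ContinuousLinearMap.nonneg_iff_isPositive ρ).2 hρ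
  have h1 := CFC.sqrt_mul_sqrt_self ρ h0
  have h2 : (CFC.sqrt ρ).IsPositive :=
    (ContinuousLinearMap.nonneg_iff_isPositive _).1 (CFC.sqrt_nonneg ρ)
  have h3 : ∀ x, ρ x = CFC.sqrt ρ (CFC.sqrt ρ x) := fun x => by
    conv_lhs => rw [← h1]
    rfl
  refine ⟨CFC.sqrt ρ, h3, h2.inner_left_eq_inner_right, fun x y => ?_⟩
  rw [h3 y, h2.inner_left_eq_inner_right]

/-- Hilbert–Schmidt operators are compact. -/
theorem isCompactOperator_of_summable_normSq [CompleteSpace F] (f : HilbertBasis ι ℂ E)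
    (T : E →L[ℂ] F)
    (hT : Summable fun k => ‖T (f k)‖ ^ 2) : IsCompactOperator T := by
  classical
  let TF : Finset ι → E →L[ℂ] F := fun s => ∑ k ∈ s, InnerProductSpace.rankOne ℂ (T (f k)) (f k)
  have hTF : ∀ s x, TF s x = ∑ k ∈ s, inner ℂ (f k) x • T (f k) := fun s x => by
    simp [TF]
  have hlim : ∀ x, Tendsto (fun s => TF s x) atTop (𝓝 (T x)) := fun x => by
    refine Tendsto.congr (fun s => ?_) ((hasSum_inner_smul f x).mapL T)
    rw [hTF]
    exact Finset.sum_congr rfl fun k _ => map_smul _ _ _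
  have hfin : ∀ s, IsCompactOperator (TF s) := fun s => by
    have : ∀ k, IsCompactOperator (InnerProductSpace.rankOne ℂ (T (f k)) (f k)) := fun k => by
      have h1 : IsCompactOperator (ContinuousLinearMap.id ℂ ℂ) :=
        (isCompactOperator_id_iff_finiteDimensional (𝕜 := ℂ)).2 inferInstance
      have h2 := (h1.comp_clm (innerSL ℂ (f k))).clm_comp
        (ContinuousLinearMap.toSpanSingleton ℂ (T (f k)))
      exact h2
    simp only [TF]
    induction s using Finset.induction_on with
    | empty => simpa using isCompactOperator_zero
    | insert a s ha ih =>
      rw [Finset.sum_insert ha]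
      exact (this a).add ih
  set t := ∑' k, ‖T (f k)‖ ^ 2
  -- Cauchy–Schwarz bounds the distance to the finite-rank truncation by the tail of the
  -- Hilbert–Schmidt series.
  have hbound : ∀ s, ‖TF s - T‖ ≤ Real.sqrt (t - ∑ k ∈ s, ‖T (f k)‖ ^ 2) := by
    intro s
    refine ContinuousLinearMap.opNorm_le_bound _ (Real.sqrt_nonneg _) fun x => ?_
    have h1 : Tendsto (fun g => ‖TF s x - TF g x‖) atTop (𝓝 ‖TF s x - T x‖) :=
      (tendsto_const_nhds.sub (hlim x)).norm
    refine le_of_tendsto h1 ((eventually_ge_atTop s).mono fun g hg => ?_)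
    have h2 : TF s x - TF g x = - ∑ k ∈ g \ s, inner ℂ (f k) x • T (f k) := by
      rw [hTF, hTF, ← Finset.sum_sdiff hg]; abel
    rw [h2, norm_neg]
    calc ‖∑ k ∈ g \ s, inner ℂ (f k) x • T (f k)‖
        ≤ ∑ k ∈ g \ s, ‖T (f k)‖ * ‖inner ℂ (f k) x‖ := by
          refine (norm_sum_le _ _).trans (Finset.sum_le_sum fun k _ => ?_)
          rw [norm_smul, mul_comm]
      _ ≤ Real.sqrt (∑ k ∈ g \ s, ‖T (f k)‖ ^ 2) *
            Real.sqrt (∑ k ∈ g \ s, ‖inner ℂ (f k) x‖ ^ 2) :=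
          Real.sum_mul_le_sqrt_mul_sqrt _ _ _
      _ ≤ Real.sqrt (t - ∑ k ∈ s, ‖T (f k)‖ ^ 2) * ‖x‖ := by
          gcongr
          · rw [le_sub_iff_add_le, Finset.sum_sdiff hg]
            exact hT.sum_le_tsum _ (fun k _ => sq_nonneg _)
          · rw [Real.sqrt_le_left (norm_nonneg _)]
            exact sum_le_hasSum _ (fun k _ => sq_nonneg _) (hasSum_normSq_inner f x)
  refine isCompactOperator_of_tendsto (l := atTop) (F := TF) ?_ (Eventually.of_forall hfin)
  rw [tendsto_iff_norm_sub_tendsto_zero]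
  refine squeeze_zero (fun _ => norm_nonneg _) hbound ?_
  have h3 : Tendsto (fun s => t - ∑ k ∈ s, ‖T (f k)‖ ^ 2) atTop (𝓝 (t - t)) :=
    tendsto_const_nhds.sub hT.hasSum
  rw [sub_self] at h3
  have h4 := (Real.continuous_sqrt.tendsto 0).comp h3
  rwa [Real.sqrt_zero] at h4

/-- Every `b j` overlaps with some `f k`, and every `f k` overlaps with only countably many `b j`,
since its squared overlaps are summable. -/
theorem countable_of_hilbertBasis (f : HilbertBasis ι ℂ E) (b : HilbertBasis κ ℂ E)
    [Countable ι] : Countable κ := by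
  have h1 : (Set.univ : Set κ) = ⋃ k : ι, Function.support fun j => ‖inner ℂ (f k) (b j)‖ ^ 2 := by
    refine Eq.symm (Set.eq_univ_of_forall fun j => ?_)
    rw [Set.mem_iUnion]
    by_contra! hcon
    have h2 := hasSum_overlap_left f b j
    have h3 : (fun k => ‖inner ℂ (f k) (b j)‖ ^ 2) = fun _ => 0 := by
      funext k
      simpa using hcon k
    rw [h3] at h2
    exact one_ne_zero (h2.unique hasSum_zero)
  rw [← Set.countable_univ_iff, h1]
  exact Set.countable_iUnion fun k => (hasSum_overlap_right f b k).summable.countable_support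

theorem finiteDimensional_of_hilbertBasis (f : HilbertBasis ι ℂ E) [Finite ι] :
    FiniteDimensional ℂ E := by
  have := Fintype.ofFinite ι
  exact f.toOrthonormalBasis.toBasis.finiteDimensional_of_finite

theorem finite_of_hilbertBasis (f : HilbertBasis ι ℂ E) (b : HilbertBasis κ ℂ E)
    [Finite ι] : Finite κ := by
  have := finiteDimensional_of_hilbertBasis f
  exact b.orthonormal.linearIndependent.finite

theorem nonempty_equiv_of_hilbertBasis (f : HilbertBasis ι ℂ E) (b : HilbertBasis κ ℂ E)
    [Countable ι] : Nonempty (κ ≃ ι) := by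
  have := countable_of_hilbertBasis f b
  cases finite_or_infinite ι with
  | inl h =>
    have := finite_of_hilbertBasis f b
    have := Fintype.ofFinite ι
    have := Fintype.ofFinite κ
    have h1 := Module.finrank_eq_card_basis f.toOrthonormalBasis.toBasis
    have h2 := Module.finrank_eq_card_basis b.toOrthonormalBasis.toBasis
    exact ⟨Fintype.equivOfCardEq (by omega)⟩
  | inr h =>
    have : Infinite κ := by
      by_contra hk
      rw [not_infinite_iff_finite] at hk
      exact (not_finite_iff_infinite.2 h) (finite_of_hilbertBasis b f)
    exact nonempty_equiv_of_countable

theorem span_orthogonal_eq_bot {v : κ → E} (hv : ∀ x, (∀ k, inner ℂ (v k) x = 0) → x = 0) :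
    (Submodule.span ℂ (Set.range v))ᗮ = ⊥ := by
  rw [Submodule.eq_bot_iff]
  intro x hx
  exact hv x fun k => (Submodule.mem_orthogonal _ _).1 hx _ (Submodule.subset_span ⟨k, rfl⟩)

/-- An eigenbasis comes indexed by eigenvalues and bases of eigenspaces, while the definitions of
energy and entropy ask for the index type of the number basis. Equality of Hilbert dimensions allows
the reindexing. -/
theorem exists_hilbertBasis_of_orthonormal [CompleteSpace E] [Countable ι] (f : HilbertBasis ι ℂ E)
    {v : κ → E} (hv : Orthonormal ℂ v) (hv' : ∀ x, (∀ k, inner ℂ (v k) x = 0) → x = 0) :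
    ∃ (b : HilbertBasis ι ℂ E) (e : ι ≃ κ), ∀ i, b i = v (e i) := by
  obtain ⟨e⟩ := nonempty_equiv_of_hilbertBasis f
    (HilbertBasis.mkOfOrthogonalEqBot hv (span_orthogonal_eq_bot hv'))
  have h1 : ∀ x, (∀ k, inner ℂ ((v ∘ e.symm) k) x = 0) → x = 0 := fun x hx =>
    hv' x fun k => by simpa using hx (e k)
  have h2 : Orthonormal ℂ (v ∘ e.symm) := hv.comp e.symm e.symm.injective
  refine ⟨HilbertBasis.mkOfOrthogonalEqBot h2 (span_orthogonal_eq_bot h1), e.symm, fun i => ?_⟩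
  rw [HilbertBasis.coe_mkOfOrthogonalEqBot]
  rfl

/-- Spectral theorem for positive operators of trace class. -/
theorem exists_isDiag [CompleteSpace E] [Countable ι] (f : HilbertBasis ι ℂ E) {ρ : E →L[ℂ] E}
    (hρ : ρ.IsPositive) (ht : Summable fun k => (inner ℂ (f k) (ρ (f k))).re) :
    ∃ (b : HilbertBasis ι ℂ E) (w : ι → ℝ), IsDiag ρ b w := by
  classical
  obtain ⟨S, hS, -, hS'⟩ := exists_sqrt hρ
  -- The trace of `ρ` is the squared Hilbert–Schmidt norm of its square root `S`; compactness of `ρ`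
  -- follows from that of `S`.
  have hScomp : IsCompactOperator S := by
    refine isCompactOperator_of_summable_normSq f S (ht.congr fun k => ?_)
    rw [hS', inner_self_eq_norm_sq_to_K]
    norm_cast
  have hcomp : IsCompactOperator ρ := by
    have : (ρ : E → E) = S ∘ S := funext hS
    rw [this]
    exact hScomp.comp_clm S
  have hsymm : (ρ : E →ₗ[ℂ] E).IsSymmetric := hρ.isSymmetric
  have horth := hsymm.orthogonalFamily_eigenspaces
  have hcompl : ∀ μ, CompleteSpace (Module.End.eigenspace (ρ : E →ₗ[ℂ] E) μ) := fun μ => by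
    have : IsClosed (Module.End.eigenspace (ρ : E →ₗ[ℂ] E) μ : Set E) := by
      have h1 : (Module.End.eigenspace (ρ : E →ₗ[ℂ] E) μ : Set E) = {x | ρ x = μ • x} := by
        ext x; simp
      rw [h1]
      exact isClosed_eq ρ.continuous (continuous_const_smul μ)
    exact this.completeSpace_coe
  choose I B hB using fun μ => exists_hilbertBasis ℂ (Module.End.eigenspace (ρ : E →ₗ[ℂ] E) μ)
  let v : (Σ μ, I μ) → E := fun p => (B p.1 p.2 : Module.End.eigenspace (ρ : E →ₗ[ℂ] E) p.1)
  have hv : Orthonormal ℂ v :=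
    horth.orthonormal_sigma_orthonormal (fun μ => (B μ).orthonormal)
  have hv' : ∀ x, (∀ p, inner ℂ (v p) x = 0) → x = 0 := by
    intro x hx
    have hbot := ContinuousLinearMap.orthogonalComplement_iSup_eigenspaces_eq_bot hcomp hsymm
    rw [Submodule.eq_bot_iff] at hbot
    refine hbot x ?_
    rw [Submodule.mem_orthogonal]
    intro u hu
    refine Submodule.iSup_induction' _ (motive := fun u _ => inner ℂ u x = 0) ?_ ?_ ?_ hu
    · intro μ u hu
      have h1 := (B μ).hasSum_repr ⟨u, hu⟩
      have h2 := h1.mapL (Submodule.subtypeL _)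
      have h3 := h2.mapL (innerSL ℂ x)
      have h4 : HasSum (fun _ : I μ => (0 : ℂ)) (innerSL ℂ x u) := by
        refine h3.of_fun_eq fun i => ?_
        have := hx ⟨μ, i⟩
        rw [← inner_conj_symm, map_eq_zero] at this
        simp only [map_smul, innerSL_apply_apply, smul_eq_mul]
        symm
        exact mul_eq_zero_of_right _ this
      rw [← inner_conj_symm, map_eq_zero]
      exact h4.unique hasSum_zero
    · simp
    · intro a b _ _ ha hb
      rw [inner_add_left, ha, hb, add_zero]
  obtain ⟨b, e, hb⟩ := exists_hilbertBasis_of_orthonormal f hv hv'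
  have hev : ∀ p, ρ (v p) = p.1 • v p := fun p =>
    Module.End.mem_eigenspace_iff.1 (B p.1 p.2).2
  refine ⟨b, fun i => (e i).1.re, fun i => ?_⟩
  have hne : v (e i) ≠ 0 := by
    rw [← norm_ne_zero_iff, hv.1]; exact one_ne_zero
  have hreal : (starRingEnd ℂ) (e i).1 = (e i).1 :=
    hsymm.conj_eigenvalue_eq_self
      (Module.End.hasEigenvalue_of_hasEigenvector ⟨(B (e i).1 (e i).2).2, hne⟩)
  rw [hb, hev, Complex.conj_eq_iff_re.1 hreal]

end Spectral

end

end RDM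

namespace RDM

noncomputable section

/-! ### States lifted to the form domain -/

section EnergyOperator

-- With `J` the inclusion of the form domain and `ξ k` a lift of `b k`, the operator `R = ∑ w_k
-- |ξ_k⟩⟨ξ_k|` satisfies `J R J* = ρ`, and its trace is the energy up to a shift. The point is that
-- the conditions on `R` are linear and refer to no eigenbasis, whereas the energy is defined
-- through one.
open ContinuousLinearMap in
theorem exists_energyOperator {ι E G : Type*} [NormedAddCommGroup E] [InnerProductSpace ℂ E]
    [NormedAddCommGroup G] [InnerProductSpace ℂ G] [CompleteSpace E] [CompleteSpace G]
    {J : G →L[ℂ] E} {ρ : E →L[ℂ] E}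
    {b : HilbertBasis ι ℂ E} {w : ι → ℝ} (h : IsDiag ρ b w) (hw : ∀ k, 0 ≤ w k) {ξ : ι → G}
    (hξ : ∀ k, w k ≠ 0 → J (ξ k) = b k) {τ : ℝ} (hτ : HasSum (fun k => w k * ‖ξ k‖ ^ 2) τ) :
    ∃ R : G →L[ℂ] G, R.IsPositive ∧ (∀ x, J (R (adjoint J x)) = ρ x) ∧
      ∀ {κ : Type _} (f : HilbertBasis κ ℂ G),
        HasSum (fun i => (inner ℂ (f i) (R (f i))).re) τ := by
  have hsum : Summable fun k => (w k : ℂ) • InnerProductSpace.rankOne ℂ (ξ k) (ξ k) := by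
    refine Summable.of_norm (hτ.summable.congr fun k => ?_)
    rw [norm_smul, InnerProductSpace.norm_rankOne, Complex.norm_real, Real.norm_eq_abs,
      abs_of_nonneg (hw k), sq]
  set R := ∑' k, (w k : ℂ) • InnerProductSpace.rankOne ℂ (ξ k) (ξ k) with hR
  have happ : ∀ x, HasSum (fun k => ((w k : ℂ) * inner ℂ (ξ k) x) • ξ k) (R x) := fun x => by
    refine (hsum.hasSum.mapL (ContinuousLinearMap.apply ℂ G x)).of_fun_eq fun k => ?_
    rw [mul_smul]
    simp
  have hinner : ∀ x y, HasSum (fun k => (w k : ℂ) * inner ℂ x (ξ k) * inner ℂ (ξ k) y)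
      (inner ℂ x (R y)) := fun x y => by
    refine ((happ y).mapL (innerSL ℂ x)).of_fun_eq fun k => ?_
    simp only [innerSL_apply_apply, inner_smul_right]
    ring
  have hquad : ∀ x, HasSum (fun k => w k * ‖inner ℂ (ξ k) x‖ ^ 2) (inner ℂ x (R x)).re :=
    fun x => by
      refine (Complex.hasSum_re (hinner x x)).of_fun_eq fun k => ?_
      rw [← inner_conj_symm x (ξ k), mul_assoc, ← Complex.normSq_eq_conj_mul_self,
        Complex.normSq_eq_norm_sq]
      norm_cast
  refine ⟨R, ?_, ?_, ?_⟩
  · rw [ContinuousLinearMap.isPositive_def]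
    refine ⟨fun x y => ?_, fun x => ?_⟩
    · have h1 := hinner x y
      have h2 := (hinner y x).star
      simp only [ContinuousLinearMap.coe_coe]
      rw [← inner_conj_symm]
      refine h2.unique (h1.of_fun_eq fun k => ?_)
      simp only [star_mul', RCLike.star_def, inner_conj_symm, Complex.conj_ofReal]
      ring
    · rw [ContinuousLinearMap.reApplyInnerSelf_apply]
      have := (hquad x).nonneg (fun k => mul_nonneg (hw k) (sq_nonneg _))
      rw [← inner_conj_symm]
      simpa only [RCLike.re_to_complex, Complex.conj_re] using this
  · intro x
    refine ((happ (adjoint J x)).mapL J).unique ((h.hasSum_apply x).of_fun_eq fun k => ?_)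
    rcases eq_or_ne (w k) 0 with h0 | h0
    · simp [h0]
    · rw [map_smul, adjoint_inner_right, hξ k h0]
  · intro κ f
    refine hasSum_swap (g := fun k i => w k * ‖inner ℂ (ξ k) (f i)‖ ^ 2)
      (fun k i => mul_nonneg (hw k) (sq_nonneg _)) (fun k => ?_) hτ (fun i => hquad (f i))
    exact (hasSum_normSq_inner_right f (ξ k)).mul_left (w k)

-- Converse of `exists_energyOperator`, for an arbitrary eigenbasis of `ρ`. The lifts are `ξ_k =
-- w_k⁻¹ R J* b_k`. With `S = √R`, the vectors `v_k = w_k^(-1/2) S J* b_k` are orthonormal and `w_k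
-- ‖ξ_k‖² = ‖S v_k‖²`, so Bessel's inequality bounds the sum by `tr R`. An inequality is all that
-- convexity needs.
open ContinuousLinearMap in
theorem exists_energyVectors {ι κ E G : Type*} [NormedAddCommGroup E] [InnerProductSpace ℂ E]
    [NormedAddCommGroup G] [InnerProductSpace ℂ G] [CompleteSpace E] [CompleteSpace G]
    {J : G →L[ℂ] E} {ρ : E →L[ℂ] E}
    {b : HilbertBasis ι ℂ E} {w : ι → ℝ} (h : IsDiag ρ b w) (hw : ∀ k, 0 ≤ w k)
    {R : G →L[ℂ] G} (hR : R.IsPositive) (hJ : ∀ x, J (R (adjoint J x)) = ρ x)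
    (f : HilbertBasis κ ℂ G) {τ : ℝ} (hτ : HasSum (fun i => (inner ℂ (f i) (R (f i))).re) τ) :
    ∃ ξ : ι → G, (∀ k, w k ≠ 0 → J (ξ k) = b k) ∧ Summable (fun k => w k * ‖ξ k‖ ^ 2) ∧
      ∑' k, w k * ‖ξ k‖ ^ 2 ≤ τ := by
  classical
  obtain ⟨S, hS, hsw, hS'⟩ := exists_sqrt hR
  have hSf : HasSum (fun i => ‖S (f i)‖ ^ 2) τ := hτ.of_fun_eq fun i => by
    rw [hS', inner_self_eq_norm_sq_to_K]
    norm_cast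
  let v : {k // w k ≠ 0} → G := fun k => ((Real.sqrt (w k))⁻¹ : ℂ) • S (adjoint J (b k))
  have hsq : ∀ k : {k // w k ≠ 0}, Real.sqrt (w k) * Real.sqrt (w k) = w k := fun k =>
    Real.mul_self_sqrt (hw k)
  have hsq0 : ∀ k : {k // w k ≠ 0}, Real.sqrt (w k) ≠ 0 := fun k =>
    (Real.sqrt_pos.2 (lt_of_le_of_ne (hw k) (Ne.symm k.2))).ne'
  -- Their Gram matrix is that of `J R J* = ρ` in its eigenbasis, divided by the square roots of the
  -- weights.
  have hv : Orthonormal ℂ v := by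
    rw [orthonormal_iff_ite]
    intro k l
    have h1 : inner ℂ (S (adjoint J (b k))) (S (adjoint J (b l)))
        = (w l : ℂ) * if k = l then 1 else 0 := by
      rw [← hS', adjoint_inner_left, hJ, h l, inner_smul_right,
        orthonormal_iff_ite.1 b.orthonormal]
      simp [Subtype.ext_iff]
    simp only [v, inner_smul_left, inner_smul_right, h1, map_inv₀, Complex.conj_ofReal]
    split_ifs with hkl
    · subst hkl
      have h2 : (Real.sqrt (w k) : ℂ) ≠ 0 := by exact_mod_cast hsq0 k
      have h3 : (w k : ℂ) = Real.sqrt (w k) * Real.sqrt (w k) := by exact_mod_cast (hsq k).symm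
      rw [h3]
      field_simp
    · simp
  let ξ : ι → G := fun k => ((w k : ℂ))⁻¹ • R (adjoint J (b k))
  have hξ : ∀ k : {k // w k ≠ 0}, w k * ‖ξ k‖ ^ 2 = ‖S (v k)‖ ^ 2 := by
    intro k
    simp only [ξ, v, map_smul, norm_smul, ← hS, norm_inv, Complex.norm_real, Real.norm_eq_abs,
      abs_of_nonneg (hw k), abs_of_nonneg (Real.sqrt_nonneg _), mul_pow, inv_pow]
    rw [Real.sq_sqrt (hw k)]
    have := k.2
    field_simp
  have hbound : ∀ F : Finset ι, ∑ k ∈ F, w k * ‖ξ k‖ ^ 2 ≤ τ := by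
    intro F
    have h1 : ∑ k ∈ F, w k * ‖ξ k‖ ^ 2 = ∑ k ∈ F.subtype (fun k => w k ≠ 0), ‖S (v k)‖ ^ 2 := by
      rw [← Finset.sum_filter_of_ne (p := fun k => w k ≠ 0)
        (fun k _ hk h0 => hk (by rw [h0, zero_mul])), ← Finset.sum_subtype_eq_sum_filter]
      exact Finset.sum_congr rfl fun k _ => hξ k
    rw [h1]
    refine hasSum_le (fun i => ?_)
      (hasSum_sum fun k (_ : k ∈ F.subtype (fun k => w k ≠ 0)) => hasSum_normSq_inner f (S (v k)))
      hSf
    refine le_trans (le_of_eq (Finset.sum_congr rfl fun k _ => ?_))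
      (hv.sum_inner_products_le (S (f i)) (s := F.subtype (fun k => w k ≠ 0)))
    rw [← hsw, norm_inner_symm]
  refine ⟨ξ, fun k hk => ?_, ?_, ?_⟩
  · simp only [ξ, map_smul, hJ, h k, smul_smul]
    rw [inv_mul_cancel₀ (by exact_mod_cast hk), one_smul]
  · exact summable_of_sum_le (fun k => mul_nonneg (hw k) (sq_nonneg _)) hbound
  · exact Real.tsum_le_of_sum_le (fun k => mul_nonneg (hw k) (sq_nonneg _)) hbound

end EnergyOperator

end

end RDM

namespace RDM

noncomputable section

/-! ### Fock space in the number basis -/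

section FockBasics

variable {s : Statistics} {n : ℕ}

theorem toFock_single (k : Occ s n) (c : ℂ) : toFock (Finsupp.single k c) = c • ket k := by
  simp [toFock]

theorem ket_apply (k l : Occ s n) : (ket k : Fock s n) l = if l = k then 1 else 0 := by
  classical
  rw [ket, lp.single_apply]
  by_cases h : l = k
  · subst h; simp
  · simp [h]

theorem inner_ket (k : Occ s n) (ψ : Fock s n) : inner ℂ (ket k) ψ = ψ k := by
  rw [ket, lp.inner_single_left]
  simp

theorem toFock_apply (φ : PreFock s n) (k : Occ s n) : toFock φ k = φ k := by
  classical
  induction φ using Finsupp.induction_linear with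
  | zero => simp
  | add f g hf hg => simp [hf, hg]
  | single l c =>
    rw [toFock_single, lp.coeFn_smul, Pi.smul_apply, ket_apply, Finsupp.single_apply]
    by_cases h : k = l
    · subst h; simp
    · simp [h, Ne.symm h]

theorem toFock_injective : Function.Injective (toFock (s := s) (n := n)) := fun φ ψ h => by
  ext k
  rw [← toFock_apply, h, toFock_apply]

theorem inner_toFock (φ : PreFock s n) (ψ : Fock s n) :
    inner ℂ (toFock φ) ψ = ∑ k ∈ φ.support, (starRingEnd ℂ) (φ k) * ψ k := by
  rw [toFock, Finsupp.linearCombination_apply, Finsupp.sum, sum_inner]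
  exact Finset.sum_congr rfl fun k _ => by rw [inner_smul_left, inner_ket]

theorem norm_toFock_sq (φ : PreFock s n) : ‖toFock φ‖ ^ 2 = ∑ k ∈ φ.support, ‖φ k‖ ^ 2 := by
  have h := inner_toFock φ (toFock φ)
  rw [inner_self_eq_norm_sq_to_K] at h
  have h2 : ((‖toFock φ‖ ^ 2 : ℝ) : ℂ) = ((∑ k ∈ φ.support, ‖φ k‖ ^ 2 : ℝ) : ℂ) := by
    push_cast
    refine h.trans (Finset.sum_congr rfl fun k _ => ?_)
    rw [toFock_apply, ← Complex.normSq_eq_conj_mul_self, Complex.normSq_eq_norm_sq]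
    push_cast; rfl
  exact_mod_cast h2

theorem orthonormal_ket : Orthonormal ℂ (ket (s := s) (n := n)) := by
  classical
  rw [orthonormal_iff_ite]
  intro k l
  rw [inner_ket, ket_apply]

variable (s n) in
/-- The number basis. -/
def ketBasis : HilbertBasis (Occ s n) ℂ (Fock s n) :=
  HilbertBasis.mkOfOrthogonalEqBot orthonormal_ket (span_orthogonal_eq_bot fun x hx => by
    ext k
    simpa [inner_ket] using hx k)

@[simp] theorem ketBasis_apply (k : Occ s n) : ketBasis s n k = ket k := by
  simp [ketBasis]

theorem eq_zero_of_inner_toFock {ψ : Fock s n} (h : ∀ φ : PreFock s n, inner ℂ (toFock φ) ψ = 0) :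
    ψ = 0 := by
  ext k
  have := h (Finsupp.single k 1)
  rw [toFock_single, one_smul, inner_ket] at this
  simpa using this

theorem hasSum_ket (ψ : Fock s n) : HasSum (fun k => ‖ψ k‖ ^ 2) (‖ψ‖ ^ 2) := by
  simpa [inner_ket] using hasSum_normSq_inner (ketBasis s n) ψ

end FockBasics

/-! ### Closed quadratic forms -/

section FormSpace

variable {s : Statistics} {n : ℕ}

theorem form_add_left (A : Module.End ℂ (PreFock s n)) (φ ψ χ : PreFock s n) :
    form A (φ + ψ) χ = form A φ χ + form A ψ χ := by
  simp [form]

theorem IsHermitianOp.form_conj {A : Module.End ℂ (PreFock s n)} (hA : IsHermitianOp A)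
    (φ ψ : PreFock s n) : (starRingEnd ℂ) (form A ψ φ) = form A φ ψ := by
  rw [hA φ ψ, form, inner_conj_symm]

theorem IsHermitianOp.form_self {A : Module.End ℂ (PreFock s n)} (hA : IsHermitianOp A)
    (φ : PreFock s n) : form A φ φ = (quad A φ : ℂ) := by
  rw [quad, Complex.conj_eq_iff_re.1 (hA.form_conj φ φ)]

theorem quad_smul (A : Module.End ℂ (PreFock s n)) (c : ℂ) (φ : PreFock s n) :
    quad A (c • φ) = ‖c‖ ^ 2 * quad A φ := by
  simp only [quad, form, map_smul, inner_smul_left, inner_smul_right, ← mul_assoc]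
  rw [mul_comm c, ← Complex.normSq_eq_conj_mul_self, Complex.normSq_eq_norm_sq,
    Complex.re_ofReal_mul]

theorem quad_add_op (A B : Module.End ℂ (PreFock s n)) (φ : PreFock s n) :
    quad (A + B) φ = quad A φ + quad B φ := by
  simp [quad, form]

/-- The form domain of an operator with `A ≥ -C`, as a Hilbert space that is embedded in Fock
space. Its inner product extends `⟨φ|(A + C + 1) ψ⟩`. -/
structure FormSpace (A : Module.End ℂ (PreFock s n)) (C : ℝ) where
  carrier : Type
  [normed : NormedAddCommGroup carrier]
  [innerProduct : InnerProductSpace ℂ carrier]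
  [complete : CompleteSpace carrier]
  J : carrier →L[ℂ] Fock s n
  emb : PreFock s n →ₗ[ℂ] carrier
  dense : DenseRange emb
  J_emb : ∀ φ, J (emb φ) = toFock φ
  J_injective : Function.Injective J
  inner_emb : ∀ φ ξ, inner ℂ (emb φ) ξ =
    inner ℂ (toFock (A φ)) (J ξ) + ((C + 1 : ℝ) : ℂ) * inner ℂ (toFock φ) (J ξ)

attribute [instance] FormSpace.normed FormSpace.innerProduct FormSpace.complete

/-- The carrier is the completion of pre-Fock space in the form norm. The shift by `C + 1` rather
than `C` makes this norm dominate the Fock norm, so that the inclusion extends continuously. -/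
theorem exists_formSpace {A : Module.End ℂ (PreFock s n)} (hA : IsHermitianOp A) {C : ℝ}
    (hC : ∀ φ, -C * ‖toFock φ‖ ^ 2 ≤ quad A φ) :
    Nonempty (FormSpace A C) := by
  let core : InnerProductSpace.Core ℂ (PreFock s n) :=
    { inner := fun φ ψ => form A φ ψ + ((C + 1 : ℝ) : ℂ) * inner ℂ (toFock φ) (toFock ψ)
      conj_inner_symm := fun φ ψ => by
        rw [map_add, map_mul, Complex.conj_ofReal, hA.form_conj, inner_conj_symm]
      re_inner_nonneg := fun φ => by
        have := hC φ
        rw [inner_self_eq_norm_sq_to_K]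
        have h2 : (form A φ φ + ((C + 1 : ℝ) : ℂ) * ((‖toFock φ‖ : ℂ)) ^ 2).re
            = quad A φ + (C + 1) * ‖toFock φ‖ ^ 2 := by
          rw [hA.form_self]; norm_cast
        refine le_of_le_of_eq ?_ h2.symm
        nlinarith [sq_nonneg ‖toFock φ‖]
      add_left := fun φ ψ χ => by
        rw [form_add_left, map_add, inner_add_left]; ring
      smul_left := fun φ ψ c => by
        simp only [form, map_smul, inner_smul_left]; ring
      definite := fun φ h => by
        have := hC φ
        rw [inner_self_eq_norm_sq_to_K] at h
        have h2 : (form A φ φ + ((C + 1 : ℝ) : ℂ) * ((‖toFock φ‖ : ℂ)) ^ 2).re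
            = quad A φ + (C + 1) * ‖toFock φ‖ ^ 2 := by
          rw [hA.form_self]; norm_cast
        have h3 : quad A φ + (C + 1) * ‖toFock φ‖ ^ 2 = 0 := by
          rw [← h2]; exact congrArg Complex.re h
        have h4 : ‖toFock φ‖ ^ 2 ≤ 0 := by linarith
        have h5 : toFock φ = 0 := by
          rw [← norm_eq_zero]
          exact pow_eq_zero_iff two_ne_zero |>.1 (le_antisymm h4 (sq_nonneg _))
        exact toFock_injective (by rw [h5, map_zero]) }
  let : NormedAddCommGroup (PreFock s n) := core.toNormedAddCommGroup
  let : InnerProductSpace ℂ (PreFock s n) := InnerProductSpace.ofCore core.toCore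
  have hinner : ∀ φ ψ : PreFock s n, inner ℂ φ ψ =
      form A φ ψ + ((C + 1 : ℝ) : ℂ) * inner ℂ (toFock φ) (toFock ψ) := fun φ ψ => rfl
  have hnorm : ∀ φ : PreFock s n, ‖toFock φ‖ ≤ 1 * ‖φ‖ := fun φ => by
    rw [one_mul, ← abs_of_nonneg (norm_nonneg (toFock φ)), ← abs_of_nonneg (norm_nonneg φ),
      ← sq_le_sq, ← inner_self_eq_norm_sq (𝕜 := ℂ) φ, hinner, inner_self_eq_norm_sq_to_K,
      hA.form_self]
    have := hC φ
    have h2 : ((quad A φ : ℂ) + ((C + 1 : ℝ) : ℂ) * ((‖toFock φ‖ : ℂ)) ^ 2).re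
            = quad A φ + (C + 1) * ‖toFock φ‖ ^ 2 := by norm_cast
    refine le_of_le_of_eq ?_ h2.symm
    nlinarith [sq_nonneg ‖toFock φ‖]
  let T : PreFock s n →L[ℂ] Fock s n := LinearMap.mkContinuous toFock 1 hnorm
  let e : PreFock s n →L[ℂ] UniformSpace.Completion (PreFock s n) :=
    UniformSpace.Completion.toComplL
  have hde : DenseRange e := UniformSpace.Completion.denseRange_coe
  have hue : IsUniformInducing e := UniformSpace.Completion.isUniformInducing_coe _
  let J := T.extend e
  have hJ : ∀ φ, J (e φ) = toFock φ := fun φ => T.extend_eq hde hue φ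
  have hid : ∀ φ ξ, inner ℂ (e φ) ξ =
        inner ℂ (toFock (A φ)) (J ξ) + ((C + 1 : ℝ) : ℂ) * inner ℂ (toFock φ) (J ξ) := by
    intro φ ξ
    refine hde.induction_on (p := fun ξ => inner ℂ (e φ) ξ =
        inner ℂ (toFock (A φ)) (J ξ) + ((C + 1 : ℝ) : ℂ) * inner ℂ (toFock φ) (J ξ)) ξ ?_ ?_
    · exact isClosed_eq (by fun_prop) (by fun_prop)
    · intro ψ
      rw [hJ, ← hA φ ψ]
      exact (UniformSpace.Completion.inner_coe φ ψ).trans (hinner φ ψ)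
  refine ⟨⟨UniformSpace.Completion (PreFock s n), J, e.toLinearMap, hde, hJ, ?_, hid⟩⟩
  rw [injective_iff_map_eq_zero]
  intro ξ hξ
  -- Closability of the form: by `hid`, the inner product with a vector of the dense range depends
  -- only on `J ξ`.
  have h1 : ∀ φ, inner ℂ ξ (e φ) = 0 := fun φ => by
    rw [← inner_conj_symm, hid, hξ]; simp
  exact hde.eq_zero_of_inner_left ℂ h1

namespace FormSpace

variable {A : Module.End ℂ (PreFock s n)} {C : ℝ} (Q : FormSpace A C)

theorem norm_emb_sq (φ : PreFock s n) :
    ‖Q.emb φ‖ ^ 2 = quad A φ + (C + 1) * ‖toFock φ‖ ^ 2 := by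
  have h := congrArg Complex.re (Q.inner_emb φ (Q.emb φ))
  rw [Q.J_emb, inner_self_eq_ofReal, inner_self_eq_ofReal] at h
  have h1 : (inner ℂ (toFock (A φ)) (toFock φ)).re = quad A φ := by
    rw [quad, form, ← inner_conj_symm, Complex.conj_re]
  rwa [Complex.add_re, h1, Complex.ofReal_re, Complex.re_ofReal_mul, Complex.ofReal_re] at h

theorem quad_eq (φ : PreFock s n) :
    quad A φ = ‖Q.emb φ‖ ^ 2 - (C + 1) * ‖toFock φ‖ ^ 2 := by
  rw [Q.norm_emb_sq]; ring

theorem exists_tendsto {ψ : Fock s n} {φ : ℕ → PreFock s n}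
    (h1 : Tendsto (fun l => toFock (φ l)) atTop (𝓝 ψ))
    (h2 : Tendsto (fun p : ℕ × ℕ => quad A (φ p.1 - φ p.2)) atTop (𝓝 0)) :
    ∃ ξ, Tendsto (fun l => Q.emb (φ l)) atTop (𝓝 ξ) ∧ Q.J ξ = ψ := by
  have hcau : CauchySeq fun l => Q.emb (φ l) := by
    rw [cauchySeq_iff_tendsto_dist_atTop_0]
    have h4 : Tendsto (fun p : ℕ × ℕ => toFock (φ p.1 - φ p.2)) atTop (𝓝 0) := by
      have h5 : Tendsto (fun p : ℕ × ℕ => toFock (φ p.1) - toFock (φ p.2)) atTop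
          (𝓝 (ψ - ψ)) := by
        rw [← prod_atTop_atTop_eq]
        exact (h1.comp tendsto_fst).sub (h1.comp tendsto_snd)
      simpa using h5
    have h6 : Tendsto (fun p : ℕ × ℕ => ‖Q.emb (φ p.1 - φ p.2)‖ ^ 2) atTop (𝓝 0) := by
      have := h2.add ((h4.norm.pow 2).const_mul (C + 1))
      simp only [norm_zero, ne_eq, OfNat.ofNat_ne_zero, not_false_eq_true, zero_pow, mul_zero,
        add_zero] at this
      simpa only [Q.norm_emb_sq] using this
    have h7 := (Real.continuous_sqrt.tendsto 0).comp h6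
    rw [Real.sqrt_zero] at h7
    refine h7.congr fun p => ?_
    rw [Function.comp_apply, Real.sqrt_sq (norm_nonneg _), map_sub, dist_eq_norm]
  obtain ⟨ξ, hξ⟩ := cauchySeq_tendsto_of_complete hcau
  refine ⟨ξ, hξ, tendsto_nhds_unique ((Q.J.continuous.tendsto ξ).comp hξ) (h1.congr fun l => ?_)⟩
  rw [Function.comp_apply, Q.J_emb]

/-- The approximating sequences in `HasFormValue` are those whose images converge in the completion,
so a form value is a shifted squared norm; as `J` is injective, it is unique. -/
theorem hasFormValue_iff {ψ : Fock s n} {e : ℝ} :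
    HasFormValue A ψ e ↔ ∃ ξ, Q.J ξ = ψ ∧ ‖ξ‖ ^ 2 = e + (C + 1) * ‖ψ‖ ^ 2 := by
  constructor
  · rintro ⟨φ, h1, h2, h3⟩
    obtain ⟨ξ, hξ, hJ⟩ := Q.exists_tendsto h1 h2
    refine ⟨ξ, hJ, tendsto_nhds_unique (hξ.norm.pow 2) ?_⟩
    simp only [Q.norm_emb_sq]
    exact h3.add ((h1.norm.pow 2).const_mul _)
  · rintro ⟨ξ, rfl, h2⟩
    obtain ⟨x, hx, hlim⟩ := mem_closure_iff_seq_limit.1 (Q.dense ξ)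
    choose φ hφ using hx
    have hφlim : Tendsto (fun l => Q.emb (φ l)) atTop (𝓝 ξ) := by simpa only [hφ] using hlim
    have hJ : Tendsto (fun l => toFock (φ l)) atTop (𝓝 (Q.J ξ)) := by
      refine ((Q.J.continuous.tendsto ξ).comp hφlim).congr fun l => ?_
      rw [Function.comp_apply, Q.J_emb]
    refine ⟨φ, hJ, ?_, ?_⟩
    · have h3 : Tendsto (fun p : ℕ × ℕ => Q.emb (φ p.1) - Q.emb (φ p.2)) atTop (𝓝 (ξ - ξ)) := by
        rw [← prod_atTop_atTop_eq]
        exact (hφlim.comp tendsto_fst).sub (hφlim.comp tendsto_snd)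
      have h4 : Tendsto (fun p : ℕ × ℕ => toFock (φ p.1) - toFock (φ p.2)) atTop
          (𝓝 (Q.J ξ - Q.J ξ)) := by
        rw [← prod_atTop_atTop_eq]
        exact (hJ.comp tendsto_fst).sub (hJ.comp tendsto_snd)
      have h5 := (h3.norm.pow 2).sub ((h4.norm.pow 2).const_mul (C + 1))
      simpa [Q.quad_eq] using h5
    · have h5 := (hφlim.norm.pow 2).sub ((hJ.norm.pow 2).const_mul (C + 1))
      rw [h2, add_sub_cancel_right] at h5
      simpa only [Q.quad_eq] using h5

/-- The weak eigenvalue equation on pre-Fock vectors extends by density to all test vectors of the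
form domain. Testing it with the eigenvector itself gives the form value. -/
theorem inner_eigenvector {ψ : Fock s n} {E : ℝ} (h : FriedrichsGraph A ψ ((E : ℂ) • ψ)) :
    ∃ ξ, Q.J ξ = ψ ∧ (∀ η, inner ℂ η ξ = ((E + C + 1 : ℝ) : ℂ) * inner ℂ (Q.J η) ψ) ∧
      HasFormValue A ψ (E * ‖ψ‖ ^ 2) := by
  obtain ⟨⟨e, he⟩, h2⟩ := h
  obtain ⟨ξ, rfl, -⟩ := Q.hasFormValue_iff.1 he
  have h3 : ∀ η, inner ℂ η ξ = ((E + C + 1 : ℝ) : ℂ) * inner ℂ (Q.J η) (Q.J ξ) := by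
    intro η
    refine Q.dense.induction_on (p := fun η => inner ℂ η ξ =
      ((E + C + 1 : ℝ) : ℂ) * inner ℂ (Q.J η) (Q.J ξ)) η ?_ ?_
    · exact isClosed_eq (by fun_prop) (by fun_prop)
    · intro φ
      rw [Q.inner_emb, h2, inner_smul_right, Q.J_emb]
      push_cast; ring
  refine ⟨ξ, rfl, h3, Q.hasFormValue_iff.2 ⟨ξ, rfl, ?_⟩⟩
  have h4 := h3 ξ
  rw [inner_self_eq_ofReal, inner_self_eq_ofReal] at h4
  have h5 : ‖ξ‖ ^ 2 = (E + C + 1) * ‖Q.J ξ‖ ^ 2 := by exact_mod_cast h4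
  rw [h5]; ring

end FormSpace

theorem HasFormValue.lower_bound {A : Module.End ℂ (PreFock s n)} {C : ℝ}
    (hC : ∀ φ, -C * ‖toFock φ‖ ^ 2 ≤ quad A φ) {ψ : Fock s n} {e : ℝ} (h : HasFormValue A ψ e) :
    -C * ‖ψ‖ ^ 2 ≤ e := by
  obtain ⟨φ, h1, -, h3⟩ := h
  exact le_of_tendsto_of_tendsto' ((h1.norm.pow 2).const_mul (-C)) h3 fun l => hC _

theorem hasFormValue_toFock (A : Module.End ℂ (PreFock s n)) (φ : PreFock s n) :
    HasFormValue A (toFock φ) (quad A φ) :=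
  ⟨fun _ => φ, tendsto_const_nhds, by simp [quad, form], tendsto_const_nhds⟩

end FormSpace

end

end RDM

namespace RDM

noncomputable section

/-! ### Ladder operators and canonical (anti)commutation relations -/

section Ladder

variable {s : Statistics} {n : ℕ}

theorem annih_single (k : Occ s n) (c : ℂ) (i : Fin n) : annih s n i (Finsupp.single k c) =
    Finsupp.single (lowerOcc k i) (c * (phase s k.1 i * (Real.sqrt (k.1 i) : ℂ))) := by
  rw [annih, Finsupp.linearCombination_single, Finsupp.smul_single, smul_eq_mul]

theorem create_single (k : Occ s n) (c : ℂ) (i : Fin n) : create s n i (Finsupp.single k c) =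
    Finsupp.single (raiseOcc k i) (c * (phase s k.1 i * (raiseCoeff s (k.1 i) : ℂ))) := by
  rw [create, Finsupp.linearCombination_single, Finsupp.smul_single, smul_eq_mul]

theorem lowerOcc_same (k : Occ s n) (i : Fin n) : (lowerOcc k i).1 i = k.1 i - 1 := by
  simp [lowerOcc]

theorem lowerOcc_ne (k : Occ s n) {i j : Fin n} (h : j ≠ i) : (lowerOcc k i).1 j = k.1 j := by
  simp [lowerOcc, h]

theorem raiseOcc_same (k : Occ s n) (i : Fin n) : (raiseOcc k i).1 i = raiseNumber s (k.1 i) := by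
  simp [raiseOcc]

theorem raiseOcc_ne (k : Occ s n) {i j : Fin n} (h : j ≠ i) : (raiseOcc k i).1 j = k.1 j := by
  simp [raiseOcc, h]

theorem lowerOcc_raiseOcc_comm (k : Occ s n) {i j : Fin n} (h : i ≠ j) :
    lowerOcc (raiseOcc k j) i = raiseOcc (lowerOcc k i) j := by
  apply Subtype.ext
  simp only [lowerOcc, raiseOcc, Function.update_of_ne h, Function.update_of_ne h.symm]
  exact Function.update_comm h.symm _ _ _

theorem raiseOcc_comm (k : Occ s n) {i j : Fin n} (h : i ≠ j) :
    raiseOcc (raiseOcc k j) i = raiseOcc (raiseOcc k i) j := by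
  apply Subtype.ext
  simp only [raiseOcc, Function.update_of_ne h, Function.update_of_ne h.symm]
  exact Function.update_comm h.symm _ _ _

theorem raiseOcc_lowerOcc (k : Occ s n) {i : Fin n} (h : k.1 i ≠ 0) :
    raiseOcc (lowerOcc k i) i = k := by
  apply Subtype.ext
  have : raiseNumber s (k.1 i - 1) = k.1 i := by
    cases s with
    | boson => simp only [raiseNumber]; omega
    | fermion =>
      have := k.2 rfl i
      simp only [raiseNumber]; omega
  simp [lowerOcc, raiseOcc, this]

theorem lowerOcc_raiseOcc (k : Occ s n) {i : Fin n} (h : s = Statistics.fermion → k.1 i = 0) :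
    lowerOcc (raiseOcc k i) i = k := by
  apply Subtype.ext
  have : raiseNumber s (k.1 i) - 1 = k.1 i := by
    cases s with
    | boson => simp [raiseNumber]
    | fermion =>
      have := h rfl
      simp only [raiseNumber]; omega
  simp [lowerOcc, raiseOcc, this]

/-- Stated additively to avoid truncated subtraction; it gives the change of the fermionic sign
exponent under a change of one occupation. -/
theorem sum_gt_update (k : Fin n → ℕ) (i j : Fin n) (m : ℕ) :
    (∑ l ∈ Finset.univ.filter (fun l => i < l), Function.update k j m l) +
      (if i < j then k j else 0)
      = (∑ l ∈ Finset.univ.filter (fun l => i < l), k l) + (if i < j then m else 0) := by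
  classical
  split_ifs with h
  · have hj : j ∈ Finset.univ.filter (fun l => i < l) := by simpa using h
    rw [Finset.sum_update_of_mem hj, ← Finset.add_sum_erase _ _ hj, Finset.sdiff_singleton_eq_erase]
    omega
  · have hj : j ∉ Finset.univ.filter (fun l => i < l) := by simpa using h
    rw [Finset.sum_update_of_notMem hj]

theorem phase_update_self (k : Fin n → ℕ) (i : Fin n) (m : ℕ) :
    phase s (Function.update k i m) i = phase s k i := by
  cases s with
  | boson => rfl
  | fermion =>
    have := sum_gt_update k i i m
    simp only [lt_irrefl, if_false, add_zero] at this
    simp only [phase, this]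

theorem phase_lowerOcc_self (k : Occ s n) (i : Fin n) :
    phase s (lowerOcc k i).1 i = phase s k.1 i := phase_update_self _ _ _

theorem phase_raiseOcc_self (k : Occ s n) (i : Fin n) :
    phase s (raiseOcc k i).1 i = phase s k.1 i := phase_update_self _ _ _

theorem phase_mul_self (k : Fin n → ℕ) (i : Fin n) : phase s k i * phase s k i = 1 := by
  cases s with
  | boson => simp [phase]
  | fermion => simp [phase, ← mul_pow]

theorem conj_phase (k : Fin n → ℕ) (i : Fin n) : (starRingEnd ℂ) (phase s k i) = phase s k i := by
  cases s with
  | boson => simp [phase]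
  | fermion => simp [phase]

theorem norm_phase (k : Fin n → ℕ) (i : Fin n) : ‖phase s k i‖ = 1 := by
  cases s with
  | boson => simp [phase]
  | fermion => simp [phase]

/-- The phase at `i` counts the particles strictly after `i`, so a new particle at `j` flips it
exactly when `i < j`. -/
theorem phase_raiseOcc_fermion (k : Occ Statistics.fermion n) {j : Fin n} (hj : k.1 j = 0)
    (i : Fin n) : phase Statistics.fermion (raiseOcc k j).1 i =
      (if i < j then -1 else 1) * phase Statistics.fermion k.1 i := by
  have h := sum_gt_update k.1 i j 1
  simp only [hj, ite_self, add_zero] at h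
  simp only [phase, raiseOcc, raiseNumber, h]
  split_ifs <;> simp [pow_succ]

theorem phase_lowerOcc_fermion (k : Occ Statistics.fermion n) {j : Fin n} (hj : k.1 j = 1)
    (i : Fin n) : phase Statistics.fermion (lowerOcc k j).1 i =
      (if i < j then -1 else 1) * phase Statistics.fermion k.1 i := by
  have h := sum_gt_update k.1 i j 0
  simp only [hj, ite_self, add_zero] at h
  simp only [phase, lowerOcc, hj, Nat.sub_self, ← h]
  split_ifs <;> simp [pow_succ]

/-- `1` for bosons and `-1` for fermions. -/
def exchangeSign : Statistics → ℂ
  | Statistics.boson => 1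
  | Statistics.fermion => -1

theorem endo_ext {A B : Module.End ℂ (PreFock s n)}
    (h : ∀ k, A (Finsupp.single k 1) = B (Finsupp.single k 1)) : A = B := by
  refine Finsupp.lhom_ext fun k c => ?_
  have : (Finsupp.single k c : PreFock s n) = c • Finsupp.single k 1 := by simp
  rw [this, map_smul, map_smul, h]

theorem sqrt_mul_sqrt_cast (m : ℕ) : (Real.sqrt m : ℂ) * (Real.sqrt m : ℂ) = m := by
  have : Real.sqrt m * Real.sqrt m = m := Real.mul_self_sqrt (Nat.cast_nonneg m)
  exact_mod_cast congrArg (fun x : ℝ => (x : ℂ)) this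

theorem create_annih_self_single (k : Occ s n) (i : Fin n) :
    create s n i (annih s n i (Finsupp.single k 1)) = (k.1 i : ℂ) • Finsupp.single k 1 := by
  rw [annih_single, create_single, phase_lowerOcc_self, lowerOcc_same]
  rcases Nat.eq_zero_or_pos (k.1 i) with h | h
  · simp [h]
  rw [raiseOcc_lowerOcc k h.ne']
  have hc : (raiseCoeff s (k.1 i - 1) : ℂ) = Real.sqrt (k.1 i) := by
    cases s with
    | boson =>
      simp only [raiseCoeff]
      rw [Nat.cast_sub h]; simp
    | fermion =>
      have := k.2 rfl i
      have h1 : k.1 i = 1 := by omega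
      simp [raiseCoeff, h1]
  rw [hc, Finsupp.smul_single, smul_eq_mul]
  congr 1
  linear_combination (Real.sqrt (k.1 i) : ℂ) * (Real.sqrt (k.1 i) : ℂ) *
    phase_mul_self (s := s) k.1 i
    + sqrt_mul_sqrt_cast (k.1 i)

/-- For distinct fermionic modes the sign arises because exactly one of the two phases flips: the
one of `i` after raising `j` if `i < j`, the one of `j` after lowering `i` if `j < i`. -/
theorem annih_create (i j : Fin n) : annih s n i * create s n j =
    exchangeSign s • (create s n j * annih s n i) + if i = j then 1 else 0 := by
  refine endo_ext fun k => ?_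
  simp only [LinearMap.add_apply, LinearMap.smul_apply, Module.End.mul_apply]
  rcases eq_or_ne i j with rfl | hij
  · rw [create_annih_self_single, if_pos rfl, Module.End.one_apply, create_single, annih_single,
      phase_raiseOcc_self, raiseOcc_same]
    have hp := phase_mul_self (s := s) k.1 i
    cases s with
    | boson =>
      rw [lowerOcc_raiseOcc k (by simp), Finsupp.smul_single, Finsupp.smul_single,
        ← Finsupp.single_add]
      congr 1
      have := sqrt_mul_sqrt_cast (k.1 i + 1)
      simp only [raiseCoeff, raiseNumber, exchangeSign, smul_eq_mul]
      push_cast at this ⊢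
      linear_combination this + (Real.sqrt (k.1 i + 1) : ℂ) * (Real.sqrt (k.1 i + 1) : ℂ) * hp
    | fermion =>
      have h1 := k.2 rfl i
      rcases (show k.1 i = 0 ∨ k.1 i = 1 by omega) with h | h
      · rw [lowerOcc_raiseOcc k (fun _ => h)]
        simp only [h, raiseCoeff, raiseNumber, exchangeSign]
        simp only [if_true, Nat.cast_zero, zero_smul, smul_zero, zero_add, Complex.ofReal_one,
          mul_one, one_mul, Nat.cast_one, Real.sqrt_one, hp]
      · simp [h, raiseCoeff, exchangeSign]
  · rw [if_neg hij, LinearMap.zero_apply, add_zero, create_single, annih_single, annih_single,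
      create_single, lowerOcc_raiseOcc_comm k hij, raiseOcc_ne k hij, lowerOcc_ne k hij.symm,
      Finsupp.smul_single]
    congr 1
    cases s with
    | boson => simp [phase, exchangeSign]; ring
    | fermion =>
      have h1 := k.2 rfl i
      have h2 := k.2 rfl j
      rcases (show k.1 i = 0 ∨ k.1 i = 1 by omega) with h | h
      · simp [h]
      rcases (show k.1 j = 0 ∨ k.1 j = 1 by omega) with h' | h'
      · rw [phase_raiseOcc_fermion k h', phase_lowerOcc_fermion k h]
        simp only [exchangeSign, smul_eq_mul]
        rcases lt_or_gt_of_ne hij with hlt | hlt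
        · simp only [hlt, hlt.not_gt, if_true, if_false]; ring
        · simp only [hlt, hlt.not_gt, if_true, if_false]; ring
      · simp [h', raiseCoeff]

theorem create_create (i j : Fin n) : create s n i * create s n j =
    exchangeSign s • (create s n j * create s n i) := by
  refine endo_ext fun k => ?_
  simp only [LinearMap.smul_apply, Module.End.mul_apply]
  rcases eq_or_ne i j with rfl | hij
  · cases s with
    | boson => simp [exchangeSign]
    | fermion =>
      rw [create_single, create_single, raiseOcc_same]
      simp [raiseCoeff, raiseNumber]
  · rw [create_single, create_single, create_single, create_single, raiseOcc_comm k hij,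
      raiseOcc_ne k hij, raiseOcc_ne k hij.symm, Finsupp.smul_single]
    congr 1
    cases s with
    | boson => simp [phase, exchangeSign]; ring
    | fermion =>
      have h1 := k.2 rfl i
      have h2 := k.2 rfl j
      rcases (show k.1 i = 0 ∨ k.1 i = 1 by omega) with h | h
      · rcases (show k.1 j = 0 ∨ k.1 j = 1 by omega) with h' | h'
        · rw [phase_raiseOcc_fermion k h', phase_raiseOcc_fermion k h]
          simp only [exchangeSign, smul_eq_mul]
          rcases lt_or_gt_of_ne hij with hlt | hlt
          · simp only [hlt, hlt.not_gt, if_true, if_false]; ring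
          · simp only [hlt, hlt.not_gt, if_true, if_false]; ring
        · simp [h', raiseCoeff]
      · simp [h, raiseCoeff]

/-- Raising is not injective on all occupations: a full fermionic state is left unchanged, with
coefficient `0`. Restricted to nonzero coefficients, raising and lowering are inverse bijections,
which yields both adjointness and the reindexing in `hasSum_raiseOcc`. -/
theorem raiseOcc_eq_iff (k l : Occ s n) (i : Fin n) :
    (raiseOcc k i = l ∧ raiseCoeff s (k.1 i) ≠ 0) ↔ (k = lowerOcc l i ∧ l.1 i ≠ 0) := by
  have hc : raiseCoeff s (k.1 i) ≠ 0 ↔ (s = Statistics.fermion → k.1 i = 0) := by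
    cases s with
    | boson =>
      simp only [raiseCoeff, reduceCtorEq, false_imp_iff, iff_true]
      exact (Real.sqrt_pos.2 (by positivity)).ne'
    | fermion => simp [raiseCoeff]
  rw [hc]
  constructor
  · rintro ⟨rfl, h⟩
    refine ⟨(lowerOcc_raiseOcc k h).symm, ?_⟩
    rw [raiseOcc_same]
    cases s <;> simp [raiseNumber]
  · rintro ⟨rfl, h⟩
    refine ⟨raiseOcc_lowerOcc l h, fun hs => ?_⟩
    rw [lowerOcc_same]
    have := l.2 hs i
    omega

theorem inner_create_single (i : Fin n) (k l : Occ s n) :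
    inner ℂ (toFock (create s n i (Finsupp.single k 1))) (toFock (Finsupp.single l 1)) =
      inner ℂ (toFock (Finsupp.single k 1)) (toFock (annih s n i (Finsupp.single l 1))) := by
  rw [create_single, annih_single, toFock_single, toFock_single, toFock_single, toFock_single,
    inner_smul_left, inner_smul_right, inner_smul_left, inner_smul_right,
    orthonormal_iff_ite.1 orthonormal_ket, orthonormal_iff_ite.1 orthonormal_ket]
  have key := raiseOcc_eq_iff k l i
  simp only [one_mul, map_mul, conj_phase, Complex.conj_ofReal, map_one]
  by_cases h : k = lowerOcc l i ∧ l.1 i ≠ 0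
  · obtain ⟨h1, h2⟩ := key.2 h
    have h3 : (raiseCoeff s (k.1 i) : ℂ) = Real.sqrt (l.1 i) := by
      rw [h.1, lowerOcc_same]
      cases s with
      | boson =>
        simp only [raiseCoeff]
        rw [Nat.cast_sub (Nat.one_le_iff_ne_zero.2 h.2)]; simp
      | fermion =>
        have := l.2 rfl i
        have h4 : l.1 i = 1 := by have := h.2; omega
        simp [raiseCoeff, h4]
    rw [if_pos h1, if_pos h.1, h3, h.1, phase_lowerOcc_self]
  · have h' : ¬ (raiseOcc k i = l ∧ raiseCoeff s (k.1 i) ≠ 0) := fun hh => h (key.1 hh)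
    have h1 : (phase s k.1 i * (raiseCoeff s (k.1 i) : ℂ)) *
        (if raiseOcc k i = l then (1:ℂ) else 0) = 0 := by
      by_cases h2 : raiseOcc k i = l
      · have : raiseCoeff s (k.1 i) = 0 := by
          by_contra h3
          exact h' ⟨h2, h3⟩
        simp [this]
      · simp [h2]
    have h4 : (phase s l.1 i * (Real.sqrt (l.1 i) : ℂ)) *
        (if k = lowerOcc l i then (1:ℂ) else 0) = 0 := by
      by_cases h2 : k = lowerOcc l i
      · have : l.1 i = 0 := by
          by_contra h3
          exact h ⟨h2, h3⟩
        simp [this]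
      · simp [h2]
    rw [h1, h4]

theorem inner_create (i : Fin n) (φ ψ : PreFock s n) :
    inner ℂ (toFock (create s n i φ)) (toFock ψ) = inner ℂ (toFock φ) (toFock (annih s n i ψ)) := by
  induction φ using Finsupp.induction_linear with
  | zero => simp
  | add f g hf hg => simp only [map_add, inner_add_left, hf, hg]
  | single k c =>
    induction ψ using Finsupp.induction_linear with
    | zero => simp
    | add f g hf hg => simp only [map_add, inner_add_right, hf, hg]
    | single l d =>
      have h1 : (Finsupp.single k c : PreFock s n) = c • Finsupp.single k 1 := by simp
      have h2 : (Finsupp.single l d : PreFock s n) = d • Finsupp.single l 1 := by simp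
      rw [h1, h2]
      simp only [map_smul, inner_smul_left, inner_smul_right, inner_create_single]

theorem inner_annih (i : Fin n) (φ ψ : PreFock s n) :
    inner ℂ (toFock (annih s n i φ)) (toFock ψ) = inner ℂ (toFock φ) (toFock (create s n i ψ)) := by
  rw [← inner_conj_symm, ← inner_create, inner_conj_symm]

theorem eq_of_inner_toFock {φ ψ : PreFock s n}
    (h : ∀ χ : PreFock s n, inner ℂ (toFock χ) (toFock φ) = inner ℂ (toFock χ) (toFock ψ)) :
    φ = ψ := by
  apply toFock_injective
  rw [← sub_eq_zero]
  refine eq_zero_of_inner_toFock fun χ => ?_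
  rw [inner_sub_right, h, sub_self]

theorem conj_exchangeSign : (starRingEnd ℂ) (exchangeSign s) = exchangeSign s := by
  cases s <;> simp [exchangeSign]

/-- The adjoint of `create_create`, obtained by testing against all pre-Fock vectors. -/
theorem annih_annih (i j : Fin n) : annih s n i * annih s n j =
    exchangeSign s • (annih s n j * annih s n i) := by
  ext1 φ
  ext1
  simp only [LinearMap.comp_apply]
  refine eq_of_inner_toFock fun χ => ?_
  simp only [Module.End.mul_apply, LinearMap.smul_apply, map_smul, inner_smul_right,
    ← inner_create]
  have := congrArg (fun A => A χ) (create_create (s := s) j i)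
  simp only [Module.End.mul_apply, LinearMap.smul_apply] at this
  rw [this, map_smul, inner_smul_left, conj_exchangeSign]

theorem numberOp_single (k : Occ s n) (c : ℂ) :
    numberOp s n (Finsupp.single k c) = ((∑ i, k.1 i : ℕ) : ℂ) • Finsupp.single k c := by
  have h1 : (Finsupp.single k c : PreFock s n) = c • Finsupp.single k 1 := by simp
  rw [h1, map_smul, smul_comm]
  congr 1
  simp only [numberOp, LinearMap.sum_apply, Module.End.mul_apply, create_annih_self_single]
  rw [← Finset.sum_smul]
  push_cast; rfl

end Ladder

end

end RDM

namespace RDM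

noncomputable section

/-! ### One-body operators on the form domain of the number operator -/

section OneBody

variable {s : Statistics} {n : ℕ}

theorem quad_numberOp (φ : PreFock s n) :
    quad (numberOp s n) φ = ∑ i, ‖toFock (annih s n i φ)‖ ^ 2 := by
  simp only [quad, form, numberOp, LinearMap.sum_apply, Module.End.mul_apply, map_sum, inner_sum,
    Complex.re_sum]
  refine Finset.sum_congr rfl fun i _ => ?_
  rw [← inner_annih, inner_self_eq_ofReal, Complex.ofReal_re]

theorem quad_numberOp_nonneg (φ : PreFock s n) : 0 ≤ quad (numberOp s n) φ := by
  rw [quad_numberOp]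
  exact Finset.sum_nonneg fun i _ => sq_nonneg _

theorem isHermitianOp_numberOp : IsHermitianOp (numberOp s n) := by
  intro φ ψ
  simp only [form, numberOp, LinearMap.sum_apply, Module.End.mul_apply, map_sum, inner_sum,
    sum_inner]
  exact Finset.sum_congr rfl fun i _ => by rw [inner_create, ← inner_annih]

variable (s n) in
/-- The form domain of the number operator. -/
def numberSpace : FormSpace (numberOp s n) 0 :=
  (exists_formSpace isHermitianOp_numberOp (C := 0)
    (fun φ => by simpa using quad_numberOp_nonneg φ)).some

/-- The expectation value of the one-body potential, as a quadratic form. -/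
theorem quad_potential (v : HermMat n) (φ : PreFock s n) : quad (potential s v) φ =
    (∑ i, ∑ j, (v : Matrix (Fin n) (Fin n) ℂ) i j *
      inner ℂ (toFock (annih s n i φ)) (toFock (annih s n j φ))).re := by
  simp only [quad, form, potential, LinearMap.sum_apply, LinearMap.smul_apply,
    Module.End.mul_apply, map_sum, map_smul, inner_sum, inner_smul_right, ← inner_annih]

theorem isHermitianOp_potential (v : HermMat n) : IsHermitianOp (potential s v) := by
  intro φ ψ
  have hv : ∀ i j, (starRingEnd ℂ) ((v : Matrix (Fin n) (Fin n) ℂ) i j) =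
      (v : Matrix (Fin n) (Fin n) ℂ) j i := fun i j => by
    conv_rhs => rw [← (selfAdjoint.mem_iff.1 v.2 : star (v : Matrix (Fin n) (Fin n) ℂ) = v)]
    rfl
  simp only [form, potential, LinearMap.sum_apply, LinearMap.smul_apply,
    Module.End.mul_apply, map_sum, map_smul, inner_sum, sum_inner, inner_smul_right,
    inner_smul_left, hv, ← inner_annih, inner_create]
  rw [Finset.sum_comm]

theorem IsHermitianOp.add {A B : Module.End ℂ (PreFock s n)} (hA : IsHermitianOp A)
    (hB : IsHermitianOp B) : IsHermitianOp (A + B) := by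
  intro φ ψ
  have h1 := hA φ ψ
  have h2 := hB φ ψ
  simp only [form, LinearMap.add_apply, map_add, inner_add_left, inner_add_right] at *
  rw [h1, h2]

theorem norm_annih_le (i : Fin n) (φ : PreFock s n) :
    ‖toFock (annih s n i φ)‖ ≤ ‖(numberSpace s n).emb φ‖ := by
  refine (sq_le_sq₀ (norm_nonneg _) (norm_nonneg _)).1 ?_
  rw [FormSpace.norm_emb_sq, quad_numberOp]
  have := Finset.single_le_sum (f := fun i => ‖toFock (annih s n i φ)‖ ^ 2)
    (fun i _ => sq_nonneg _) (Finset.mem_univ i)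
  nlinarith [sq_nonneg ‖toFock φ‖]

variable (s) in
/-- The annihilation operator on the form domain of the number operator. -/
def annihExt (i : Fin n) : (numberSpace s n).carrier →L[ℂ] Fock s n :=
  (toFock ∘ₗ annih s n i).extendOfNorm (numberSpace s n).emb

@[simp] theorem annihExt_emb (i : Fin n) (φ : PreFock s n) :
    annihExt s i ((numberSpace s n).emb φ) = toFock (annih s n i φ) :=
  LinearMap.extendOfNorm_eq (numberSpace s n).dense
    ⟨1, fun φ => by simpa using norm_annih_le i φ⟩ φ

theorem inner_annihExt (i : Fin n) (φ : PreFock s n) (η : (numberSpace s n).carrier) :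
    inner ℂ (toFock φ) (annihExt s i η) =
      inner ℂ (toFock (create s n i φ)) ((numberSpace s n).J η) := by
  refine (numberSpace s n).dense.induction_on (p := fun η => inner ℂ (toFock φ) (annihExt s i η) =
      inner ℂ (toFock (create s n i φ)) ((numberSpace s n).J η)) η ?_ ?_
  · exact isClosed_eq (by fun_prop) (by fun_prop)
  · intro ψ
    rw [annihExt_emb, FormSpace.J_emb, inner_create]

theorem annihExt_apply (i : Fin n) (η : (numberSpace s n).carrier) (k : Occ s n) :
    annihExt s i η k = phase s k.1 i * (raiseCoeff s (k.1 i) : ℂ) *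
      (numberSpace s n).J η (raiseOcc k i) := by
  have h := inner_annihExt i (Finsupp.single k 1) η
  rw [toFock_single, one_smul, inner_ket, create_single, toFock_single, inner_smul_left,
    inner_ket] at h
  rw [h]
  simp [conj_phase]

/-- The quadratic form of the one-body potential `v` on the form domain of the number operator. -/
def oneBody (v : HermMat n) (η : (numberSpace s n).carrier) : ℝ :=
  (∑ i, ∑ j, (v : Matrix (Fin n) (Fin n) ℂ) i j * inner ℂ (annihExt s i η) (annihExt s j η)).re

theorem oneBody_emb (v : HermMat n) (φ : PreFock s n) :
    oneBody v ((numberSpace s n).emb φ) = quad (potential s v) φ := by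
  simp only [oneBody, annihExt_emb, quad_potential]

theorem continuous_oneBody (v : HermMat n) : Continuous (oneBody (s := s) v) := by
  unfold oneBody
  fun_prop

@[simp] theorem oneBody_zero (v : HermMat n) : oneBody (s := s) v 0 = 0 := by
  simp [oneBody]

theorem exists_abs_oneBody_le (s : Statistics) (v : HermMat n) :
    ∃ c : ℝ, 0 ≤ c ∧ ∀ η : (numberSpace s n).carrier, |oneBody v η| ≤ c * ‖η‖ ^ 2 := by
  refine ⟨∑ i, ∑ j, ‖(v : Matrix (Fin n) (Fin n) ℂ) i j‖ * (‖annihExt s i‖ * ‖annihExt s j‖),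
    Finset.sum_nonneg fun i _ => Finset.sum_nonneg fun j _ => by positivity, fun η => ?_⟩
  rw [Finset.sum_mul]
  refine (Complex.abs_re_le_norm _).trans
    ((norm_sum_le _ _).trans (Finset.sum_le_sum fun i _ => ?_))
  rw [Finset.sum_mul]
  refine (norm_sum_le _ _).trans (Finset.sum_le_sum fun j _ => ?_)
  rw [norm_mul, mul_assoc]
  refine mul_le_mul_of_nonneg_left ?_ (norm_nonneg _)
  refine (norm_inner_le_norm _ _).trans ?_
  calc _ ≤ (‖annihExt s i‖ * ‖η‖) * (‖annihExt s j‖ * ‖η‖) := by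
        gcongr <;> exact ContinuousLinearMap.le_opNorm _ _
    _ = _ := by ring

/-- Up to a constant, `A` dominates a positive multiple of the number operator. -/
def DominatesNumber (A : Module.End ℂ (PreFock s n)) : Prop :=
  ∃ K : ℝ, 0 < K ∧ ∃ C : ℝ, ∀ φ, quad (numberOp s n) φ ≤ K * (quad A φ + C * ‖toFock φ‖ ^ 2)

/-- A form-Cauchy sequence for `A` is one for the number operator by domination, and along it every
one-body form converges. The lift `η` of `ψ` is the same for all `v`, so adding `V_v` shifts the
form value by `oneBody v η`. -/
theorem HasFormValue.exists_numberSpace {A : Module.End ℂ (PreFock s n)} {K C : ℝ}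
    (hA : ∀ φ, quad (numberOp s n) φ ≤ K * (quad A φ + C * ‖toFock φ‖ ^ 2))
    {ψ : Fock s n} {e : ℝ} (h : HasFormValue A ψ e) :
    ∃ η, (numberSpace s n).J η = ψ ∧ ‖η‖ ^ 2 ≤ K * (e + C * ‖ψ‖ ^ 2) + ‖ψ‖ ^ 2 ∧
      ∀ v, HasFormValue (A + potential s v) ψ (e + oneBody v η) := by
  obtain ⟨φ, h1, h2, h3⟩ := h
  have h4 : Tendsto (fun p : ℕ × ℕ => toFock (φ p.1 - φ p.2)) atTop (𝓝 0) := by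
    have h5 : Tendsto (fun p : ℕ × ℕ => toFock (φ p.1) - toFock (φ p.2)) atTop
        (𝓝 (ψ - ψ)) := by
      rw [← prod_atTop_atTop_eq]
      exact (h1.comp tendsto_fst).sub (h1.comp tendsto_snd)
    simpa using h5
  have h5 : Tendsto (fun p : ℕ × ℕ => quad (numberOp s n) (φ p.1 - φ p.2)) atTop (𝓝 0) := by
    refine squeeze_zero (fun p => quad_numberOp_nonneg _) (fun p => hA _) ?_
    simpa using (h2.add ((h4.norm.pow 2).const_mul C)).const_mul K
  obtain ⟨η, hη, hJ⟩ := (numberSpace s n).exists_tendsto h1 h5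
  refine ⟨η, hJ, ?_, fun v => ⟨φ, h1, ?_, ?_⟩⟩
  · refine le_of_tendsto_of_tendsto' (hη.norm.pow 2)
      (((h3.add ((h1.norm.pow 2).const_mul C)).const_mul K).add (h1.norm.pow 2)) fun l => ?_
    rw [FormSpace.norm_emb_sq]
    linarith [hA (φ l)]
  · have h6 : Tendsto (fun p : ℕ × ℕ => (numberSpace s n).emb (φ p.1 - φ p.2)) atTop (𝓝 0) := by
      have h7 : Tendsto (fun p : ℕ × ℕ => (numberSpace s n).emb (φ p.1) -
          (numberSpace s n).emb (φ p.2)) atTop (𝓝 (η - η)) := by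
        rw [← prod_atTop_atTop_eq]
        exact (hη.comp tendsto_fst).sub (hη.comp tendsto_snd)
      simpa using h7
    have h8 := h2.add (((continuous_oneBody v).tendsto 0).comp h6)
    simpa only [quad_add_op, oneBody_emb, oneBody_zero, Function.comp_def, add_zero] using h8
  · have h8 := h3.add (((continuous_oneBody v).tendsto η).comp hη)
    simpa [quad_add_op, oneBody_emb, Function.comp_def] using h8

theorem sqrt_raiseNumber {m : ℕ} (hm : raiseCoeff s m ≠ 0) :
    Real.sqrt (raiseNumber s m) = raiseCoeff s m := by
  cases s with
  | boson => simp [raiseCoeff, raiseNumber]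
  | fermion =>
    have : m = 0 := by by_contra h; simp [raiseCoeff, h] at hm
    simp [raiseCoeff, raiseNumber, this]

/-- Reindexing of a series by adding a particle. -/
theorem hasSum_raiseOcc {M : Type*} [AddCommMonoid M] [TopologicalSpace M] (i : Fin n)
    {f g : Occ s n → M} (hf : ∀ k, k.1 i = 0 → f k = 0)
    (hg : ∀ k, raiseCoeff s (k.1 i) = 0 → g k = 0)
    (h : ∀ k, raiseCoeff s (k.1 i) ≠ 0 → f (raiseOcc k i) = g k) {x : M} :
    HasSum f x ↔ HasSum g x := by
  classical
  let e : {k : Occ s n // raiseCoeff s (k.1 i) ≠ 0} ≃ {k : Occ s n // k.1 i ≠ 0} :=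
    { toFun := fun k => ⟨raiseOcc k.1 i, ((raiseOcc_eq_iff k.1 _ i).1 ⟨rfl, k.2⟩).2⟩
      invFun := fun k => ⟨lowerOcc k.1 i, ((raiseOcc_eq_iff _ k.1 i).2 ⟨rfl, k.2⟩).2⟩
      left_inv := fun k => Subtype.ext ((raiseOcc_eq_iff k.1 _ i).1 ⟨rfl, k.2⟩).1.symm
      right_inv := fun k => Subtype.ext ((raiseOcc_eq_iff _ k.1 i).2 ⟨rfl, k.2⟩).1 }
  have h1 : HasSum (f ∘ ((↑) : {k : Occ s n | k.1 i ≠ 0} → Occ s n)) x ↔ HasSum f x :=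
    hasSum_subtype_iff_of_support_subset fun k hk hk0 => hk (hf k hk0)
  have h2 : HasSum (g ∘ ((↑) : {k : Occ s n | raiseCoeff s (k.1 i) ≠ 0} → Occ s n)) x ↔
      HasSum g x :=
    hasSum_subtype_iff_of_support_subset fun k hk hk0 => hk (hg k hk0)
  rw [← h1, ← h2]
  have h3 : g ∘ ((↑) : {k : Occ s n | raiseCoeff s (k.1 i) ≠ 0} → Occ s n) =
      (f ∘ ((↑) : {k : Occ s n | k.1 i ≠ 0} → Occ s n)) ∘ e := by
    funext k
    exact (h k.1 k.2).symm
  rw [h3]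
  exact (e.hasSum_iff).symm

/-- The one-body reduced density matrix in terms of a spectral decomposition. -/
theorem hasSum_oneRDM {ρ : Fock s n →L[ℂ] Fock s n} {κ : Type*}
    {b : HilbertBasis κ ℂ (Fock s n)} {w : κ → ℝ} (h : IsDiag ρ b w) (hw : ∀ k, 0 ≤ w k)
    {η : κ → (numberSpace s n).carrier} (hη : ∀ k, w k ≠ 0 → (numberSpace s n).J (η k) = b k)
    (hsum : Summable fun k => w k * ‖η k‖ ^ 2) (i j : Fin n) :
    Summable (fun m => (w m : ℂ) * inner ℂ (annihExt s j (η m)) (annihExt s i (η m))) ∧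
    HasSum (fun k : Occ s n =>
      inner ℂ (ket k) (ρ (toFock (create s n j (annih s n i (Finsupp.single k 1))))))
      (∑' m, (w m : ℂ) * inner ℂ (annihExt s j (η m)) (annihExt s i (η m))) := by
  let g : κ → Occ s n → ℂ := fun m k =>
    (w m : ℂ) * ((starRingEnd ℂ) (annihExt s j (η m) k) * annihExt s i (η m) k)
  have hg : ∀ m, HasSum (g m) ((w m : ℂ) * inner ℂ (annihExt s j (η m)) (annihExt s i (η m))) :=
    fun m => by
      refine HasSum.mul_left _ ((lp.hasSum_inner (𝕜 := ℂ) (annihExt s j (η m))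
        (annihExt s i (η m))).of_fun_eq fun k => ?_)
      rw [RCLike.inner_apply, mul_comm]
  have hsq : ∀ i, Summable fun p : κ × Occ s n => w p.1 * ‖annihExt s i (η p.1) p.2‖ ^ 2 := by
    intro i
    have h1 : Summable fun m => w m * ‖annihExt s i (η m)‖ ^ 2 := by
      refine Summable.of_nonneg_of_le (fun m => mul_nonneg (hw m) (sq_nonneg _)) (fun m => ?_)
        (hsum.mul_left (‖annihExt s i‖ ^ 2))
      calc w m * ‖annihExt s i (η m)‖ ^ 2 ≤ w m * (‖annihExt s i‖ * ‖η m‖) ^ 2 := by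
            gcongr
            · exact hw m
            · exact ContinuousLinearMap.le_opNorm _ _
        _ = _ := by ring
    exact (hasSum_uncurry_of_nonneg
      (g := fun m k => w m * ‖annihExt s i (η m) k‖ ^ 2)
      (fun m k => mul_nonneg (hw m) (sq_nonneg _))
      (fun m => (hasSum_ket (annihExt s i (η m))).mul_left (w m)) h1.hasSum).summable
  -- The terms are bounded by sums of squares, so Fubini applies; both squares are summable because
  -- the mean particle number is finite.
  have hgs : Summable fun p : κ × Occ s n => g p.1 p.2 := by
    refine Summable.of_norm_bounded ((hsq i).add (hsq j)) fun p => ?_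
    simp only [g, norm_mul, Complex.norm_real, Real.norm_eq_abs, abs_of_nonneg (hw _),
      RCLike.norm_conj]
    rw [← mul_add]
    refine mul_le_mul_of_nonneg_left ?_ (hw _)
    nlinarith [sq_nonneg (‖annihExt s i (η p.1) p.2‖ - ‖annihExt s j (η p.1) p.2‖),
      sq_nonneg (‖annihExt s i (η p.1) p.2‖), sq_nonneg (‖annihExt s j (η p.1) p.2‖)]
  have hrow : HasSum (fun m => (w m : ℂ) * inner ℂ (annihExt s j (η m)) (annihExt s i (η m)))
      (∑' p : κ × Occ s n, g p.1 p.2) := hgs.hasSum.prod_fiberwise hg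
  refine ⟨hrow.summable, ?_⟩
  rw [hrow.tsum_eq]
  have hcol : HasSum (fun k => ∑' m, g m k) (∑' p : κ × Occ s n, g p.1 p.2) := by
    have h2 : HasSum (fun p : Occ s n × κ => g p.2 p.1) (∑' p : κ × Occ s n, g p.1 p.2) :=
      (Equiv.prodComm (Occ s n) κ).hasSum_iff.2 hgs.hasSum
    exact h2.prod_fiberwise fun k => (h2.summable.prod_factor k).hasSum
  -- The defining trace is indexed by the occupation before annihilation in `i`, `g` by the one
  -- after it.
  refine (hasSum_raiseOcc i (fun k hk => ?_) (fun k hk => ?_) (fun k hk => ?_)).2 hcol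
  · rw [annih_single]
    simp [hk]
  · have : ∀ m, g m k = 0 := fun m => by
      simp only [g, annihExt_apply i, hk]
      simp
    simp [this]
  · refine (h.hasSum_inner _ _).unique (HasSum.of_fun_eq
      ((hgs.prod_symm.prod_factor k).hasSum) fun m => ?_)
    have hk' := (raiseOcc_eq_iff k _ i).1 ⟨rfl, hk⟩
    rcases eq_or_ne (w m) 0 with h0 | h0
    · simp [g, h0]
    have h5 : annih s n i (Finsupp.single (raiseOcc k i) 1) =
        Finsupp.single k (phase s k.1 i * (raiseCoeff s (k.1 i) : ℂ)) := by
      rw [annih_single, ← hk'.1, phase_raiseOcc_self, one_mul, raiseOcc_same,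
        sqrt_raiseNumber hk]
    rw [h5, inner_ket, ← inner_conj_symm, ← hη m h0]
    have h6 : (Finsupp.single k (phase s k.1 i * (raiseCoeff s (k.1 i) : ℂ)) : PreFock s n) =
      (phase s k.1 i * (raiseCoeff s (k.1 i) : ℂ)) • Finsupp.single k 1 := by simp
    rw [h6, map_smul, map_smul, inner_smul_left, ← inner_annihExt, toFock_single, one_smul,
      inner_ket]
    simp only [g, annihExt_apply i, map_mul, conj_phase, Complex.conj_ofReal, Prod.swap_prod_mk]
    ring

end OneBody

end

end RDM

namespace RDM

noncomputable section

/-! ### Particle number controls entropy -/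

section NumberExpectation

variable {s : Statistics} {n : ℕ}

theorem norm_sq_numberSpace (η : (numberSpace s n).carrier) :
    ‖η‖ ^ 2 = ∑ i, ‖annihExt s i η‖ ^ 2 + ‖(numberSpace s n).J η‖ ^ 2 := by
  refine (numberSpace s n).dense.induction_on (p := fun η => ‖η‖ ^ 2 =
    ∑ i, ‖annihExt s i η‖ ^ 2 + ‖(numberSpace s n).J η‖ ^ 2) η ?_ ?_
  · exact isClosed_eq (by fun_prop) (by fun_prop)
  · intro φ
    simp only [FormSpace.norm_emb_sq, quad_numberOp, annihExt_emb, FormSpace.J_emb]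
    ring

/-- The total particle number of an occupation. -/
def particles (k : Occ s n) : ℕ := ∑ i, k.1 i

theorem hasSum_particles (η : (numberSpace s n).carrier) :
    HasSum (fun k : Occ s n => (particles k : ℝ) * ‖(numberSpace s n).J η k‖ ^ 2)
      (‖η‖ ^ 2 - ‖(numberSpace s n).J η‖ ^ 2) := by
  rw [norm_sq_numberSpace, add_sub_cancel_right]
  have h : ∀ i, HasSum (fun k : Occ s n => (k.1 i : ℝ) * ‖(numberSpace s n).J η k‖ ^ 2)
      (‖annihExt s i η‖ ^ 2) := by
    intro i
    refine (hasSum_raiseOcc i (fun k hk => by simp [hk]) (fun k hk => ?_) (fun k hk => ?_)).2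
      (hasSum_ket (annihExt s i η))
    · rw [annihExt_apply, hk]; simp
    · rw [annihExt_apply, norm_mul, norm_mul, norm_phase, one_mul, raiseOcc_same, mul_pow,
        Complex.norm_real, Real.norm_eq_abs, sq_abs, ← sqrt_raiseNumber hk,
        Real.sq_sqrt (Nat.cast_nonneg _)]
  refine (hasSum_sum fun i (_ : i ∈ Finset.univ) => h i).of_fun_eq fun k => ?_
  rw [particles, ← Finset.sum_mul]
  push_cast; rfl

/-- A product of `n` geometric series: the free partition function of bosons, which also bounds the
fermionic one. -/
theorem summable_pi_exp {x : ℝ} (hx : 0 < x) : ∀ n : ℕ,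
    Summable fun k : Fin n → ℕ => Real.exp (-x * (∑ i, k i : ℕ))
  | 0 => Summable.of_finite
  | n + 1 => by
    have h1 : Summable fun m : ℕ => Real.exp (-x * m) := by
      simpa [mul_comm] using Real.summable_exp_nat_mul_iff.2 (neg_lt_zero.2 hx)
    have h2 := h1.mul_of_nonneg (summable_pi_exp hx n) (fun _ => (Real.exp_pos _).le)
      (fun _ => (Real.exp_pos _).le)
    rw [← (Fin.consEquiv fun _ => ℕ).summable_iff]
    refine h2.congr fun p => ?_
    rw [← Real.exp_add]
    simp only [Function.comp_apply, Fin.consEquiv, Equiv.coe_fn_mk, Fin.sum_univ_succ,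
      Fin.cons_zero, Fin.cons_succ]
    congr 1
    push_cast; ring

theorem summable_exp_particles {x : ℝ} (hx : 0 < x) :
    Summable fun k : Occ s n => Real.exp (-x * particles k) :=
  (summable_pi_exp hx n).comp_injective Subtype.val_injective

instance : Inhabited (Occ s n) := ⟨⟨fun _ => 0, fun _ _ => Nat.zero_le _⟩⟩

theorem hasSum_gibbsWeight {ι : Type*} [Nonempty ι] {f : ι → ℝ}
    (hf : Summable fun k => Real.exp (f k)) :
    0 < ∑' l, Real.exp (f l) ∧
      HasSum (fun k => Real.exp (f k) / ∑' l, Real.exp (f l)) 1 := by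
  have h : 0 < ∑' l, Real.exp (f l) :=
    hf.tsum_pos (fun _ => (Real.exp_pos _).le) (Classical.arbitrary ι) (Real.exp_pos _)
  exact ⟨h, by simpa [h.ne'] using hf.hasSum.div_const (∑' l, Real.exp (f l))⟩

/-- The entropy is bounded by the particle number. -/
theorem entropy_le_particles {κ : Type*} {b : HilbertBasis κ ℂ (Fock s n)} {w : κ → ℝ}
    (hw : ∀ k, 0 ≤ w k) (hw1 : HasSum w 1) {η : κ → (numberSpace s n).carrier}
    (hη : ∀ k, w k ≠ 0 → (numberSpace s n).J (η k) = b k) {M : ℝ}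
    (hM : HasSum (fun k => w k * (‖η k‖ ^ 2 - 1)) M) {x : ℝ} (hx : 0 < x) :
    Summable (fun k => Real.negMulLog (w k)) ∧ ∑' k, Real.negMulLog (w k) ≤
      x * M + Real.log (∑' k : Occ s n, Real.exp (-x * particles k)) := by
  obtain ⟨hZ, hl⟩ := hasSum_gibbsWeight (summable_exp_particles (s := s) (n := n) hx)
  set Z := ∑' k : Occ s n, Real.exp (-x * particles k)
  have hlog : ∀ k : Occ s n, -Real.log (Real.exp (-x * particles k) / Z) =
      x * particles k + Real.log Z := fun k => by
    rw [Real.log_div (Real.exp_pos _).ne' hZ.ne', Real.log_exp]; ring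
  have hlog0 : ∀ k : Occ s n, 0 ≤ -Real.log (Real.exp (-x * particles k) / Z) := fun k => by
    have h1 : Real.exp (-x * particles k) / Z ≤ 1 :=
      le_hasSum hl k fun j _ => div_nonneg (Real.exp_pos _).le hZ.le
    have := Real.log_nonpos (div_nonneg (Real.exp_pos _).le hZ.le) h1
    linarith
  -- The comparison distribution is the free Gibbs state in the number basis; minus its logarithm is
  -- affine in the particle number.
  refine klein_inequality (g := fun k l => ‖inner ℂ (b k) (ketBasis s n l)‖ ^ 2)
    (fun _ _ => sq_nonneg _) (hasSum_overlap_right b _) (hasSum_overlap_left b _) hw hw1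
    (l := fun k => Real.exp (-x * particles k) / Z)
    (fun k => div_nonneg (Real.exp_pos _).le hZ.le) hl
    (fun _ k _ _ => (div_pos (Real.exp_pos _) hZ).ne') ?_
  refine hasSum_uncurry_of_nonneg (g := fun k l => ‖inner ℂ (b k) (ketBasis s n l)‖ ^ 2 *
      (w k * -Real.log (Real.exp (-x * particles l) / Z)))
      (r := fun k => x * (w k * (‖η k‖ ^ 2 - 1)) + w k * Real.log Z)
    (fun k l => mul_nonneg (sq_nonneg _) (mul_nonneg (hw k) (hlog0 l))) (fun k => ?_) ?_
  · rcases eq_or_ne (w k) 0 with h0 | h0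
    · simp [h0]
    have h1 := hasSum_particles (η k)
    rw [hη k h0, b.orthonormal.1 k, one_pow] at h1
    have h2 := hasSum_ket (b k)
    rw [b.orthonormal.1 k, one_pow] at h2
    have h3 := (h1.mul_left (w k * x)).add (h2.mul_left (w k * Real.log Z))
    rw [show x * (w k * (‖η k‖ ^ 2 - 1)) + w k * Real.log Z =
      w k * x * (‖η k‖ ^ 2 - 1) + w k * Real.log Z * 1 by ring]
    refine h3.of_fun_eq fun l => ?_
    rw [hlog, ketBasis_apply, norm_inner_symm, inner_ket]
    ring
  · have := (hM.mul_left x).add (hw1.mul_right (Real.log Z))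
    simpa using this

end NumberExpectation

/-! ### Density operators, energy and entropy of mixtures -/

section States

variable {s : Statistics} {n : ℕ}

theorem IsDensityOp.exists_isDiag {ρ : Fock s n →L[ℂ] Fock s n} (hρ : IsDensityOp ρ) :
    ∃ (b : HilbertBasis (Occ s n) ℂ (Fock s n)) (w : Occ s n → ℝ), IsDiag ρ b w :=
  RDM.exists_isDiag (ketBasis s n) hρ.1 (by simpa using hρ.2.summable)

theorem IsDensityOp.weights {ρ : Fock s n →L[ℂ] Fock s n} (hρ : IsDensityOp ρ) {κ : Type*}
    {b : HilbertBasis κ ℂ (Fock s n)} {w : κ → ℝ} (h : IsDiag ρ b w) :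
    (∀ k, 0 ≤ w k) ∧ HasSum w 1 := by
  have h0 := h.nonneg hρ.1
  exact ⟨h0, (h.hasSum_trace_iff h0 (ketBasis s n) 1).1 (by simpa using hρ.2)⟩

theorem IsDiag.isDensityOp {ρ : Fock s n →L[ℂ] Fock s n} {κ : Type*}
    {b : HilbertBasis κ ℂ (Fock s n)} {w : κ → ℝ} (h : IsDiag ρ b w) (h0 : ∀ k, 0 ≤ w k)
    (h1 : HasSum w 1) : IsDensityOp ρ :=
  ⟨h.isPositive h0, by simpa using (h.hasSum_trace_iff h0 (ketBasis s n) 1).2 h1⟩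

theorem hasSum_le_one {κ : Type*} {w : κ → ℝ} (h0 : ∀ k, 0 ≤ w k) (h1 : HasSum w 1) (k : κ) :
    w k ≤ 1 := le_hasSum h1 k fun j _ => h0 j

/-- The convex combination of two operators. -/
def mix (c : ℝ) (ρ₁ ρ₂ : Fock s n →L[ℂ] Fock s n) : Fock s n →L[ℂ] Fock s n :=
  ((1 - c : ℝ) : ℂ) • ρ₁ + (c : ℂ) • ρ₂

theorem mix_apply (c : ℝ) (ρ₁ ρ₂ : Fock s n →L[ℂ] Fock s n) (x : Fock s n) :
    mix c ρ₁ ρ₂ x = ((1 - c : ℝ) : ℂ) • ρ₁ x + (c : ℂ) • ρ₂ x := rfl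

theorem inner_mix (c : ℝ) (ρ₁ ρ₂ : Fock s n →L[ℂ] Fock s n) (x y : Fock s n) :
    inner ℂ x (mix c ρ₁ ρ₂ y) =
      ((1 - c : ℝ) : ℂ) * inner ℂ x (ρ₁ y) + (c : ℂ) * inner ℂ x (ρ₂ y) := by
  rw [mix_apply, inner_add_right, inner_smul_right, inner_smul_right]

theorem re_inner_mix (c : ℝ) (ρ₁ ρ₂ : Fock s n →L[ℂ] Fock s n) (x y : Fock s n) :
    (inner ℂ x (mix c ρ₁ ρ₂ y)).re =
      (1 - c) * (inner ℂ x (ρ₁ y)).re + c * (inner ℂ x (ρ₂ y)).re := by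
  rw [inner_mix, Complex.add_re, Complex.re_ofReal_mul, Complex.re_ofReal_mul]

theorem IsDensityOp.mix {ρ₁ ρ₂ : Fock s n →L[ℂ] Fock s n} (h₁ : IsDensityOp ρ₁)
    (h₂ : IsDensityOp ρ₂) {c : ℝ} (hc0 : 0 ≤ c) (hc1 : c ≤ 1) : IsDensityOp (mix c ρ₁ ρ₂) := by
  refine ⟨(h₁.1.smul_of_nonneg ?_).add (h₂.1.smul_of_nonneg ?_), ?_⟩
  · exact_mod_cast sub_nonneg.2 hc1
  · exact_mod_cast hc0
  · have := (h₁.2.mul_left (1 - c)).add (h₂.2.mul_left c)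
    simp only [re_inner_mix]
    simpa using this

theorem HasOneRDM.mix {ρ₁ ρ₂ : Fock s n →L[ℂ] Fock s n} {γ₁ γ₂ : HermMat n}
    (h₁ : HasOneRDM ρ₁ γ₁) (h₂ : HasOneRDM ρ₂ γ₂) (c : ℝ) :
    HasOneRDM (mix c ρ₁ ρ₂) ((1 - c) • γ₁ + c • γ₂) := by
  intro i j
  have := ((h₁ i j).mul_left ((1 - c : ℝ) : ℂ)).add ((h₂ i j).mul_left (c : ℂ))
  simp only [inner_mix]
  have hγ : (((1 - c) • γ₁ + c • γ₂ : HermMat n) : Matrix (Fin n) (Fin n) ℂ) i j =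
      ((1 - c : ℝ) : ℂ) * (γ₁ : Matrix (Fin n) (Fin n) ℂ) i j +
        (c : ℂ) * (γ₂ : Matrix (Fin n) (Fin n) ℂ) i j := by
    simp only [AddSubgroup.coe_add, selfAdjoint.val_smul, Matrix.add_apply, Matrix.smul_apply,
      Complex.real_smul]
  rw [hγ]
  exact this

theorem HasOneRDM.unique {ρ : Fock s n →L[ℂ] Fock s n} {γ₁ γ₂ : HermMat n}
    (h₁ : HasOneRDM ρ γ₁) (h₂ : HasOneRDM ρ γ₂) : γ₁ = γ₂ := by
  apply Subtype.ext
  ext i j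
  exact (h₁ i j).unique (h₂ i j)

theorem HasEnergy.exists_operator {A : Module.End ℂ (PreFock s n)} {C : ℝ} (Q : FormSpace A C)
    {ρ : Fock s n →L[ℂ] Fock s n} (hρ : IsDensityOp ρ) {E : ℝ} (h : HasEnergy A ρ E) :
    ∃ R : Q.carrier →L[ℂ] Q.carrier,
      R.IsPositive ∧ (∀ x, Q.J (R (ContinuousLinearMap.adjoint Q.J x)) = ρ x) ∧
      ∀ {κ : Type _} (f : HilbertBasis κ ℂ Q.carrier),
        HasSum (fun i => (inner ℂ (f i) (R (f i))).re) (E + (C + 1)) := by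
  obtain ⟨b, w, hd, e, he, hE⟩ := h
  obtain ⟨hw0, hw1⟩ := hρ.weights hd
  have h1 : ∀ k, ∃ ξ, w k ≠ 0 → Q.J ξ = b k ∧ ‖ξ‖ ^ 2 = e k + (C + 1) := fun k => by
    by_cases hk : w k = 0
    · exact ⟨0, fun h => absurd hk h⟩
    · obtain ⟨ξ, h2, h3⟩ := Q.hasFormValue_iff.1 (he k hk)
      rw [b.orthonormal.1 k, one_pow, mul_one] at h3
      exact ⟨ξ, fun _ => ⟨h2, h3⟩⟩
  choose ξ hξ using h1
  refine exists_energyOperator hd hw0 (fun k hk => (hξ k hk).1) ?_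
  have h4 := hE.add (hw1.mul_right (C + 1))
  rw [one_mul] at h4
  refine h4.of_fun_eq fun k => ?_
  by_cases hk : w k = 0
  · simp [hk]
  · rw [(hξ k hk).2]; ring

/-- Any positive `R` above `ρ` gives an upper bound for the energy. Together with
`HasEnergy.exists_operator` this replaces a trace formula for the energy. -/
theorem exists_hasEnergy_le {A : Module.End ℂ (PreFock s n)} {C : ℝ} (Q : FormSpace A C)
    {ρ : Fock s n →L[ℂ] Fock s n} (hρ : IsDensityOp ρ) {R : Q.carrier →L[ℂ] Q.carrier}
    (hR : R.IsPositive) (hJ : ∀ x, Q.J (R (ContinuousLinearMap.adjoint Q.J x)) = ρ x)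
    {κ : Type*} (f : HilbertBasis κ ℂ Q.carrier) {E : ℝ}
    (ht : HasSum (fun i => (inner ℂ (f i) (R (f i))).re) (E + (C + 1))) :
    ∃ E', E' ≤ E ∧ HasEnergy A ρ E' := by
  obtain ⟨b, w, hd⟩ := hρ.exists_isDiag
  obtain ⟨hw0, hw1⟩ := hρ.weights hd
  obtain ⟨ξ, hξ, hs, hle⟩ := exists_energyVectors hd hw0 hR hJ f ht
  have h5 := hs.hasSum.sub (hw1.mul_right (C + 1))
  refine ⟨∑' k, w k * ‖ξ k‖ ^ 2 - 1 * (C + 1), by linarith, b, w, hd,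
    fun k => ‖ξ k‖ ^ 2 - (C + 1), fun k hk => ?_, h5.of_fun_eq fun k => by ring⟩
  rw [Q.hasFormValue_iff]
  refine ⟨ξ k, hξ k hk, ?_⟩
  rw [b.orthonormal.1 k]; ring

/-- The energy is convex. -/
theorem HasEnergy.mix {A : Module.End ℂ (PreFock s n)} (hA : IsHermitianOp A)
    (hb : IsBoundedBelow A) {ρ₁ ρ₂ : Fock s n →L[ℂ] Fock s n} (hρ₁ : IsDensityOp ρ₁)
    (hρ₂ : IsDensityOp ρ₂) {E₁ E₂ : ℝ} (h₁ : HasEnergy A ρ₁ E₁) (h₂ : HasEnergy A ρ₂ E₂)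
    {c : ℝ} (hc0 : 0 ≤ c) (hc1 : c ≤ 1) :
    ∃ E, E ≤ (1 - c) * E₁ + c * E₂ ∧ HasEnergy A (mix c ρ₁ ρ₂) E := by
  obtain ⟨C, hC⟩ := hb
  obtain ⟨Q⟩ := exists_formSpace hA hC
  obtain ⟨R₁, hR₁, hJ₁, ht₁⟩ := h₁.exists_operator Q hρ₁
  obtain ⟨R₂, hR₂, hJ₂, ht₂⟩ := h₂.exists_operator Q hρ₂
  obtain ⟨W, f, -⟩ := exists_hilbertBasis ℂ Q.carrier
  -- The eigenbasis of the mixture bears no relation to those of its components, but the lifted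
  -- operators mix linearly.
  let R : Q.carrier →L[ℂ] Q.carrier := ((1 - c : ℝ) : ℂ) • R₁ + (c : ℂ) • R₂
  have hR : R.IsPositive :=
    (hR₁.smul_of_nonneg (by exact_mod_cast sub_nonneg.2 hc1)).add
      (hR₂.smul_of_nonneg (by exact_mod_cast hc0))
  refine exists_hasEnergy_le Q (hρ₁.mix hρ₂ hc0 hc1) hR (fun x => ?_) f ?_
  · simp only [R, _root_.add_apply, _root_.smul_apply, map_add, map_smul, hJ₁, hJ₂, mix_apply]
  · rw [show (1 - c) * E₁ + c * E₂ + (C + 1) =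
      (1 - c) * (E₁ + (C + 1)) + c * (E₂ + (C + 1)) by ring]
    refine (((ht₁ f).mul_left (1 - c)).add ((ht₂ f).mul_left c)).of_fun_eq fun i => ?_
    simp only [R, _root_.add_apply, _root_.smul_apply, inner_add_right,
      inner_smul_right, Complex.add_re, Complex.re_ofReal_mul]

/-- Klein's inequality for a state that is compared with a diagonal state. -/
theorem entropy_le_cross {ρ : Fock s n →L[ℂ] Fock s n} {κ ι : Type*}
    {b : HilbertBasis κ ℂ (Fock s n)} {w : κ → ℝ} (h : IsDiag ρ b w) (hw0 : ∀ k, 0 ≤ w k)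
    (hw1 : HasSum w 1) {b' : HilbertBasis ι ℂ (Fock s n)} {l : ι → ℝ} (hl0 : ∀ k, 0 ≤ l k)
    (hl1 : HasSum l 1) (hsupp : ∀ j, l j = 0 → (inner ℂ (b' j) (ρ (b' j))).re = 0) {T : ℝ}
    (hT : HasSum (fun j => (inner ℂ (b' j) (ρ (b' j))).re * -Real.log (l j)) T) :
    Summable (fun k => Real.negMulLog (w k)) ∧ ∑' k, Real.negMulLog (w k) ≤ T := by
  refine klein_inequality (g := fun k j => ‖inner ℂ (b k) (b' j)‖ ^ 2)
    (fun _ _ => sq_nonneg _) (hasSum_overlap_right b b') (hasSum_overlap_left b b') hw0 hw1 hl0 hl1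
    ?_ ?_
  · intro k j hkj hk hj
    have h1 := le_hasSum (h.hasSum_quad (b' j)) k
      fun i _ => mul_nonneg (hw0 i) (sq_nonneg _)
    rw [hsupp j hj] at h1
    have h2 : 0 < w k * ‖inner ℂ (b k) (b' j)‖ ^ 2 :=
      mul_pos (lt_of_le_of_ne (hw0 k) (Ne.symm hk)) (lt_of_le_of_ne (sq_nonneg _) (Ne.symm hkj))
    linarith
  · have h1 := hasSum_uncurry_of_nonneg
      (g := fun j k => ‖inner ℂ (b k) (b' j)‖ ^ 2 * (w k * -Real.log (l j)))
      (fun j k => mul_nonneg (sq_nonneg _) (mul_nonneg (hw0 k)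
        (neg_nonneg.2 (Real.log_nonpos (hl0 j) (hasSum_le_one hl0 hl1 j)))))
      (fun j => ((h.hasSum_quad (b' j)).mul_right (-Real.log (l j))).of_fun_eq
        fun k => by ring) hT
    exact (Equiv.prodComm κ ι).hasSum_iff.2 h1

/-- The entropy of a convex combination. -/
theorem entropy_mix {ρ₁ ρ₂ : Fock s n →L[ℂ] Fock s n} (hρ₁ : IsDensityOp ρ₁)
    (hρ₂ : IsDensityOp ρ₂) {c : ℝ} (hc0 : 0 < c) (hc1 : c < 1) {ι : Type*}
    {b : HilbertBasis ι ℂ (Fock s n)} {w : ι → ℝ} (h : IsDiag (mix c ρ₁ ρ₂) b w) {S : ℝ}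
    (hS : HasSum (fun k => Real.negMulLog (w k)) S) :
    ∃ T₁ T₂ : ℝ, S = (1 - c) * T₁ + c * T₂ ∧
      HasSum (fun j => (inner ℂ (b j) (ρ₁ (b j))).re * -Real.log (w j)) T₁ ∧
      HasSum (fun j => (inner ℂ (b j) (ρ₂ (b j))).re * -Real.log (w j)) T₂ ∧
      (∀ j, w j = 0 → (inner ℂ (b j) (ρ₁ (b j))).re = 0) ∧
      (∀ j, w j = 0 → (inner ℂ (b j) (ρ₂ (b j))).re = 0) := by
  -- In the eigenbasis of the mixture its weights are convex combinations of the diagonals of the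
  -- two states, so its entropy splits into two cross entropies.
  obtain ⟨hw0, hw1⟩ := (hρ₁.mix hρ₂ hc0.le hc1.le).weights h
  have hd : ∀ j, w j = (1 - c) * (inner ℂ (b j) (ρ₁ (b j))).re +
      c * (inner ℂ (b j) (ρ₂ (b j))).re := fun j => by rw [← h.inner_apply j, re_inner_mix]
  have hp₁ : ∀ j, 0 ≤ (inner ℂ (b j) (ρ₁ (b j))).re := fun j => hρ₁.1.re_inner_nonneg_right _
  have hp₂ : ∀ j, 0 ≤ (inner ℂ (b j) (ρ₂ (b j))).re := fun j => hρ₂.1.re_inner_nonneg_right _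
  have hlog : ∀ j, 0 ≤ -Real.log (w j) := fun j =>
    neg_nonneg.2 (Real.log_nonpos (hw0 j) (hasSum_le_one hw0 hw1 j))
  have hneg : ∀ j, Real.negMulLog (w j) = w j * -Real.log (w j) := fun j => by
    rw [Real.negMulLog]; ring
  have hc' : 0 < 1 - c := sub_pos.2 hc1
  -- All terms are nonnegative, and since `1 - c` is strictly positive the full entropy series
  -- dominates this part.
  have hs₁ : Summable fun j => (inner ℂ (b j) (ρ₁ (b j))).re * -Real.log (w j) := by
    refine Summable.of_nonneg_of_le (fun j => mul_nonneg (hp₁ j) (hlog j)) (fun j => ?_)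
      (hS.summable.mul_left (1 - c)⁻¹)
    rw [hneg, ← mul_assoc]
    refine mul_le_mul_of_nonneg_right ?_ (hlog j)
    rw [inv_mul_eq_div, le_div_iff₀ hc', hd j, mul_comm]
    exact le_add_of_nonneg_right (mul_nonneg hc0.le (hp₂ j))
  have hs₂ : Summable fun j => (inner ℂ (b j) (ρ₂ (b j))).re * -Real.log (w j) := by
    refine Summable.of_nonneg_of_le (fun j => mul_nonneg (hp₂ j) (hlog j)) (fun j => ?_)
      (hS.summable.mul_left c⁻¹)
    rw [hneg, ← mul_assoc]
    refine mul_le_mul_of_nonneg_right ?_ (hlog j)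
    rw [inv_mul_eq_div, le_div_iff₀ hc0, hd j, mul_comm]
    exact le_add_of_nonneg_left (mul_nonneg hc'.le (hp₁ j))
  refine ⟨_, _, ?_, hs₁.hasSum, hs₂.hasSum, fun j hj => ?_, fun j hj => ?_⟩
  · refine hS.unique (((hs₁.hasSum.mul_left (1 - c)).add (hs₂.hasSum.mul_left c)).of_fun_eq
      fun j => ?_)
    rw [hneg]
    calc w j * -Real.log (w j) = ((1 - c) * (inner ℂ (b j) (ρ₁ (b j))).re +
          c * (inner ℂ (b j) (ρ₂ (b j))).re) * -Real.log (w j) := by rw [← hd j]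
      _ = _ := by ring
  · have := hd j
    nlinarith [hp₁ j, hp₂ j]
  · have := hd j
    nlinarith [hp₁ j, hp₂ j]

end States

end

end RDM

namespace RDM

noncomputable section

/-! ### Pure states of finite vectors -/

section PureStates

variable {s : Statistics} {n : ℕ}

/-- The pure state of a vector. -/
def pure (ψ : Fock s n) : Fock s n →L[ℂ] Fock s n := InnerProductSpace.rankOne ℂ ψ ψ

theorem pure_apply (ψ χ : Fock s n) : pure ψ χ = inner ℂ ψ χ • ψ := by
  simp [pure]

theorem re_inner_pure (ψ χ : Fock s n) : (inner ℂ χ (pure ψ χ)).re = ‖inner ℂ χ ψ‖ ^ 2 := by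
  rw [pure_apply, inner_smul_right, ← inner_conj_symm, ← Complex.normSq_eq_conj_mul_self,
    Complex.ofReal_re, Complex.normSq_eq_norm_sq]

theorem isDensityOp_pure {ψ : Fock s n} (hψ : ‖ψ‖ = 1) : IsDensityOp (pure ψ) := by
  refine ⟨InnerProductSpace.isPositive_rankOne_self ψ, ?_⟩
  simp only [re_inner_pure]
  simpa [hψ] using hasSum_normSq_inner (ketBasis s n) ψ

/-- The lift of the pure state is the rank-one operator of `Q.emb φ` in the form space. -/
theorem exists_hasEnergy_pure {A : Module.End ℂ (PreFock s n)} (hA : IsHermitianOp A)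
    (hb : IsBoundedBelow A) {φ : PreFock s n} (hφ : ‖toFock φ‖ = 1) :
    ∃ E, E ≤ quad A φ ∧ HasEnergy A (pure (toFock φ)) E := by
  obtain ⟨C, hC⟩ := hb
  obtain ⟨Q⟩ := exists_formSpace hA hC
  obtain ⟨W, f, -⟩ := exists_hilbertBasis ℂ Q.carrier
  refine exists_hasEnergy_le Q (isDensityOp_pure hφ)
    (R := InnerProductSpace.rankOne ℂ (Q.emb φ) (Q.emb φ))
    (InnerProductSpace.isPositive_rankOne_self _) (fun x => ?_) f ?_
  · rw [InnerProductSpace.rankOne_apply, map_smul, ContinuousLinearMap.adjoint_inner_right,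
      Q.J_emb, pure_apply]
  · have h := hasSum_normSq_inner f (Q.emb φ)
    rw [Q.norm_emb_sq, hφ] at h
    rw [one_pow, mul_one] at h
    refine h.of_fun_eq fun i => ?_
    rw [InnerProductSpace.rankOne_apply, inner_smul_right, ← inner_conj_symm,
      ← Complex.normSq_eq_conj_mul_self, Complex.ofReal_re, Complex.normSq_eq_norm_sq]

variable (s) in
/-- The one-body reduced density matrix of a vector. -/
def vectorRDM (η : (numberSpace s n).carrier) : HermMat n :=
  ⟨Matrix.of fun i j => inner ℂ (annihExt s j η) (annihExt s i η), by
    rw [selfAdjoint.mem_iff]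
    ext i j
    simp [Matrix.star_apply]⟩

theorem oneBody_eq_tracePairing (v : HermMat n) (η : (numberSpace s n).carrier) :
    oneBody v η = tracePairing v (vectorRDM s η) := by
  simp [oneBody, tracePairing, vectorRDM, Matrix.trace, Matrix.mul_apply]

theorem hasOneRDM_pure (φ : PreFock s n) :
    HasOneRDM (pure (toFock φ)) (vectorRDM s ((numberSpace s n).emb φ)) := by
  intro i j
  have h1 : HasSum (fun k : Occ s n => inner ℂ (ket k) (pure (toFock φ)
      (toFock (create s n j (annih s n i (Finsupp.single k 1))))))
      (∑ k ∈ φ.support, inner ℂ (ket k) (pure (toFock φ)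
      (toFock (create s n j (annih s n i (Finsupp.single k 1)))))) := by
    refine hasSum_sum_of_ne_finset_zero fun k hk => ?_
    rw [pure_apply, inner_smul_right, inner_ket, toFock_apply, Finsupp.notMem_support_iff.1 hk,
      mul_zero]
  convert h1 using 1
  have h2 : φ = ∑ k ∈ φ.support, φ k • Finsupp.single k (1 : ℂ) := by
    conv_lhs => rw [← Finsupp.sum_single φ]
    exact Finset.sum_congr rfl fun k _ => by simp
  have h3 : inner ℂ (toFock φ) (toFock (create s n j (annih s n i φ))) =
      ∑ k ∈ φ.support, φ k *
        inner ℂ (toFock φ) (toFock (create s n j (annih s n i (Finsupp.single k 1)))) := by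
    calc inner ℂ (toFock φ) (toFock (create s n j (annih s n i φ)))
        = inner ℂ (toFock φ) (toFock (create s n j (annih s n i
          (∑ k ∈ φ.support, φ k • Finsupp.single k (1 : ℂ))))) := by rw [← h2]
      _ = _ := by simp only [map_sum, map_smul, inner_sum, inner_smul_right]
  simp only [vectorRDM, annihExt_emb, Matrix.of_apply, inner_annih]
  rw [h3]
  refine Finset.sum_congr rfl fun k _ => ?_
  rw [pure_apply, inner_smul_right, inner_ket, toFock_apply, mul_comm]

end PureStates

/-! ### The grand potential: lower bound, convexity, admixtures -/

section GrandPotential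

variable {s : Statistics} {n : ℕ}

theorem DominatesNumber.isBoundedBelow {A : Module.End ℂ (PreFock s n)} (h : DominatesNumber A) :
    IsBoundedBelow A := by
  obtain ⟨K, hK, C, hC⟩ := h
  refine ⟨C, fun φ => ?_⟩
  have h1 := (quad_numberOp_nonneg φ).trans (hC φ)
  have h2 := nonneg_of_mul_nonneg_right h1 hK
  linarith

/-- A spectral decomposition of a density-matrix operator of finite grand potential. -/
structure SpectralData (β : ℝ) (A : Module.End ℂ (PreFock s n)) (ρ : Fock s n →L[ℂ] Fock s n)
    (b : HilbertBasis (Occ s n) ℂ (Fock s n)) (w e : Occ s n → ℝ) (E S ω : ℝ) : Prop where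
  diag : IsDiag ρ b w
  nonneg : ∀ k, 0 ≤ w k
  sum_weights : HasSum w 1
  formValue : ∀ k, w k ≠ 0 → HasFormValue A (b k) (e k)
  energy : HasSum (fun k => w k * e k) E
  entropy : HasSum (fun k => Real.negMulLog (w k)) S
  eq : ω = E - β⁻¹ * S

/-- The definition lets energy and entropy use different eigenbases; the entropy is transported to
the basis of the energy. -/
theorem HasGrandPotential.exists_spectralData {β : ℝ} {A : Module.End ℂ (PreFock s n)}
    {ρ : Fock s n →L[ℂ] Fock s n} (hρ : IsDensityOp ρ) {ω : ℝ} (h : HasGrandPotential β A ρ ω) :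
    ∃ b w e E S, SpectralData β A ρ b w e E S ω := by
  obtain ⟨E, S, ⟨b, w, hd, e, he, hE⟩, ⟨b', w', hd', hS⟩, hω⟩ := h
  obtain ⟨h0, h1⟩ := hρ.weights hd
  obtain ⟨h0', h1'⟩ := hρ.weights hd'
  exact ⟨b, w, e, E, S, hd, h0, h1, he, hE,
    IsDiag.hasSum_negMulLog hd' hd h0' (hasSum_le_one h0' h1') hS, hω⟩

/-- The vectors of a spectral decomposition in the form domain of the number operator. -/
theorem exists_numberVectors {A : Module.End ℂ (PreFock s n)} {K C : ℝ}
    (hA : ∀ φ, quad (numberOp s n) φ ≤ K * (quad A φ + C * ‖toFock φ‖ ^ 2))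
    {b : HilbertBasis (Occ s n) ℂ (Fock s n)} {w e : Occ s n → ℝ} (hw0 : ∀ k, 0 ≤ w k)
    (hw1 : HasSum w 1) (he : ∀ k, w k ≠ 0 → HasFormValue A (b k) (e k)) {E : ℝ}
    (hE : HasSum (fun k => w k * e k) E) :
    ∃ η : Occ s n → (numberSpace s n).carrier,
      (∀ k, w k ≠ 0 → (numberSpace s n).J (η k) = b k) ∧
      (∀ k, w k ≠ 0 → ∀ v, HasFormValue (A + potential s v) (b k) (e k + oneBody v (η k))) ∧
      (∀ k, w k * (‖η k‖ ^ 2 - 1) ≤ w k * (K * (e k + C))) ∧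
      (∀ k, 0 ≤ w k * (‖η k‖ ^ 2 - 1)) ∧
      Summable (fun k => w k * ‖η k‖ ^ 2) ∧ (∀ k, w k = 0 → η k = 0) := by
  have h1 : ∀ k, ∃ η, (w k = 0 → η = 0) ∧ (w k ≠ 0 → (numberSpace s n).J η = b k ∧
      ‖η‖ ^ 2 ≤ K * (e k + C * ‖b k‖ ^ 2) + ‖b k‖ ^ 2 ∧
      ∀ v, HasFormValue (A + potential s v) (b k) (e k + oneBody v η)) := fun k => by
    by_cases hk : w k = 0
    · exact ⟨0, fun _ => rfl, fun h => absurd hk h⟩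
    · obtain ⟨η, h2⟩ := (he k hk).exists_numberSpace hA
      exact ⟨η, fun h => absurd h hk, fun _ => h2⟩
  choose η hη0 hη using h1
  have hle : ∀ k, w k * (‖η k‖ ^ 2 - 1) ≤ w k * (K * (e k + C)) := fun k => by
    by_cases hk : w k = 0
    · simp [hk]
    · have h2 := (hη k hk).2.1
      rw [b.orthonormal.1 k] at h2
      exact mul_le_mul_of_nonneg_left (by linarith) (hw0 k)
  have hge : ∀ k, 0 ≤ w k * (‖η k‖ ^ 2 - 1) := fun k => by
    by_cases hk : w k = 0
    · simp [hk]
    · have h2 := norm_sq_numberSpace (η k)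
      rw [(hη k hk).1, b.orthonormal.1 k] at h2
      have h3 : 0 ≤ ∑ i, ‖annihExt s i (η k)‖ ^ 2 := Finset.sum_nonneg fun i _ => sq_nonneg _
      exact mul_nonneg (hw0 k) (by linarith)
  refine ⟨η, fun k hk => (hη k hk).1, fun k hk => (hη k hk).2.2, hle, hge, ?_, hη0⟩
  have hs : Summable fun k => w k * (K * (e k + C)) := by
    refine ((hE.mul_left K).add (hw1.mul_left (K * C))).summable.congr fun k => ?_
    ring
  have h4 := (Summable.of_nonneg_of_le hge hle hs).add hw1.summable
  exact h4.congr fun k => by ring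

/-- The mean particle number is at most `K * (E + C)`, so finite energy forces finite entropy. The
free parameter `x` is tuned to the temperature in `exists_le_grandPotential`. -/
theorem exists_entropy_of_energy {A : Module.End ℂ (PreFock s n)} {K C : ℝ}
    (hA : ∀ φ, quad (numberOp s n) φ ≤ K * (quad A φ + C * ‖toFock φ‖ ^ 2))
    {b : HilbertBasis (Occ s n) ℂ (Fock s n)} {w e : Occ s n → ℝ} (hw0 : ∀ k, 0 ≤ w k)
    (hw1 : HasSum w 1) (he : ∀ k, w k ≠ 0 → HasFormValue A (b k) (e k)) {E : ℝ}
    (hE : HasSum (fun k => w k * e k) E) {x : ℝ} (hx : 0 < x) :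
    Summable (fun k => Real.negMulLog (w k)) ∧ ∑' k, Real.negMulLog (w k) ≤
      x * (K * (E + C)) + Real.log (∑' k : Occ s n, Real.exp (-x * particles k)) := by
  obtain ⟨η, hη, -, hle, hge, hs, -⟩ := exists_numberVectors hA hw0 hw1 he hE
  have hM : HasSum (fun k => w k * (‖η k‖ ^ 2 - 1)) (∑' k, w k * ‖η k‖ ^ 2 - 1) :=
    (hs.hasSum.sub hw1).of_fun_eq fun k => by ring
  obtain ⟨h1, h2⟩ := entropy_le_particles hw0 hw1 hη hM hx
  refine ⟨h1, h2.trans ?_⟩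
  have h3 : HasSum (fun k => w k * (K * (e k + C))) (K * (E + C)) := by
    rw [show K * (E + C) = K * E + K * C * 1 by ring]
    exact ((hE.mul_left K).add (hw1.mul_left (K * C))).of_fun_eq fun k => by ring
  have h4 := hasSum_le hle hM h3
  have := mul_le_mul_of_nonneg_left h4 hx.le
  linarith

/-- The grand potential is bounded from below. -/
theorem exists_le_grandPotential {β : ℝ} (hβ : 0 < β) {A : Module.End ℂ (PreFock s n)}
    (hA : DominatesNumber A) : ∃ B : ℝ, ∀ ρ : Fock s n →L[ℂ] Fock s n, IsDensityOp ρ → ∀ ω,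
      HasGrandPotential β A ρ ω → B ≤ ω := by
  obtain ⟨K, hK, C, hC⟩ := hA
  -- With `x = β / K` the entropy bound contains exactly `β * E`, so the energy cancels.
  refine ⟨-C - β⁻¹ * Real.log (∑' k : Occ s n, Real.exp (-(β / K) * particles k)),
    fun ρ hρ ω hω => ?_⟩
  obtain ⟨b, w, e, E, S, h⟩ := hω.exists_spectralData hρ
  have h1 := (exists_entropy_of_energy hC h.nonneg h.sum_weights h.formValue h.energy
    (div_pos hβ hK)).2
  rw [h.entropy.tsum_eq] at h1
  rw [h.eq]
  have h2 : β / K * (K * (E + C)) = β * (E + C) := by field_simp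
  rw [h2] at h1
  have h3 := mul_le_mul_of_nonneg_left h1 (inv_pos.2 hβ).le
  have h4 : β⁻¹ * (β * (E + C) + Real.log (∑' k : Occ s n, Real.exp (-(β / K) * particles k))) =
    E + C + β⁻¹ * Real.log (∑' k : Occ s n, Real.exp (-(β / K) * particles k)) := by
      field_simp
  linarith

theorem HasEnergy.exists_grandPotential {β : ℝ} {A : Module.End ℂ (PreFock s n)}
    (hA : DominatesNumber A) {ρ : Fock s n →L[ℂ] Fock s n} (hρ : IsDensityOp ρ) {E : ℝ}
    (h : HasEnergy A ρ E) : ∃ b w e S, SpectralData β A ρ b w e E S (E - β⁻¹ * S) := by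
  obtain ⟨K, hK, C, hC⟩ := hA
  obtain ⟨b, w, hd, e, he, hE⟩ := h
  obtain ⟨h0, h1⟩ := hρ.weights hd
  have h2 := (exists_entropy_of_energy hC h0 h1 he hE one_pos).1
  exact ⟨b, w, e, _, hd, h0, h1, he, hE, h2.hasSum, rfl⟩

theorem SpectralData.hasGrandPotential {β : ℝ} {A : Module.End ℂ (PreFock s n)}
    {ρ : Fock s n →L[ℂ] Fock s n} {b : HilbertBasis (Occ s n) ℂ (Fock s n)} {w e : Occ s n → ℝ}
    {E S ω : ℝ} (h : SpectralData β A ρ b w e E S ω) : HasGrandPotential β A ρ ω :=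
  ⟨E, S, ⟨b, w, h.diag, e, h.formValue, h.energy⟩, ⟨b, w, h.diag, h.entropy⟩, h.eq⟩

/-- The grand potential is convex. -/
theorem HasGrandPotential.mix {β : ℝ} (hβ : 0 < β) {A : Module.End ℂ (PreFock s n)}
    (hA : IsHermitianOp A) (hN : DominatesNumber A) {ρ₁ ρ₂ : Fock s n →L[ℂ] Fock s n}
    (hρ₁ : IsDensityOp ρ₁) (hρ₂ : IsDensityOp ρ₂) {ω₁ ω₂ : ℝ} (h₁ : HasGrandPotential β A ρ₁ ω₁)
    (h₂ : HasGrandPotential β A ρ₂ ω₂) {c : ℝ} (hc0 : 0 < c) (hc1 : c < 1) :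
    ∃ ω, ω ≤ (1 - c) * ω₁ + c * ω₂ ∧ HasGrandPotential β A (mix c ρ₁ ρ₂) ω := by
  obtain ⟨b₁, w₁, e₁, E₁, S₁, d₁⟩ := h₁.exists_spectralData hρ₁
  obtain ⟨b₂, w₂, e₂, E₂, S₂, d₂⟩ := h₂.exists_spectralData hρ₂
  obtain ⟨E, hE, hEn⟩ := HasEnergy.mix hA hN.isBoundedBelow hρ₁ hρ₂
    ⟨b₁, w₁, d₁.diag, e₁, d₁.formValue, d₁.energy⟩ ⟨b₂, w₂, d₂.diag, e₂, d₂.formValue, d₂.energy⟩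
    hc0.le hc1.le
  obtain ⟨b, w, e, S, d⟩ := hEn.exists_grandPotential (β := β) hN (hρ₁.mix hρ₂ hc0.le hc1.le)
  obtain ⟨T₁, T₂, hS, hT₁, hT₂, hs₁, hs₂⟩ := entropy_mix hρ₁ hρ₂ hc0 hc1 d.diag d.entropy
  -- Each entropy is at most the corresponding cross entropy with the mixture: this is concavity of
  -- the entropy.
  have hS₁ := (entropy_le_cross d₁.diag d₁.nonneg d₁.sum_weights d.nonneg d.sum_weights hs₁ hT₁).2
  have hS₂ := (entropy_le_cross d₂.diag d₂.nonneg d₂.sum_weights d.nonneg d.sum_weights hs₂ hT₂).2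
  rw [d₁.entropy.tsum_eq] at hS₁
  rw [d₂.entropy.tsum_eq] at hS₂
  refine ⟨_, ?_, d.hasGrandPotential⟩
  rw [d₁.eq, d₂.eq, hS]
  have h3 := mul_le_mul_of_nonneg_left hS₁ (sub_pos.2 hc1).le
  have h4 := mul_le_mul_of_nonneg_left hS₂ hc0.le
  have h5 := mul_le_mul_of_nonneg_left (add_le_add h3 h4) (inv_pos.2 hβ).le
  linarith

/-- A partial sum of the series of `-ln` at `1`, applied to an operator. -/
def logPoly (m : ℕ) (ρ : Fock s n →L[ℂ] Fock s n) : Fock s n →L[ℂ] Fock s n :=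
  ∑ j ∈ Finset.range m, ((j + 1 : ℝ) : ℂ)⁻¹ • (1 - ρ) ^ (j + 1)

/-- The reason for truncating: `ln` is singular at `0`, while a polynomial in `ρ` is norm
continuous, so the admixture can be sent to zero at fixed `m`. -/
theorem continuous_logPoly (m : ℕ) : Continuous (logPoly (s := s) (n := n) m) := by
  unfold logPoly
  fun_prop

theorem IsDiag.logPoly {ρ : Fock s n →L[ℂ] Fock s n} {κ : Type*}
    {b : HilbertBasis κ ℂ (Fock s n)} {w : κ → ℝ} (h : IsDiag ρ b w) (m : ℕ) :
    IsDiag (logPoly m ρ) b fun k => ∑ j ∈ Finset.range m, (1 - w k) ^ (j + 1) / (j + 1) := by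
  intro k
  have h1 : ∀ j : ℕ, ((1 - ρ) ^ j) (b k) = (((1 - w k) ^ j : ℝ) : ℂ) • b k := fun j => by
    induction j with
    | zero => simp
    | succ j ih =>
      rw [pow_succ', mul_apply_eq_comp, ih, map_smul, _root_.sub_apply, h k,
        one_apply_eq_self]
      have : b k - (w k : ℂ) • b k = ((1 - w k : ℝ) : ℂ) • b k := by
        rw [Complex.ofReal_sub, sub_smul, Complex.ofReal_one, one_smul]
      rw [this, smul_smul, pow_succ]
      push_cast; rfl
  simp only [RDM.logPoly, _root_.sum_apply, _root_.smul_apply, h1, smul_smul]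
  rw [← Finset.sum_smul]
  congr 1
  push_cast
  exact Finset.sum_congr rfl fun j _ => by rw [div_eq_inv_mul]

theorem logPoly_le {x : ℝ} (hx : 0 < x) (hx1 : x ≤ 1) (m : ℕ) :
    ∑ j ∈ Finset.range m, (1 - x) ^ (j + 1) / ((j : ℝ) + 1) ≤ -Real.log x := by
  have h := Real.hasSum_pow_div_log_of_abs_lt_one (x := 1 - x)
    (by rw [abs_of_nonneg (by linarith)]; linarith)
  rw [sub_sub_cancel] at h
  exact sum_le_hasSum _ (fun j _ => div_nonneg (pow_nonneg (by linarith) _) (by positivity)) h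

/-- The grand potential of a state with an admixture of a pure state. -/
theorem exists_grandPotential_mix_pure {β : ℝ} (hβ : 0 < β) {A : Module.End ℂ (PreFock s n)}
    (hA : IsHermitianOp A) (hN : DominatesNumber A) {ρ : Fock s n →L[ℂ] Fock s n}
    (hρ : IsDensityOp ρ) {ω : ℝ} (h : HasGrandPotential β A ρ ω) {φ : PreFock s n}
    (hφ : ‖toFock φ‖ = 1) {c : ℝ} (hc0 : 0 < c) (hc1 : c < 1) (m : ℕ) :
    ∃ ω', HasGrandPotential β A (mix c ρ (pure (toFock φ))) ω' ∧
      ω' ≤ (1 - c) * ω + c * (quad A φ - β⁻¹ *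
        (inner ℂ (toFock φ) (logPoly m (mix c ρ (pure (toFock φ))) (toFock φ))).re) := by
  have hp := isDensityOp_pure hφ
  obtain ⟨b₁, w₁, e₁, E₁, S₁, d₁⟩ := h.exists_spectralData hρ
  obtain ⟨E₂, hE₂, hEp⟩ := exists_hasEnergy_pure hA hN.isBoundedBelow hφ
  obtain ⟨E, hE, hEn⟩ := HasEnergy.mix hA hN.isBoundedBelow hρ hp
    ⟨b₁, w₁, d₁.diag, e₁, d₁.formValue, d₁.energy⟩ hEp hc0.le hc1.le
  obtain ⟨b, w, e, S, d⟩ := hEn.exists_grandPotential (β := β) hN (hρ.mix hp hc0.le hc1.le)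
  obtain ⟨T₁, T₂, hS, hT₁, hT₂, hs₁, hs₂⟩ := entropy_mix hρ hp hc0 hc1 d.diag d.entropy
  have hS₁ := (entropy_le_cross d₁.diag d₁.nonneg d₁.sum_weights d.nonneg d.sum_weights hs₁ hT₁).2
  rw [d₁.entropy.tsum_eq] at hS₁
  refine ⟨_, d.hasGrandPotential, ?_⟩
  -- All terms of the logarithmic series are nonnegative, so the truncation underestimates the cross
  -- entropy. Where `w k = 0` the pure state has no overlap, and `Real.log 0 = 0` does no harm.
  have hT : (inner ℂ (toFock φ)
      (logPoly m (RDM.mix c ρ (pure (toFock φ))) (toFock φ))).re ≤ T₂ := by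
    refine hasSum_le (fun k => ?_) ((d.diag.logPoly m).hasSum_quad (toFock φ)) hT₂
    rw [re_inner_pure, mul_comm]
    rcases eq_or_ne (w k) 0 with h0 | h0
    · have := hs₂ k h0
      rw [re_inner_pure] at this
      rw [this]; simp
    · exact mul_le_mul_of_nonneg_left (logPoly_le (lt_of_le_of_ne (d.nonneg k) (Ne.symm h0))
        (hasSum_le_one d.nonneg d.sum_weights k) m) (sq_nonneg _)
  rw [d₁.eq, hS]
  have h3 := mul_le_mul_of_nonneg_left hS₁ (sub_pos.2 hc1).le
  have h4 := mul_le_mul_of_nonneg_left hT hc0.le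
  have h5 := mul_le_mul_of_nonneg_left (add_le_add h3 h4) (inv_pos.2 hβ).le
  have h6 := mul_le_mul_of_nonneg_left hE₂ hc0.le
  linarith

end GrandPotential

end

end RDM

namespace RDM

noncomputable section

/-! ### Minimisers of the grand potential are Gibbs states -/

section EulerLagrange

variable {s : Statistics} {n : ℕ}

theorem logPoly_nonneg {x : ℝ} (hx1 : x ≤ 1) (m : ℕ) :
    0 ≤ ∑ j ∈ Finset.range m, (1 - x) ^ (j + 1) / ((j : ℝ) + 1) :=
  Finset.sum_nonneg fun j _ => div_nonneg (pow_nonneg (by linarith) _) (by positivity)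

theorem tendsto_logPoly {x : ℝ} (hx : 0 < x) (hx1 : x ≤ 1) :
    Tendsto (fun m => ∑ j ∈ Finset.range m, (1 - x) ^ (j + 1) / ((j : ℝ) + 1)) atTop
      (𝓝 (-Real.log x)) := by
  have h := Real.hasSum_pow_div_log_of_abs_lt_one (x := 1 - x)
    (by rw [abs_of_nonneg (by linarith)]; linarith)
  rw [sub_sub_cancel] at h
  exact h.tendsto_sum_nat

theorem quad_smul_real (A : Module.End ℂ (PreFock s n)) (c : ℝ) (φ : PreFock s n) :
    quad A ((c : ℂ) • φ) = c ^ 2 * quad A φ := by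
  rw [quad_smul]
  simp

/-- The first variation of the grand potential of `A + V_v` at a minimiser with the minimum `Ω`. -/
theorem first_variation {β : ℝ} (hβ : 0 < β) {A : Module.End ℂ (PreFock s n)}
    (hA : IsHermitianOp A) (hN : DominatesNumber A) {ρ : Fock s n →L[ℂ] Fock s n}
    (hρ : IsDensityOp ρ) {γ : HermMat n} (hγ : HasOneRDM ρ γ) {ω : ℝ}
    (h : HasGrandPotential β A ρ ω) {v : HermMat n}
    (hmin : ∀ γ', ∀ ω' ∈ grandPotentialValues β A γ',
      ω + tracePairing v γ ≤ ω' + tracePairing v γ') (m : ℕ) (φ : PreFock s n) :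
    β⁻¹ * (inner ℂ (toFock φ) (logPoly m ρ (toFock φ))).re ≤
      quad (A + potential s v) φ - (ω + tracePairing v γ) * ‖toFock φ‖ ^ 2 := by
  have unit : ∀ φ : PreFock s n, ‖toFock φ‖ = 1 →
      β⁻¹ * (inner ℂ (toFock φ) (logPoly m ρ (toFock φ))).re ≤
      quad (A + potential s v) φ - (ω + tracePairing v γ) := by
    intro φ hφ
    have hc : ∀ᶠ c : ℝ in 𝓝[>] 0, β⁻¹ *
        (inner ℂ (toFock φ) (logPoly m (mix c ρ (pure (toFock φ))) (toFock φ))).re ≤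
        quad (A + potential s v) φ - (ω + tracePairing v γ) := by
      filter_upwards [Ioo_mem_nhdsGT (zero_lt_one' ℝ)] with c hc
      obtain ⟨ω', h1, h2⟩ := exists_grandPotential_mix_pure hβ hA hN hρ h hφ hc.1 hc.2 m
      -- The mixture is a competitor with an affine change of density matrix. The terms of order
      -- zero in `c` cancel; one divides by `c` and lets `c → 0⁺`.
      have h3 := hmin _ ω' ⟨_, hρ.mix (isDensityOp_pure hφ) hc.1.le hc.2.le,
        hγ.mix (hasOneRDM_pure φ) c, h1⟩
      rw [map_add, map_smul, map_smul, ← oneBody_eq_tracePairing, oneBody_emb, smul_eq_mul,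
        smul_eq_mul] at h3
      rw [quad_add_op]
      refine le_of_mul_le_mul_left ?_ hc.1
      linarith
    refine le_of_tendsto (Tendsto.const_mul _ ?_) hc
    have hcont : Continuous fun c : ℝ => (inner ℂ (toFock φ)
        (logPoly m (mix c ρ (pure (toFock φ))) (toFock φ))).re := by
      have h1 : Continuous fun c : ℝ => mix c ρ (pure (toFock φ)) := by
        unfold RDM.mix
        fun_prop
      have h2 := (continuous_logPoly (s := s) (n := n) m).comp h1
      exact Complex.continuous_re.comp
        (continuous_const.inner (h2.clm_apply continuous_const))
    have h0 := hcont.tendsto 0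
    have h00 : mix 0 ρ (pure (toFock φ)) = ρ := by simp [RDM.mix]
    rw [h00] at h0
    exact h0.mono_left nhdsWithin_le_nhds
  rcases eq_or_ne (toFock φ) 0 with h0 | h0
  · have : φ = 0 := toFock_injective (by rw [h0, map_zero])
    subst this
    simp [quad, form]
  · have hr := norm_pos_iff.2 h0
    set r := ‖toFock φ‖
    have h1 := unit (((r⁻¹ : ℝ) : ℂ) • φ) (by
      rw [map_smul, norm_smul, Complex.norm_real, Real.norm_eq_abs, abs_of_pos (inv_pos.2 hr)]
      exact inv_mul_cancel₀ hr.ne')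
    rw [quad_smul_real, map_smul, map_smul, inner_smul_left, inner_smul_right, Complex.conj_ofReal,
      Complex.re_ofReal_mul, Complex.re_ofReal_mul] at h1
    have h2 := mul_le_mul_of_nonneg_left h1 (sq_nonneg r)
    have e1 : r * r⁻¹ = 1 := mul_inv_cancel₀ hr.ne'
    have e2 : r ^ 2 * (β⁻¹ * (r⁻¹ * (r⁻¹ *
      (inner ℂ (toFock φ) (logPoly m ρ (toFock φ))).re))) =
      (r * r⁻¹) ^ 2 * (β⁻¹ * (inner ℂ (toFock φ) (logPoly m ρ (toFock φ))).re) := by ring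
    have e3 : r ^ 2 * (r⁻¹ ^ 2 * quad (A + potential s v) φ - (ω + tracePairing v γ)) =
      (r * r⁻¹) ^ 2 * quad (A + potential s v) φ - (ω + tracePairing v γ) * r ^ 2 := by ring
    rw [e2, e3, e1] at h2
    linarith

/-- A normalised vector that saturates a lower bound of the quadratic form is an eigenvector. -/
theorem friedrichsGraph_of_le {A : Module.End ℂ (PreFock s n)} (hA : IsHermitianOp A)
    {x : Fock s n} (hx : ‖x‖ = 1) {Ω E : ℝ}
    (hle : ∀ φ, (E - Ω) * ‖inner ℂ x (toFock φ)‖ ^ 2 ≤ quad A φ - Ω * ‖toFock φ‖ ^ 2)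
    (hE : Ω ≤ E) {h : ℝ} (hf : HasFormValue A x h) (hh : h ≤ E) :
    FriedrichsGraph A x ((E : ℂ) • x) := by
  have hC : ∀ φ, -(-Ω) * ‖toFock φ‖ ^ 2 ≤ quad A φ := fun φ => by
    have := mul_nonneg (sub_nonneg.2 hE) (sq_nonneg ‖inner ℂ x (toFock φ)‖)
    linarith [hle φ]
  -- With lower bound `Ω`, the form norm is that of `A - Ω + 1`, and an eigenvector of energy `E`
  -- has squared form norm `μ = E - Ω + 1`.
  obtain ⟨Q⟩ := exists_formSpace hA hC
  obtain ⟨ξ, hξ, hn⟩ := Q.hasFormValue_iff.1 hf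
  rw [hx] at hn
  set μ := E - Ω + 1
  have hμ : 0 < μ := by simp only [μ]; linarith
  set ζ := ContinuousLinearMap.adjoint Q.J x
  have hζ : ∀ η, inner ℂ ζ η = inner ℂ x (Q.J η) := fun η =>
    ContinuousLinearMap.adjoint_inner_left Q.J η x
  have hbound : ∀ η, μ * ‖inner ℂ x (Q.J η)‖ ^ 2 ≤ ‖η‖ ^ 2 := fun η => by
    refine Q.dense.induction_on (p := fun η => μ * ‖inner ℂ x (Q.J η)‖ ^ 2 ≤ ‖η‖ ^ 2) η ?_ ?_
    · exact isClosed_le (by fun_prop) (by fun_prop)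
    · intro φ
      rw [Q.J_emb, Q.norm_emb_sq]
      have h1 : ‖inner ℂ x (toFock φ)‖ ≤ ‖toFock φ‖ := by
        simpa [hx] using norm_inner_le_norm (𝕜 := ℂ) x (toFock φ)
      have h2 := pow_le_pow_left₀ (norm_nonneg _) h1 2
      simp only [μ]
      linarith [hle φ]
  have hζn : μ * ‖ζ‖ ^ 2 ≤ 1 := by
    have h1 := hbound ζ
    rw [← hζ, inner_self_eq_ofReal, Complex.norm_real, Real.norm_eq_abs,
      abs_of_nonneg (sq_nonneg _)] at h1
    rcases eq_or_lt_of_le (sq_nonneg ‖ζ‖) with h2 | h2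
    · rw [← h2]; simp
    · refine le_of_mul_le_mul_right ?_ h2
      linarith
  have h1 : inner ℂ ζ ξ = 1 := by
    rw [hζ, hξ, inner_self_eq_ofReal, hx]; simp
  -- The equality case of Cauchy–Schwarz: `‖ξ‖² ≤ μ`, `⟨ζ, ξ⟩ = 1` and `μ ‖ζ‖² ≤ 1`, so the square
  -- expands to at most `μ - 2μ + μ`.
  have h2 : ‖ξ - (μ : ℂ) • ζ‖ ^ 2 ≤ 0 := by
    rw [@norm_sub_sq ℂ, inner_smul_right, norm_smul, ← inner_conj_symm, h1, Complex.norm_real,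
      Real.norm_eq_abs, abs_of_pos hμ, hn, mul_pow]
    simp only [map_one, mul_one, RCLike.re_to_complex, Complex.ofReal_re]
    have := mul_le_mul_of_nonneg_left hζn hμ.le
    simp only [μ] at this ⊢
    nlinarith
  have h3 : ξ = (μ : ℂ) • ζ := by
    rw [← sub_eq_zero, ← norm_eq_zero]
    exact pow_eq_zero_iff two_ne_zero |>.1 (le_antisymm h2 (sq_nonneg _))
  refine ⟨⟨h, hf⟩, fun φ => ?_⟩
  have h4 := Q.inner_emb φ ξ
  have h5 : inner ℂ (Q.emb φ) ζ = inner ℂ (toFock φ) x := by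
    rw [← inner_conj_symm, hζ, inner_conj_symm, Q.J_emb]
  nth_rw 1 [h3] at h4
  rw [hξ, inner_smul_right, h5] at h4
  rw [inner_smul_right]
  have h6 : inner ℂ (toFock (A φ)) x =
      ((μ : ℂ) - ((-Ω + 1 : ℝ) : ℂ)) * inner ℂ (toFock φ) x := by
    rw [sub_mul, h4]; ring
  rw [h6]
  congr 1
  simp only [μ]
  push_cast
  ring

theorem FriedrichsGraph.formValue_le {A : Module.End ℂ (PreFock s n)} {x : Fock s n} {Ω E h : ℝ}
    (hx : ‖x‖ = 1)
    (hle : ∀ φ, (E - Ω) * ‖inner ℂ x (toFock φ)‖ ^ 2 ≤ quad A φ - Ω * ‖toFock φ‖ ^ 2)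
    (hf : HasFormValue A x h) : E ≤ h := by
  obtain ⟨φ, h1, -, h3⟩ := hf
  have h4 := le_of_tendsto_of_tendsto' ((((tendsto_const_nhds (x := x)).inner h1).norm.pow
    2).const_mul (E - Ω)) (h3.sub ((h1.norm.pow 2).const_mul Ω)) (fun l => hle (φ l))
  rw [inner_self_eq_ofReal, hx] at h4
  simp at h4
  linarith

/-- The one-body energy in terms of a spectral decomposition. -/
theorem hasSum_oneBody {ρ : Fock s n →L[ℂ] Fock s n} {κ : Type*}
    {b : HilbertBasis κ ℂ (Fock s n)} {w : κ → ℝ} (h : IsDiag ρ b w) (hw : ∀ k, 0 ≤ w k)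
    {η : κ → (numberSpace s n).carrier} (hη : ∀ k, w k ≠ 0 → (numberSpace s n).J (η k) = b k)
    (hsum : Summable fun k => w k * ‖η k‖ ^ 2) {γ : HermMat n} (hγ : HasOneRDM ρ γ)
    (v : HermMat n) : HasSum (fun k => w k * oneBody v (η k)) (tracePairing v γ) := by
  have h1 : ∀ i j, HasSum (fun m => (w m : ℂ) * inner ℂ (annihExt s i (η m))
      (annihExt s j (η m))) ((γ : Matrix (Fin n) (Fin n) ℂ) j i) := fun i j => by
    obtain ⟨h2, h3⟩ := hasSum_oneRDM h hw hη hsum j i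
    have := h2.hasSum
    rwa [h3.unique (hγ j i)] at this
  have h2 := hasSum_sum (s := Finset.univ) fun i _ => hasSum_sum (s := Finset.univ) fun j _ =>
    (h1 i j).mul_left ((v : Matrix (Fin n) (Fin n) ℂ) i j)
  have h3 := Complex.hasSum_re h2
  convert h3 using 1
  · funext k
    rw [oneBody, ← Complex.re_ofReal_mul, Finset.mul_sum]
    congr 1
    refine Finset.sum_congr rfl fun i _ => ?_
    rw [Finset.mul_sum]
    exact Finset.sum_congr rfl fun j _ => by ring
  · simp [tracePairing, Matrix.trace, Matrix.mul_apply]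

theorem exists_hasOneRDM {ρ : Fock s n →L[ℂ] Fock s n} {κ : Type*}
    {b : HilbertBasis κ ℂ (Fock s n)} {w : κ → ℝ} (h : IsDiag ρ b w) (hw : ∀ k, 0 ≤ w k)
    {η : κ → (numberSpace s n).carrier} (hη : ∀ k, w k ≠ 0 → (numberSpace s n).J (η k) = b k)
    (hsum : Summable fun k => w k * ‖η k‖ ^ 2) : ∃ γ, HasOneRDM ρ γ := by
  refine ⟨⟨Matrix.of fun i j => ∑' m, (w m : ℂ) * inner ℂ (annihExt s j (η m))
    (annihExt s i (η m)), ?_⟩, fun i j => (hasSum_oneRDM h hw hη hsum i j).2⟩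
  rw [selfAdjoint.mem_iff]
  ext i j
  simp [Matrix.star_apply, Complex.conj_tsum]

/-- The Euler–Lagrange equation: a minimiser of the grand potential of `A + V_v` is the Gibbs
state. -/
theorem isGibbsState_of_minimal {β : ℝ} (hβ : 0 < β) {A : Module.End ℂ (PreFock s n)}
    (hA : IsHermitianOp A) (hN : DominatesNumber A) {ρ : Fock s n →L[ℂ] Fock s n}
    (hρ : IsDensityOp ρ) {γ : HermMat n} (hγ : HasOneRDM ρ γ) {ω : ℝ}
    (h : HasGrandPotential β A ρ ω) {v : HermMat n}
    (hmin : ∀ γ', ∀ ω' ∈ grandPotentialValues β A γ',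
      ω + tracePairing v γ ≤ ω' + tracePairing v γ') :
    v ∈ finitePotentials β A ∧ IsGibbsState β (A + potential s v) ρ := by
  obtain ⟨b, w, e, E, S, d⟩ := h.exists_spectralData hρ
  have hN' := hN
  obtain ⟨K, hK, C, hC⟩ := hN'
  obtain ⟨η, hη, hform, hle, hge, hs, hη0⟩ :=
    exists_numberVectors hC d.nonneg d.sum_weights d.formValue d.energy
  have hAv : IsHermitianOp (A + potential s v) := hA.add (isHermitianOp_potential v)
  set Ω := ω + tracePairing v γ with hΩ
  have hvar := first_variation hβ hA hN hρ hγ h hmin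
  rw [← hΩ] at hvar
  have hw1 := hasSum_le_one d.nonneg d.sum_weights
  have hterm : ∀ k m φ, β⁻¹ * ((∑ j ∈ Finset.range m, (1 - w k) ^ (j + 1) / ((j : ℝ) + 1)) *
      ‖inner ℂ (b k) (toFock φ)‖ ^ 2) ≤
      quad (A + potential s v) φ - Ω * ‖toFock φ‖ ^ 2 := by
    intro k m φ
    refine le_trans (mul_le_mul_of_nonneg_left ?_ (inv_pos.2 hβ).le) (hvar m φ)
    exact le_hasSum ((d.diag.logPoly m).hasSum_quad (toFock φ)) k fun j _ =>
      mul_nonneg (logPoly_nonneg (hw1 j) m) (sq_nonneg _)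
  have hpos : ∀ k, 0 < w k := by
    intro k
    refine lt_of_le_of_ne (d.nonneg k) fun hk => ?_
    refine (b.orthonormal.ne_zero k) (eq_zero_of_inner_toFock fun φ => ?_)
    by_contra hne
    rw [← inner_conj_symm, ← ne_eq, map_ne_zero] at hne
    -- At weight zero the truncated logarithms are the partial sums of the harmonic series. Their
    -- divergence forces the eigenvector to be orthogonal to all pre-Fock vectors, so `ρ` has no
    -- kernel.
    have h1 := Real.tendsto_sum_range_one_div_nat_succ_atTop
    have h2 := (h1.atTop_mul_const (sq_pos_of_pos (norm_pos_iff.2 hne))).const_mul_atTop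
      (inv_pos.2 hβ)
    obtain ⟨m, hm⟩ := (h2.eventually_gt_atTop
      (quad (A + potential s v) φ - Ω * ‖toFock φ‖ ^ 2)).exists
    have h3 := hterm k m φ
    rw [← hk] at h3
    simp only [sub_zero, one_pow] at h3
    exact absurd h3 (not_le.2 hm)
  set En : Occ s n → ℝ := fun k => Ω - β⁻¹ * Real.log (w k) with hEn
  have hEΩ : ∀ k, Ω ≤ En k := fun k => by
    have := mul_nonpos_of_nonneg_of_nonpos (inv_pos.2 hβ).le
      (Real.log_nonpos (d.nonneg k) (hw1 k))
    simp only [hEn]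
    linarith
  have hquad : ∀ k φ, (En k - Ω) * ‖inner ℂ (b k) (toFock φ)‖ ^ 2 ≤
      quad (A + potential s v) φ - Ω * ‖toFock φ‖ ^ 2 := fun k φ => by
    have h1 := le_of_tendsto' (((tendsto_logPoly (hpos k) (hw1 k)).mul_const
      (‖inner ℂ (b k) (toFock φ)‖ ^ 2)).const_mul β⁻¹) fun m => hterm k m φ
    simp only [hEn]
    linarith
  have hlow : ∀ k, En k ≤ e k + oneBody v (η k) := fun k =>
    FriedrichsGraph.formValue_le (b.orthonormal.1 k) (hquad k) (hform k (hpos k).ne' v)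
  have hrdm := hasSum_oneBody d.diag d.nonneg hη hs hγ v
  -- The value `Ω` is attained by `ρ` itself, so the weighted gaps between form values and `En` sum
  -- to zero; being nonnegative, all of them vanish.
  have hdiff : HasSum (fun k => w k * (e k + oneBody v (η k) - En k)) 0 := by
    have h1 : HasSum (fun k => w k * En k) (Ω + β⁻¹ * S) := by
      rw [← mul_one Ω]
      refine ((d.sum_weights.mul_left Ω).add (d.entropy.mul_left β⁻¹)).of_fun_eq fun k => ?_
      simp only [hEn, Real.negMulLog]
      ring
    have h2 := (d.energy.add hrdm).sub h1
    have h3 : E + tracePairing v γ - (Ω + β⁻¹ * S) = 0 := by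
      rw [hΩ, d.eq]; ring
    rw [h3] at h2
    exact h2.of_fun_eq fun k => by ring
  have heq : ∀ k, e k + oneBody v (η k) ≤ En k := fun k => by
    have h1 := (hasSum_zero_iff_of_nonneg fun k =>
      mul_nonneg (d.nonneg k) (sub_nonneg.2 (hlow k))).1 hdiff
    have h2 := congrFun h1 k
    simp only [Pi.zero_apply, mul_eq_zero, (hpos k).ne', false_or] at h2
    linarith
  have hbasis : IsEnergyBasis (A + potential s v) b En := fun k =>
    friedrichsGraph_of_le hAv (b.orthonormal.1 k) (hquad k) (hEΩ k) (hform k (hpos k).ne' v)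
      (heq k)
  have hexp : ∀ k, Real.exp (-β * En k) = Real.exp (-β * Ω) * w k := fun k => by
    have h1 : Real.exp (-β * Ω) * w k = Real.exp (-β * Ω + Real.log (w k)) := by
      rw [Real.exp_add, Real.exp_log (hpos k)]
    rw [h1]
    congr 1
    simp only [hEn]
    field_simp
    ring
  have hsum : HasSum (fun k => Real.exp (-β * En k)) (Real.exp (-β * Ω)) := by
    have h1 := d.sum_weights.mul_left (Real.exp (-β * Ω))
    rw [mul_one] at h1
    exact h1.of_fun_eq hexp
  have hb : IsBoundedBelow (A + potential s v) := ⟨-Ω, fun φ => by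
    have k : Occ s n := default
    have := mul_nonneg (sub_nonneg.2 (hEΩ k)) (sq_nonneg ‖inner ℂ (b k) (toFock φ)‖)
    linarith [hquad k φ]⟩
  refine ⟨⟨hb, b, En, hbasis, hsum.summable⟩, hb, b, En, hbasis, hsum.summable, fun k => ?_⟩
  rw [hsum.tsum_eq, hexp, mul_div_cancel_left₀ _ (Real.exp_pos _).ne']
  exact d.diag k

/-- The Gibbs state determines the operator up to a constant. -/
theorem IsGibbsState.exists_sub_eq {β : ℝ} (hβ : 0 < β) {A A' : Module.End ℂ (PreFock s n)}
    {ρ : Fock s n →L[ℂ] Fock s n} (h : IsGibbsState β A ρ) (h' : IsGibbsState β A' ρ) :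
    ∃ c : ℝ, ∀ φ, A' φ - A φ = (c : ℂ) • φ := by
  obtain ⟨-, b, E, hE, hs, hd⟩ := h
  obtain ⟨-, b', E', hE', hs', hd'⟩ := h'
  set Z := ∑' l, Real.exp (-β * E l)
  set Z' := ∑' l, Real.exp (-β * E' l)
  have hZ : 0 < Z := (hasSum_gibbsWeight hs).1
  have hZ' : 0 < Z' := (hasSum_gibbsWeight hs').1
  have hE : ∀ k φ, inner ℂ (toFock (A φ)) (b k) = (E k : ℂ) * inner ℂ (toFock φ) (b k) :=
    fun k φ => by rw [(hE k).2 φ, inner_smul_right]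
  have hE' : ∀ k φ, inner ℂ (toFock (A' φ)) (b' k) = (E' k : ℂ) * inner ℂ (toFock φ) (b' k) :=
    fun k φ => by rw [(hE' k).2 φ, inner_smul_right]
  set c := β⁻¹ * (Real.log Z - Real.log Z') with hc
  -- Overlapping eigenvectors carry the same weight of `ρ`; taking logarithms, the energies differ
  -- by a constant fixed by the two partition functions.
  have hov : ∀ k j, inner ℂ (b' j) (b k) ≠ 0 → E' j = E k + c := by
    intro k j hkj
    have h1 := IsDiag.eq_of_inner_ne_zero (w := fun k => Real.exp (-β * E' k) / Z')
      (w' := fun k => Real.exp (-β * E k) / Z) hd' hd hkj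
    have h2 := congrArg Real.log h1
    rw [Real.log_div (Real.exp_ne_zero _) hZ'.ne', Real.log_div (Real.exp_ne_zero _) hZ.ne',
      Real.log_exp, Real.log_exp] at h2
    rw [hc]
    field_simp
    linarith
  refine ⟨c, fun φ => ?_⟩
  have hA' : ∀ k, inner ℂ (toFock (A' φ)) (b k) =
      ((E k + c : ℝ) : ℂ) * inner ℂ (toFock φ) (b k) := by
    intro k
    refine (b'.hasSum_inner_mul_inner (toFock (A' φ)) (b k)).unique ?_
    refine ((b'.hasSum_inner_mul_inner (toFock φ) (b k)).mul_left _).of_fun_eq fun j => ?_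
    rw [hE']
    rcases eq_or_ne (inner ℂ (b' j) (b k)) 0 with h0 | h0
    · simp [h0]
    · rw [hov k j h0]; ring
  rw [← sub_eq_zero]
  set χ := A' φ - A φ - (c : ℂ) • φ
  have h0 : ∀ k, inner ℂ (toFock χ) (b k) = 0 := fun k => by
    simp only [χ, map_sub, map_smul, inner_sub_left, hA', hE, inner_smul_left,
      Complex.conj_ofReal]
    push_cast
    ring
  have h1 := hasSum_normSq_inner_right b (toFock χ)
  simp only [h0, norm_zero, ne_eq, OfNat.ofNat_ne_zero, not_false_eq_true, zero_pow] at h1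
  have h2 := h1.unique hasSum_zero
  exact toFock_injective (by simpa using h2)

end EulerLagrange

end

end RDM

namespace RDM

noncomputable section

/-! ### Gibbs states minimise the grand potential -/

section Gibbs

variable {s : Statistics} {n : ℕ}

theorem exists_isDiag_of_summable {ι : Type*} (b : HilbertBasis ι ℂ (Fock s n)) {w : ι → ℝ}
    (hw : ∀ k, 0 ≤ w k) (hs : Summable w) : ∃ ρ : Fock s n →L[ℂ] Fock s n, IsDiag ρ b w := by
  classical
  have hsum : Summable fun k => (w k : ℂ) • InnerProductSpace.rankOne ℂ (b k) (b k) := by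
    refine Summable.of_norm (hs.congr fun k => ?_)
    rw [norm_smul, InnerProductSpace.norm_rankOne, Complex.norm_real, Real.norm_eq_abs,
      abs_of_nonneg (hw k), b.orthonormal.1 k, mul_one, mul_one]
  refine ⟨∑' k, (w k : ℂ) • InnerProductSpace.rankOne ℂ (b k) (b k), fun j => ?_⟩
  have h1 := hsum.hasSum.mapL (ContinuousLinearMap.apply ℂ (Fock s n) (b j))
  refine h1.unique ?_
  have h2 : (w j : ℂ) • b j = (ContinuousLinearMap.apply ℂ (Fock s n) (b j))
      ((w j : ℂ) • InnerProductSpace.rankOne ℂ (b j) (b j)) := by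
    simp [b.orthonormal.1 j]
    rfl
  rw [h2]
  refine hasSum_single j fun k hk => ?_
  simp [b.orthonormal.2 hk]

theorem potential_apply (v : HermMat n) (φ : PreFock s n) : potential s v φ =
    ∑ i, ∑ j, (v : Matrix (Fin n) (Fin n) ℂ) i j • create s n i (annih s n j φ) := by
  simp [potential, LinearMap.sum_apply]

theorem add_potential_neg (A : Module.End ℂ (PreFock s n)) (v : HermMat n) :
    A + potential s v + potential s (-v) = A := by
  refine LinearMap.ext fun φ => ?_
  rw [LinearMap.add_apply, LinearMap.add_apply, potential_apply, potential_apply, add_assoc,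
    ← Finset.sum_add_distrib]
  simp

theorem oneBody_neg (v : HermMat n) (η : (numberSpace s n).carrier) :
    oneBody (-v) η = -oneBody v η := by
  simp [oneBody]

theorem IsEnergyBasis.hasFormValue {A : Module.End ℂ (PreFock s n)} (hA : IsHermitianOp A)
    (hb : IsBoundedBelow A) {b : HilbertBasis (Occ s n) ℂ (Fock s n)} {E : Occ s n → ℝ}
    (h : IsEnergyBasis A b E) (k : Occ s n) : HasFormValue A (b k) (E k) := by
  obtain ⟨C, hC⟩ := hb
  obtain ⟨Q⟩ := exists_formSpace hA hC
  obtain ⟨ξ, -, -, h1⟩ := Q.inner_eigenvector (h k)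
  simpa [b.orthonormal.1 k] using h1

theorem IsEnergyBasis.neg_le {A : Module.End ℂ (PreFock s n)} (hA : IsHermitianOp A)
    {C : ℝ} (hC : ∀ φ, -C * ‖toFock φ‖ ^ 2 ≤ quad A φ)
    {b : HilbertBasis (Occ s n) ℂ (Fock s n)} {E : Occ s n → ℝ}
    (h : IsEnergyBasis A b E) (k : Occ s n) : -C ≤ E k := by
  simpa [b.orthonormal.1 k] using (h.hasFormValue hA ⟨C, hC⟩ k).lower_bound hC

/-- Jensen's inequality for the exponential, by summing the tangent-line inequality at the mean. -/
theorem exp_le_tsum_of_mean {ι : Type*} {p N : ι → ℝ} (hp : ∀ i, 0 ≤ p i) (hp1 : HasSum p 1)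
    {x m t : ℝ} (hm : HasSum (fun i => N i * p i) m)
    (ht : HasSum (fun i => Real.exp (-x * N i) * p i) t) : Real.exp (-x * m) ≤ t := by
  have h1 : HasSum (fun i => Real.exp (-x * m) * (1 - x * (N i - m)) * p i)
      (Real.exp (-x * m) * ((1 + x * m) * 1 - x * m)) := by
    refine ((((hp1.mul_left (1 + x * m)).sub (hm.mul_left x)).mul_left
      (Real.exp (-x * m))).of_fun_eq fun i => ?_)
    ring
  have h2 := hasSum_le (fun i => ?_) h1 ht
  · rwa [show (1 + x * m) * 1 - x * m = 1 by ring, mul_one] at h2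
  · refine mul_le_mul_of_nonneg_right ?_ (hp i)
    have h3 := Real.add_one_le_exp (-x * (N i - m))
    calc Real.exp (-x * m) * (1 - x * (N i - m))
        ≤ Real.exp (-x * m) * Real.exp (-x * (N i - m)) :=
          mul_le_mul_of_nonneg_left (by linarith) (Real.exp_pos _).le
      _ = _ := by rw [← Real.exp_add]; congr 1; ring

/-- The Peierls inequality for the number operator. -/
theorem IsEnergyBasis.summable_exp {A : Module.End ℂ (PreFock s n)} (hA : IsHermitianOp A)
    (hN : DominatesNumber A) {b : HilbertBasis (Occ s n) ℂ (Fock s n)} {E : Occ s n → ℝ}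
    (h : IsEnergyBasis A b E) {x : ℝ} (hx : 0 < x) : Summable fun k => Real.exp (-x * E k) := by
  have hb := hN.isBoundedBelow
  obtain ⟨K, hK, C, hC⟩ := hN
  have h1 : ∀ k, ∃ η, (numberSpace s n).J η = b k ∧ ‖η‖ ^ 2 ≤ K * (E k + C) + 1 := fun k => by
    obtain ⟨η, h2, h3, -⟩ := (h.hasFormValue hA hb k).exists_numberSpace hC
    rw [b.orthonormal.1 k] at h3
    exact ⟨η, h2, by linarith⟩
  choose η hη hle using h1
  have hy := div_pos hx hK
  set y := x / K with hxy
  -- Domination bounds `E k` below by the mean particle number of `b k`, and Jensen turns this into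
  -- a mean of `e^{-yN}`. Summing over `k` recovers the free partition function.
  have hterm : ∀ k, Real.exp (-x * E k) ≤
      Real.exp (x * C) * ∑' l : Occ s n, Real.exp (-y * particles l) * ‖b k l‖ ^ 2 := by
    intro k
    have hp1 := hasSum_ket (b k)
    rw [b.orthonormal.1 k, one_pow] at hp1
    have hm := hasSum_particles (η k)
    rw [hη, b.orthonormal.1 k, one_pow] at hm
    have ht : Summable fun l : Occ s n => Real.exp (-y * particles l) * ‖b k l‖ ^ 2 := by
      refine Summable.of_nonneg_of_le (fun l => by positivity) (fun l => ?_) hp1.summable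
      refine mul_le_of_le_one_left (sq_nonneg _) (Real.exp_le_one_iff.2 ?_)
      have : 0 ≤ y * particles l := by positivity
      linarith
    have h2 := exp_le_tsum_of_mean (fun l => sq_nonneg _) hp1 hm ht.hasSum
    refine le_trans ?_ (mul_le_mul_of_nonneg_left h2 (Real.exp_pos _).le)
    rw [← Real.exp_add]
    refine Real.exp_le_exp.2 ?_
    have h3 := mul_le_mul_of_nonneg_left (hle k) hy.le
    have h4 : y * (K * (E k + C) + 1) = x * (E k + C) + y := by
      rw [hxy]; field_simp
    linarith
  refine Summable.of_nonneg_of_le (fun k => (Real.exp_pos _).le) hterm (Summable.mul_left _ ?_)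
  have h5 : ∀ l : Occ s n, HasSum (fun k => Real.exp (-y * particles l) * ‖b k l‖ ^ 2)
      (Real.exp (-y * particles l)) := fun l => by
    have h6 := hasSum_normSq_inner_right b (ket l)
    have h7 : ‖ket l‖ = 1 := orthonormal_ket.1 l
    rw [h7] at h6
    simp only [inner_ket] at h6
    simpa using h6.mul_left (Real.exp (-y * particles l))
  have h8 := hasSum_uncurry_of_nonneg (g := fun (l k : Occ s n) =>
    Real.exp (-y * particles l) * ‖b k l‖ ^ 2) (fun _ _ => by positivity) h5
    (summable_exp_particles hy).hasSum
  exact (h8.summable.prod_symm.hasSum.prod_fiberwise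
    fun k => (h8.summable.prod_symm.prod_factor k).hasSum).summable

/-- The factor `E + C` is absorbed by half of the exponential, at the price of summability at `x /
2`. -/
theorem IsEnergyBasis.summable_mul_exp {A : Module.End ℂ (PreFock s n)} (hA : IsHermitianOp A)
    (hN : DominatesNumber A) {b : HilbertBasis (Occ s n) ℂ (Fock s n)} {E : Occ s n → ℝ}
    (h : IsEnergyBasis A b E) {x : ℝ} (hx : 0 < x) :
    Summable fun k => Real.exp (-x * E k) * E k := by
  obtain ⟨C, hC⟩ := hN.isBoundedBelow
  have h0 := fun k => h.neg_le hA hC k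
  have h1 := h.summable_exp hA hN hx
  have h2 := h.summable_exp hA hN (half_pos hx)
  have h3 : Summable fun k => Real.exp (-x * E k) * (E k + C) := by
    refine Summable.of_nonneg_of_le
      (fun k => mul_nonneg (Real.exp_pos _).le (by linarith [h0 k])) (fun k => ?_)
      (h2.mul_left (Real.exp (x / 2 * C) * (2 / x)))
    have h4 := Real.add_one_le_exp (x / 2 * (E k + C))
    have h5 : E k + C ≤ 2 / x * Real.exp (x / 2 * (E k + C)) := by
      rw [div_mul_eq_mul_div, le_div_iff₀ hx]
      linarith
    calc Real.exp (-x * E k) * (E k + C)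
        ≤ Real.exp (-x * E k) * (2 / x * Real.exp (x / 2 * (E k + C))) :=
          mul_le_mul_of_nonneg_left h5 (Real.exp_pos _).le
      _ = 2 / x * (Real.exp (-x * E k) * Real.exp (x / 2 * (E k + C))) := by ring
      _ = 2 / x * (Real.exp (x / 2 * C) * Real.exp (-(x / 2) * E k)) := by
          rw [← Real.exp_add, ← Real.exp_add]; congr 2; ring
      _ = _ := by ring
  exact (h3.sub (h1.mul_left C)).congr fun k => by ring

theorem PartitionFinite.exists_isGibbsState {β : ℝ} {A : Module.End ℂ (PreFock s n)}
    (h : PartitionFinite β A) : ∃ ρ, IsGibbsState β A ρ := by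
  obtain ⟨hb, b, E, hE, hs⟩ := h
  obtain ⟨h0, h1⟩ := hasSum_gibbsWeight hs
  obtain ⟨ρ, hρ⟩ := exists_isDiag_of_summable b
    (fun k => div_nonneg (Real.exp_pos (-β * E k)).le h0.le) h1.summable
  exact ⟨ρ, hb, b, E, hE, hs, hρ⟩

/-- Eigenvectors of different energies are orthogonal: the form inner product of their lifts is
evaluated through either eigenvalue equation. -/
theorem IsEnergyBasis.eq_of_inner_ne_zero {A : Module.End ℂ (PreFock s n)} (hA : IsHermitianOp A)
    (hb : IsBoundedBelow A) {b b' : HilbertBasis (Occ s n) ℂ (Fock s n)} {E E' : Occ s n → ℝ}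
    (h : IsEnergyBasis A b E) (h' : IsEnergyBasis A b' E') {k j : Occ s n}
    (hkj : inner ℂ (b k) (b' j) ≠ 0) : E k = E' j := by
  obtain ⟨C, hC⟩ := hb
  obtain ⟨Q⟩ := exists_formSpace hA hC
  obtain ⟨ξ, hξ, h1, -⟩ := Q.inner_eigenvector (h k)
  obtain ⟨ξ', hξ', h1', -⟩ := Q.inner_eigenvector (h' j)
  have h2 := h1' ξ
  rw [← inner_conj_symm, h1, hξ, hξ', map_mul, Complex.conj_ofReal, inner_conj_symm] at h2
  have h3 := mul_right_cancel₀ hkj h2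
  rw [Complex.ofReal_inj] at h3
  linarith

theorem IsGibbsState.unique {β : ℝ} {A : Module.End ℂ (PreFock s n)} (hA : IsHermitianOp A)
    {ρ ρ' : Fock s n →L[ℂ] Fock s n} (h : IsGibbsState β A ρ) (h' : IsGibbsState β A ρ') :
    ρ = ρ' := by
  obtain ⟨hb, b, E, hE, hs, hd⟩ := h
  obtain ⟨-, b', E', hE', hs', hd'⟩ := h'
  have hov : ∀ k j, inner ℂ (b k) (b' j) ≠ 0 → E k = E' j := fun k j hkj =>
    hE.eq_of_inner_ne_zero hA hb hE' hkj
  have hZ : ∑' l, Real.exp (-β * E' l) = ∑' l, Real.exp (-β * E l) :=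
    (hasSum_of_overlap_eq (b := b) (b' := b') (fun k => (Real.exp_pos _).le)
      (fun k j hkj => by rw [hov k j hkj]) hs.hasSum).tsum_eq
  rw [hZ] at hd'
  have hd1 : IsDiag ρ b' fun k => Real.exp (-β * E' k) / ∑' l, Real.exp (-β * E l) := by
    intro j
    rw [← sub_eq_zero]
    have h1 := hasSum_normSq_inner b (ρ (b' j) -
      ((Real.exp (-β * E' j) / ∑' l, Real.exp (-β * E l) : ℝ) : ℂ) • b' j)
    have h2 : ∀ k, inner ℂ (b k) (ρ (b' j) -
      ((Real.exp (-β * E' j) / ∑' l, Real.exp (-β * E l) : ℝ) : ℂ) • b' j) = 0 := fun k => by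
      rw [inner_sub_right, inner_smul_right, IsDiag.inner_apply_left
        (w := fun k => Real.exp (-β * E k) / ∑' l, Real.exp (-β * E l)) hd]
      rcases eq_or_ne (inner ℂ (b k) (b' j)) 0 with h0 | h0
      · simp [h0]
      · rw [hov k j h0, sub_self]
    simp only [h2, norm_zero, ne_eq, OfNat.ofNat_ne_zero, not_false_eq_true, zero_pow] at h1
    have h3 := h1.unique hasSum_zero
    exact norm_eq_zero.1 (pow_eq_zero_iff two_ne_zero |>.1 h3)
  ext1 x
  exact (hd1.hasSum_apply x).unique (IsDiag.hasSum_apply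
    (w := fun k => Real.exp (-β * E' k) / ∑' l, Real.exp (-β * E l)) hd' x)

/-- Bessel's inequality in the form domain, for an orthonormal basis of eigenvectors. -/
theorem IsEnergyBasis.bessel {A : Module.End ℂ (PreFock s n)} (hA : IsHermitianOp A)
    {C : ℝ} (hC : ∀ φ, -C * ‖toFock φ‖ ^ 2 ≤ quad A φ)
    {b : HilbertBasis (Occ s n) ℂ (Fock s n)} {E : Occ s n → ℝ}
    (h : IsEnergyBasis A b E) {ψ : Fock s n} {e : ℝ} (he : HasFormValue A ψ e) :
    Summable (fun j => (E j + C + 1) * ‖inner ℂ (b j) ψ‖ ^ 2) ∧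
      ∑' j, (E j + C + 1) * ‖inner ℂ (b j) ψ‖ ^ 2 ≤ e + (C + 1) * ‖ψ‖ ^ 2 := by
  classical
  obtain ⟨Q⟩ := exists_formSpace hA hC
  obtain ⟨ξ, rfl, hn⟩ := Q.hasFormValue_iff.1 he
  have hμ : ∀ j, 0 < E j + C + 1 := fun j => by linarith [h.neg_le hA hC j]
  choose f hf hf1 _ using fun j => Q.inner_eigenvector (h j)
  have hsqrt : ∀ j, Real.sqrt (E j + C + 1) * Real.sqrt (E j + C + 1) = E j + C + 1 :=
    fun j => Real.mul_self_sqrt (hμ j).le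
  -- Eigenvectors remain orthogonal in the form inner product, with squared norm `E j + C + 1`;
  -- Bessel for the normalised lifts is the claim.
  have hon : Orthonormal ℂ fun j => ((Real.sqrt (E j + C + 1))⁻¹ : ℂ) • f j := by
    rw [orthonormal_iff_ite]
    intro i j
    rw [inner_smul_left, inner_smul_right, hf1, hf, orthonormal_iff_ite.1 b.orthonormal i j]
    split_ifs with hij
    · subst hij
      rw [← Complex.ofReal_inv, Complex.conj_ofReal, ← hsqrt i]
      have := (Real.sqrt_pos.2 (hμ i)).ne'
      push_cast
      have h' : (Real.sqrt (E i + C + 1) : ℂ) ≠ 0 := by exact_mod_cast this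
      rw [Real.sqrt_mul_self (Real.sqrt_nonneg _)]
      field_simp
    · simp
  have hval : ∀ j, ‖inner ℂ (((Real.sqrt (E j + C + 1))⁻¹ : ℂ) • f j) ξ‖ ^ 2 =
      (E j + C + 1) * ‖inner ℂ (b j) (Q.J ξ)‖ ^ 2 := by
    intro j
    rw [inner_smul_left, ← Complex.ofReal_inv, Complex.conj_ofReal, norm_mul, Complex.norm_real,
      Real.norm_eq_abs, abs_of_nonneg (inv_nonneg.2 (Real.sqrt_nonneg _)), norm_inner_symm, hf1,
      norm_mul, Complex.norm_real, Real.norm_eq_abs, abs_of_pos (hμ j), norm_inner_symm,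
      mul_pow, mul_pow, inv_pow, Real.sq_sqrt (hμ j).le]
    have := (hμ j).ne'
    field_simp
  have h1 := hon.inner_products_summable ξ
  have h2 := hon.tsum_inner_products_le ξ
  simp only [hval] at h1 h2
  rw [hn] at h2
  exact ⟨h1, h2⟩

/-- The Gibbs state of `A + V_v` minimises the grand potential of `A + V_v`. -/
theorem IsGibbsState.minimal {β : ℝ} (hβ : 0 < β) {A : Module.End ℂ (PreFock s n)}
    (hA : IsHermitianOp A) (hN : DominatesNumber A) {v : HermMat n}
    (hNv : DominatesNumber (A + potential s v)) {ρ : Fock s n →L[ℂ] Fock s n}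
    (h : IsGibbsState β (A + potential s v) ρ) :
    IsDensityOp ρ ∧ ∃ γ ω, HasOneRDM ρ γ ∧ HasGrandPotential β A ρ ω ∧
      ∀ γ', ∀ ω' ∈ grandPotentialValues β A γ',
        ω + tracePairing v γ ≤ ω' + tracePairing v γ' := by
  obtain ⟨hb, b, E, hE, hs, hd⟩ := h
  have hAv : IsHermitianOp (A + potential s v) := hA.add (isHermitianOp_potential v)
  obtain ⟨hZ, hw1⟩ := hasSum_gibbsWeight hs
  set Z := ∑' l, Real.exp (-β * E l)
  set w : Occ s n → ℝ := fun k => Real.exp (-β * E k) / Z with hw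
  have hwp : ∀ k, 0 < w k := fun k => div_pos (Real.exp_pos _) hZ
  have hd : IsDiag ρ b w := hd
  have hρ : IsDensityOp ρ := hd.isDensityOp (fun k => (hwp k).le) hw1
  have hlog : ∀ k, -Real.log (w k) = β * E k + Real.log Z := fun k => by
    rw [hw, Real.log_div (Real.exp_ne_zero _) hZ.ne', Real.log_exp]; ring
  obtain ⟨Ev, hEv⟩ : ∃ Ev, HasSum (fun k => w k * E k) Ev :=
    ⟨_, (((hE.summable_mul_exp hAv hNv hβ).div_const Z).congr fun k => by
      simp only [hw]; ring).hasSum⟩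
  have hform : ∀ k, HasFormValue (A + potential s v) (b k) (E k) := hE.hasFormValue hAv hb
  obtain ⟨K, hK, C, hC⟩ := hNv
  obtain ⟨η, hη, hfv, -, -, hsη, -⟩ :=
    exists_numberVectors hC (fun k => (hwp k).le) hw1 (fun k _ => hform k) hEv
  obtain ⟨γ, hγ⟩ := exists_hasOneRDM hd (fun k => (hwp k).le) hη hsη
  have hone := hasSum_oneBody hd (fun k => (hwp k).le) hη hsη hγ v
  -- Subtracting the potential again: the form domain argument applies to `A + V_v` with the
  -- potential `-v`.
  have hfA : ∀ k, HasFormValue A (b k) (E k - oneBody v (η k)) := fun k => by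
    have h1 := hfv k (hwp k).ne' (-v)
    rwa [add_potential_neg, oneBody_neg, ← sub_eq_add_neg] at h1
  have hEA : HasSum (fun k => w k * (E k - oneBody v (η k))) (Ev - tracePairing v γ) :=
    (hEv.sub hone).of_fun_eq fun k => by ring
  have hS : HasSum (fun k => Real.negMulLog (w k)) (β * Ev + Real.log Z * 1) := by
    refine ((hEv.mul_left β).add (hw1.mul_left (Real.log Z))).of_fun_eq fun k => ?_
    rw [Real.negMulLog, neg_mul_comm, hlog]; ring
  refine ⟨hρ, γ, _, hγ, ⟨_, _, ⟨b, w, hd, _, fun k _ => hfA k, hEA⟩, ⟨b, w, hd, hS⟩, rfl⟩, ?_⟩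
  rintro γ' ω' ⟨ρ', hρ', hγ', hω'⟩
  obtain ⟨b', w', e', E', S', d'⟩ := hω'.exists_spectralData hρ'
  obtain ⟨K', hK', C', hC'⟩ := hN
  obtain ⟨η', hη', hfv', -, -, hsη', -⟩ :=
    exists_numberVectors hC' d'.nonneg d'.sum_weights d'.formValue d'.energy
  have hone' := hasSum_oneBody d'.diag d'.nonneg hη' hsη' hγ' v
  have hE' : HasSum (fun k => w' k * (e' k + oneBody v (η' k))) (E' + tracePairing v γ') :=
    (d'.energy.add hone').of_fun_eq fun k => by ring
  obtain ⟨B, hB⟩ := hb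
  have hμ : ∀ j, 0 ≤ E j + B + 1 := fun j => by linarith [hE.neg_le hAv hB j]
  have hrow : ∀ k, Summable (fun j => w' k * ((E j + B + 1) * ‖inner ℂ (b j) (b' k)‖ ^ 2)) ∧
      ∑' j, w' k * ((E j + B + 1) * ‖inner ℂ (b j) (b' k)‖ ^ 2) ≤
        w' k * (e' k + oneBody v (η' k) + (B + 1)) := fun k => by
    by_cases hk : w' k = 0
    · simp [hk, summable_zero]
    · obtain ⟨h1, h2⟩ := hE.bessel hAv hB (hfv' k hk v)
      rw [b'.orthonormal.1 k, one_pow, mul_one] at h2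
      exact ⟨h1.mul_left _, by
        rw [tsum_mul_left]; exact mul_le_mul_of_nonneg_left h2 (d'.nonneg k)⟩
  have hup : HasSum (fun k => w' k * (e' k + oneBody v (η' k) + (B + 1)))
      (E' + tracePairing v γ' + (B + 1) * 1) :=
    (hE'.add (d'.sum_weights.mul_left (B + 1))).of_fun_eq fun k => by ring
  have hrs : Summable fun k => ∑' j, w' k * ((E j + B + 1) * ‖inner ℂ (b j) (b' k)‖ ^ 2) :=
    Summable.of_nonneg_of_le (fun k => tsum_nonneg fun j =>
      mul_nonneg (d'.nonneg k) (mul_nonneg (hμ j) (sq_nonneg _))) (fun k => (hrow k).2) hup.summable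
  -- Tonelli turns Bessel's inequality over the eigenvectors of `ρ'` into a series over the energy
  -- levels `E j`, bounded by the energy of `ρ'`.
  have hT := hasSum_swap (fun k j => mul_nonneg (d'.nonneg k) (mul_nonneg (hμ j) (sq_nonneg _)))
    (fun k => (hrow k).1.hasSum) hrs.hasSum
    (c := fun j => (E j + B + 1) * (inner ℂ (b j) (ρ' (b j))).re) (fun j => by
      refine ((d'.diag.hasSum_quad (b j)).mul_left (E j + B + 1)).of_fun_eq fun k => ?_
      rw [norm_inner_symm]; ring)
  have hTle := hasSum_le (fun k => (hrow k).2) hrs.hasSum hup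
  set T := ∑' k, ∑' j, w' k * ((E j + B + 1) * ‖inner ℂ (b j) (b' k)‖ ^ 2)
  have htr : HasSum (fun j => (inner ℂ (b j) (ρ' (b j))).re) 1 :=
    (d'.diag.hasSum_trace_iff d'.nonneg b 1).2 d'.sum_weights
  -- Since `-ln w_j = β E_j + ln Z`, the cross entropy with the Gibbs state is affine in the energy,
  -- and Klein's inequality becomes the Gibbs variational principle.
  have hcross : HasSum (fun j => (inner ℂ (b j) (ρ' (b j))).re * -Real.log (w j))
      (β * T + (Real.log Z - β * (B + 1)) * 1) := by
    refine ((hT.mul_left β).add (htr.mul_left _)).of_fun_eq fun j => ?_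
    rw [hlog]; ring
  have hent := (entropy_le_cross d'.diag d'.nonneg d'.sum_weights (fun k => (hwp k).le) hw1
    (fun j hj => absurd hj (hwp j).ne') hcross).2
  rw [d'.entropy.tsum_eq] at hent
  rw [d'.eq]
  have h3 := mul_le_mul_of_nonneg_left hTle hβ.le
  have h4 : S' ≤ β * (E' + tracePairing v γ') + Real.log Z := by linarith
  have h5 := mul_le_mul_of_nonneg_left h4 (inv_pos.2 hβ).le
  have h6 : β⁻¹ * (β * (E' + tracePairing v γ') + Real.log Z) =
    E' + tracePairing v γ' + β⁻¹ * Real.log Z := by field_simp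
  have h7 : β⁻¹ * (β * Ev + Real.log Z * 1) = Ev + β⁻¹ * Real.log Z := by field_simp
  rw [h7]
  linarith

end Gibbs

end

end RDM

namespace RDM

noncomputable section

/-! ### Positive matrices and Gram matrices -/

section Gram

variable {ι E : Type*} [Fintype ι] [NormedAddCommGroup E] [InnerProductSpace ℂ E]

/-- With `M = B* B` the double sum is `∑ k, ‖∑ j, B k j • x j‖ ^ 2`. -/
theorem re_sum_mul_inner_nonneg {M : Matrix ι ι ℂ} (hM : M.PosSemidef) (x : ι → E) :
    0 ≤ (∑ i, ∑ j, M i j * inner ℂ (x i) (x j)).re := by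
  classical
  open scoped MatrixOrder in
  obtain ⟨B, rfl⟩ := (CStarAlgebra.nonneg_iff_eq_star_mul_self).1 hM.nonneg
  rw [Matrix.star_eq_conjTranspose]
  have h : ∑ i, ∑ j, (B.conjTranspose * B) i j * inner ℂ (x i) (x j) =
      ∑ k, inner ℂ (∑ j, B k j • x j) (∑ j, B k j • x j) := by
    simp only [Matrix.mul_apply, Matrix.conjTranspose_apply, sum_inner, inner_sum, inner_smul_left,
      inner_smul_right, Finset.sum_mul]
    calc _ = ∑ i, ∑ k, ∑ j, star (B k i) * B k j * inner ℂ (x i) (x j) :=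
          Finset.sum_congr rfl fun i _ => Finset.sum_comm
      _ = ∑ k, ∑ i, ∑ j, star (B k i) * B k j * inner ℂ (x i) (x j) := Finset.sum_comm
      _ = _ := by
          refine Finset.sum_congr rfl fun k _ => ?_
          rw [Finset.sum_comm]
          refine Finset.sum_congr rfl fun i _ => ?_
          rw [Finset.mul_sum]
          refine Finset.sum_congr rfl fun j _ => ?_
          rw [← Complex.star_def]
          ring
  rw [h, Complex.re_sum]
  exact Finset.sum_nonneg fun k _ => inner_self_nonneg (𝕜 := ℂ)

/-- Compactness of the sup-norm unit sphere gives a positive minimum. Passing to the Euclidean norm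
costs the cardinality, increased by one so that the empty index type is covered. -/
theorem exists_le_re_dotProduct [DecidableEq ι] {M : Matrix ι ι ℂ}
    (hM : ∀ u : ι → ℂ, u ≠ 0 → 0 < (star u ⬝ᵥ M.mulVec u).re) :
    ∃ ε : ℝ, 0 < ε ∧ ∀ u : ι → ℂ, ε * ∑ i, ‖u i‖ ^ 2 ≤ (star u ⬝ᵥ M.mulVec u).re := by
  let f : (ι → ℂ) → ℝ := fun u => (star u ⬝ᵥ M.mulVec u).re
  have hf : Continuous f := by
    simp only [f, dotProduct, Matrix.mulVec]
    fun_prop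
  have hsmul : ∀ (c : ℝ) u, f ((c : ℂ) • u) = c ^ 2 * f u := fun c u => by
    simp only [f, star_smul, Matrix.mulVec_smul, smul_dotProduct, dotProduct_smul, smul_eq_mul,
      Complex.star_def, Complex.conj_ofReal, Complex.re_ofReal_mul]
    ring
  have hle : ∃ m : ℝ, 0 < m ∧ ∀ u : ι → ℂ, ‖u‖ = 1 → m ≤ f u := by
    by_cases hne : (Metric.sphere (0 : ι → ℂ) 1).Nonempty
    · obtain ⟨u, hu, hmin⟩ := (isCompact_sphere (0 : ι → ℂ) 1).exists_isMinOn hne hf.continuousOn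
      refine ⟨f u, hM u ?_, fun v hv => hmin (by simpa using hv)⟩
      rintro rfl
      simp at hu
    · exact ⟨1, one_pos, fun u hu => absurd ⟨u, by simpa using hu⟩ hne⟩
  obtain ⟨m, hm, hle⟩ := hle
  refine ⟨m / (Fintype.card ι + 1), by positivity, fun u => ?_⟩
  have hnorm : m * ‖u‖ ^ 2 ≤ f u := by
    rcases eq_or_ne u 0 with rfl | h0
    · simp [f]
    · have hr := norm_pos_iff.2 h0
      have h1 := hle (((‖u‖⁻¹ : ℝ) : ℂ) • u) (by
        rw [norm_smul, Complex.norm_real, norm_inv, norm_norm, inv_mul_cancel₀ hr.ne'])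
      rw [hsmul, inv_pow, inv_mul_eq_div, le_div_iff₀ (by positivity)] at h1
      exact h1
  refine le_trans ?_ hnorm
  rw [div_mul_eq_mul_div, div_le_iff₀ (by positivity), mul_assoc]
  refine mul_le_mul_of_nonneg_left ?_ hm.le
  calc ∑ i, ‖u i‖ ^ 2 ≤ ∑ _i : ι, ‖u‖ ^ 2 :=
        Finset.sum_le_sum fun i _ => pow_le_pow_left₀ (norm_nonneg _) (norm_le_pi_norm u i) 2
    _ = ‖u‖ ^ 2 * Fintype.card ι := by simp [mul_comm]
    _ ≤ _ := mul_le_mul_of_nonneg_left (by linarith) (sq_nonneg _)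

end Gram

/-! ### Modes, the vacuum, and domination by powers of the number operator -/

section Modes

variable {s : Statistics} {n : ℕ}

variable (s) in
/-- The creation operator of the one-particle state `z`. -/
def createMode (z : Fin n → ℂ) : Module.End ℂ (PreFock s n) := ∑ i, z i • create s n i

variable (s) in
/-- The annihilation operator of the one-particle state `z`. -/
def annihMode (z : Fin n → ℂ) : Module.End ℂ (PreFock s n) :=
  ∑ i, (starRingEnd ℂ) (z i) • annih s n i

theorem createMode_apply (z : Fin n → ℂ) (φ : PreFock s n) :
    createMode s z φ = ∑ i, z i • create s n i φ := by
  simp [createMode, LinearMap.sum_apply]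

theorem annihMode_apply (z : Fin n → ℂ) (φ : PreFock s n) :
    annihMode s z φ = ∑ i, (starRingEnd ℂ) (z i) • annih s n i φ := by
  simp [annihMode, LinearMap.sum_apply]

theorem inner_createMode (z : Fin n → ℂ) (φ ψ : PreFock s n) :
    inner ℂ (toFock (createMode s z φ)) (toFock ψ) =
      inner ℂ (toFock φ) (toFock (annihMode s z ψ)) := by
  simp only [createMode_apply, annihMode_apply, map_sum, map_smul, sum_inner, inner_sum,
    inner_smul_left, inner_smul_right, inner_create]

theorem inner_annihMode (z : Fin n → ℂ) (φ ψ : PreFock s n) :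
    inner ℂ (toFock (annihMode s z φ)) (toFock ψ) =
      inner ℂ (toFock φ) (toFock (createMode s z ψ)) := by
  rw [← inner_conj_symm, ← inner_createMode, inner_conj_symm]

theorem annih_create_apply (i j : Fin n) (φ : PreFock s n) :
    annih s n i (create s n j φ) =
      exchangeSign s • create s n j (annih s n i φ) + (if i = j then φ else 0) := by
  have h := LinearMap.congr_fun (annih_create (s := s) i j) φ
  simp only [LinearMap.add_apply, LinearMap.smul_apply, Module.End.mul_apply] at h
  rw [h]
  split_ifs <;> simp

theorem annih_annih_apply (i j : Fin n) (φ : PreFock s n) :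
    annih s n i (annih s n j φ) = exchangeSign s • annih s n j (annih s n i φ) :=
  LinearMap.congr_fun (annih_annih (s := s) i j) φ

theorem create_create_apply (i j : Fin n) (φ : PreFock s n) :
    create s n i (create s n j φ) = exchangeSign s • create s n j (create s n i φ) :=
  LinearMap.congr_fun (create_create (s := s) i j) φ

theorem annih_createMode (i : Fin n) (z : Fin n → ℂ) (φ : PreFock s n) :
    annih s n i (createMode s z φ) =
      exchangeSign s • createMode s z (annih s n i φ) + z i • φ := by
  simp only [createMode_apply, map_sum, map_smul, annih_create_apply, smul_add,
    Finset.sum_add_distrib, Finset.smul_sum, smul_ite, smul_zero]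
  simp [smul_comm (exchangeSign s)]

theorem annihMode_createMode (y z : Fin n → ℂ) (φ : PreFock s n) :
    annihMode s y (createMode s z φ) =
      exchangeSign s • createMode s z (annihMode s y φ) + (star y ⬝ᵥ z) • φ := by
  rw [annihMode_apply, annihMode_apply, map_sum, Finset.smul_sum, dotProduct, Finset.sum_smul,
    ← Finset.sum_add_distrib]
  refine Finset.sum_congr rfl fun i _ => ?_
  rw [annih_createMode, map_smul, smul_add, smul_smul, smul_smul, smul_smul, mul_comm]
  rfl

theorem annihMode_annihMode (y z : Fin n → ℂ) (φ : PreFock s n) :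
    annihMode s y (annihMode s z φ) = exchangeSign s • annihMode s z (annihMode s y φ) := by
  simp only [annihMode_apply, map_sum, map_smul, Finset.smul_sum]
  rw [Finset.sum_comm]
  refine Finset.sum_congr rfl fun i _ => Finset.sum_congr rfl fun j _ => ?_
  rw [annih_annih_apply, smul_smul, smul_smul, smul_smul, smul_smul]
  congr 1
  ring

theorem createMode_createMode (y z : Fin n → ℂ) (φ : PreFock s n) :
    createMode s y (createMode s z φ) = exchangeSign s • createMode s z (createMode s y φ) := by
  simp only [createMode_apply, map_sum, map_smul, Finset.smul_sum]
  rw [Finset.sum_comm]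
  refine Finset.sum_congr rfl fun i _ => Finset.sum_congr rfl fun j _ => ?_
  rw [create_create_apply, smul_smul, smul_smul, smul_smul, smul_smul]
  congr 1
  ring

variable (s n) in
/-- The vacuum state. -/
def vacuum : PreFock s n := Finsupp.single default 1

@[simp] theorem annih_vacuum (i : Fin n) : annih s n i (vacuum s n) = 0 := by
  have : (default : Occ s n).1 i = 0 := rfl
  rw [vacuum, annih_single, this]
  simp

@[simp] theorem annihMode_vacuum (z : Fin n → ℂ) : annihMode s z (vacuum s n) = 0 := by
  simp [annihMode_apply]

@[simp] theorem norm_vacuum : ‖toFock (vacuum s n)‖ = 1 := by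
  rw [vacuum, toFock_single, one_smul]
  exact orthonormal_ket.1 _

theorem vacuum_ne_zero : vacuum s n ≠ 0 := by
  intro h
  have := norm_vacuum (s := s) (n := n)
  rw [h] at this
  simp at this

/-- A one-body potential that is a constant vanishes. -/
theorem eq_of_potential_sub_eq {v v' : HermMat n} {c : ℂ}
    (h : ∀ φ : PreFock s n, potential s v' φ - potential s v φ = c • φ) : v = v' := by
  have hpot : ∀ (v : HermMat n) φ, potential s v φ = ∑ i, ∑ j,
    (v : Matrix (Fin n) (Fin n) ℂ) i j • create s n i (annih s n j φ) := potential_apply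
  -- The vacuum is annihilated by every one-body potential, so it fixes the constant; the
  -- one-particle states then read off the matrix entries.
  have hc : c = 0 := by
    have h1 := h (vacuum s n)
    simp only [hpot, annih_vacuum, map_zero, smul_zero, Finset.sum_const_zero, sub_zero] at h1
    exact (smul_eq_zero.1 h1.symm).resolve_right vacuum_ne_zero
  have hone : ∀ (v : HermMat n) k l, inner ℂ (toFock (create s n k (vacuum s n)))
      (toFock (potential s v (create s n l (vacuum s n)))) =
      (v : Matrix (Fin n) (Fin n) ℂ) k l := by
    intro v k l
    have h2 : ∀ i j : Fin n, create s n i (if j = l then vacuum s n else 0) =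
      if j = l then create s n i (vacuum s n) else 0 := fun i j => by split_ifs <;> simp
    have h3 : ∀ i : Fin n, inner ℂ (toFock (create s n k (vacuum s n)))
        (toFock (create s n i (vacuum s n))) = if i = k then 1 else 0 := fun i => by
      rw [inner_create, annih_create_apply, annih_vacuum, map_zero, smul_zero, zero_add]
      by_cases hik : k = i
      · simp [hik]
      · simp [hik, Ne.symm hik]
    simp only [hpot, annih_create_apply, annih_vacuum, map_zero, smul_zero, zero_add,
      map_sum, map_smul, h2, smul_ite, Finset.sum_ite_eq', Finset.mem_univ, if_true, inner_sum,
      inner_smul_right, h3]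
    simp
  apply Subtype.ext
  ext k l
  rw [← hone v k l, ← hone v' k l, eq_comm, ← sub_eq_zero, ← inner_sub_right, ← map_sub, h, hc]
  simp

theorem finite_occ_fermion : Finite (Occ Statistics.fermion n) := by
  refine Finite.of_injective (fun k : Occ Statistics.fermion n => fun i =>
    (⟨k.1 i, Nat.lt_succ_of_le (k.2 rfl i)⟩ : Fin 2)) fun k l h => ?_
  apply Subtype.ext
  funext i
  exact congrArg Fin.val (congrFun h i)

/-- In finite dimensions every form is bounded. -/
theorem exists_abs_quad_le [Finite (Occ s n)] (A : Module.End ℂ (PreFock s n)) :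
    ∃ c : ℝ, 0 ≤ c ∧ ∀ φ, |quad A φ| ≤ c * ‖toFock φ‖ ^ 2 := by
  have := Fintype.ofFinite (Occ s n)
  refine ⟨∑ k, ∑ l, ‖form A (Finsupp.single k 1) (Finsupp.single l 1)‖,
    Finset.sum_nonneg fun k _ => Finset.sum_nonneg fun l _ => norm_nonneg _, fun φ => ?_⟩
  have h2 : φ = ∑ k, φ k • Finsupp.single k (1 : ℂ) := by
    conv_lhs => rw [← Finsupp.univ_sum_single φ]
    exact Finset.sum_congr rfl fun k _ => by simp
  have h3 : form A φ φ = ∑ k, ∑ l, (starRingEnd ℂ) (φ k) *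
      (φ l * form A (Finsupp.single k 1) (Finsupp.single l 1)) := by
    conv_lhs => rw [h2]
    simp only [form, map_sum, map_smul, sum_inner, inner_sum, inner_smul_left, inner_smul_right]
    simp only [Finset.mul_sum]
    rw [Finset.sum_comm]
    exact Finset.sum_congr rfl fun k _ => Finset.sum_congr rfl fun l _ => by ring
  have h4 : ∀ k, ‖φ k‖ ≤ ‖toFock φ‖ := fun k => by
    rw [← toFock_apply]; exact lp.norm_apply_le_norm two_ne_zero _ _
  rw [quad, h3, Finset.sum_mul]
  refine (Complex.abs_re_le_norm _).trans ((norm_sum_le _ _).trans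
    (Finset.sum_le_sum fun k _ => ?_))
  rw [Finset.sum_mul]
  refine (norm_sum_le _ _).trans (Finset.sum_le_sum fun l _ => ?_)
  rw [norm_mul, norm_mul, RCLike.norm_conj, ← mul_assoc, mul_comm, sq]
  exact mul_le_mul_of_nonneg_left (mul_le_mul (h4 k) (h4 l) (norm_nonneg _) (norm_nonneg _))
    (norm_nonneg _)

theorem dominatesNumber_of_finite [Finite (Occ s n)] (A : Module.End ℂ (PreFock s n)) :
    DominatesNumber A := by
  obtain ⟨c₁, h₁, h1⟩ := exists_abs_quad_le A
  obtain ⟨c₂, h₂, h2⟩ := exists_abs_quad_le (numberOp s n)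
  refine ⟨1, one_pos, c₁ + c₂, fun φ => ?_⟩
  have h3 := (abs_le.1 (h1 φ)).1
  have h4 := (abs_le.1 (h2 φ)).2
  linarith

theorem quad_numberOp_pow (m : ℕ) (φ : PreFock s n) : quad (numberOp s n ^ m) φ =
    ∑ k ∈ φ.support, (particles k : ℝ) ^ m * ‖φ k‖ ^ 2 := by
  have h1 : ∀ k c, (numberOp s n ^ m) (Finsupp.single k c) =
      ((particles k : ℂ) ^ m) • Finsupp.single k c := by
    intro k c
    induction m with
    | zero => simp
    | succ m ih =>
      rw [pow_succ', Module.End.mul_apply, ih, map_smul, numberOp_single, smul_smul, pow_succ]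
      rfl
  have h2 : ∀ k, ((numberOp s n ^ m) φ) k = (particles k : ℂ) ^ m * φ k := by
    intro k
    induction φ using Finsupp.induction_linear with
    | zero => simp
    | add f g hf hg => simp [hf, hg, mul_add]
    | single l c =>
      rw [h1]
      by_cases h : l = k
      · subst h; simp
      · simp [h]
  rw [quad, form, inner_toFock, Complex.re_sum]
  refine Finset.sum_congr rfl fun k _ => ?_
  rw [toFock_apply, h2, mul_left_comm, ← Complex.normSq_eq_conj_mul_self,
    Complex.normSq_eq_norm_sq, ← Complex.ofReal_natCast, ← Complex.ofReal_pow,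
    ← Complex.ofReal_mul, Complex.ofReal_re]

theorem IsCoercive.dominatesNumber {m : ℕ} (hm : 0 < m) {A : Module.End ℂ (PreFock s n)}
    (h : IsCoercive m A) : DominatesNumber A := by
  obtain ⟨K, hK, C, hC⟩ := h
  refine ⟨K⁻¹, inv_pos.2 hK, C, fun φ => ?_⟩
  rw [inv_mul_eq_div, le_div_iff₀ hK]
  refine le_trans ?_ (hC φ)
  rw [mul_comm, ← pow_one (numberOp s n), ← pow_mul, one_mul, quad_numberOp_pow, quad_numberOp_pow]
  refine mul_le_mul_of_nonneg_left (Finset.sum_le_sum fun k _ =>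
    mul_le_mul_of_nonneg_right ?_ (sq_nonneg _)) hK.le
  rw [pow_one]
  exact_mod_cast Nat.le_self_pow hm.ne' (particles k)

theorem abs_quad_potential_le (s : Statistics) (v : HermMat n) : ∃ c : ℝ, 0 ≤ c ∧
    ∀ φ, |quad (potential s v) φ| ≤ c * (quad (numberOp s n) φ + ‖toFock φ‖ ^ 2) := by
  obtain ⟨c, hc, h⟩ := exists_abs_oneBody_le s v
  refine ⟨c, hc, fun φ => ?_⟩
  have h1 := h ((numberSpace s n).emb φ)
  rw [oneBody_emb, FormSpace.norm_emb_sq] at h1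
  linarith

/-- The potential is bounded by `c * (N + 1)`, while for `m ≥ 2` the number operator has relative
bound zero with respect to `N ^ m`. -/
theorem IsCoercive.dominatesNumber_add_potential {m : ℕ} (hm : 2 ≤ m)
    {A : Module.End ℂ (PreFock s n)} (h : IsCoercive m A) (v : HermMat n) :
    DominatesNumber (A + potential s v) := by
  obtain ⟨K, hK, C, hC⟩ := h
  obtain ⟨c, hc, hv⟩ := abs_quad_potential_le s v
  -- The last constant comes from completing the square in `(c + 1) x ≤ K x² + (c + 1)² / (4K)`; the
  -- factor `c + 1` instead of `c` leaves one copy of `N` over.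
  refine ⟨1, one_pos, C + c + (c + 1) ^ 2 / (4 * K), fun φ => ?_⟩
  have h1 : (c + 1) * quad (numberOp s n) φ ≤
      K * quad (numberOp s n ^ m) φ + (c + 1) ^ 2 / (4 * K) * ‖toFock φ‖ ^ 2 := by
    rw [← pow_one (numberOp s n), ← pow_mul, one_mul, quad_numberOp_pow, quad_numberOp_pow,
      norm_toFock_sq, Finset.mul_sum, Finset.mul_sum, Finset.mul_sum, ← Finset.sum_add_distrib]
    refine Finset.sum_le_sum fun k _ => ?_
    rw [← mul_assoc, ← mul_assoc, ← add_mul]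
    refine mul_le_mul_of_nonneg_right ?_ (sq_nonneg _)
    have h2 : (particles k : ℝ) ^ 2 ≤ (particles k : ℝ) ^ m := by
      rcases Nat.eq_zero_or_pos (particles k) with h0 | h0
      · rw [h0]
        simp [show m ≠ 0 by omega]
      · exact_mod_cast Nat.pow_le_pow_right h0 hm
    have h3 := mul_le_mul_of_nonneg_left h2 hK.le
    refine le_trans ?_ (add_le_add_left h3 _)
    have h4 : 0 ≤ (2 * K * particles k - (c + 1)) ^ 2 / (4 * K) := by positivity
    have h5 : (2 * K * particles k - (c + 1)) ^ 2 / (4 * K) =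
      K * (particles k : ℝ) ^ 2 - (c + 1) * particles k + (c + 1) ^ 2 / (4 * K) := by
        field_simp; ring
    rw [pow_one]
    linarith
  have h6 := (abs_le.1 (hv φ)).1
  rw [quad_add_op]
  linarith [hC φ]

end Modes

end

end RDM

namespace RDM

noncomputable section

/-! ### Window states: superpositions of particle numbers in one mode -/

section ModeStates

variable {n : ℕ}

/-- The normalised state with `k` bosons in the one-particle state `z`. -/
def modeState (z : Fin n → ℂ) : ℕ → PreFock Statistics.boson n
  | 0 => vacuum _ _
  | k + 1 => ((Real.sqrt (k + 1 : ℕ) : ℂ))⁻¹ • createMode _ z (modeState z k)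

theorem sqrt_cast_succ_ne_zero (k : ℕ) : (Real.sqrt (k + 1 : ℕ) : ℂ) ≠ 0 := by
  have : 0 < Real.sqrt (k + 1 : ℕ) := Real.sqrt_pos.2 (by positivity)
  exact_mod_cast this.ne'

theorem createMode_modeState (z : Fin n → ℂ) (k : ℕ) :
    createMode _ z (modeState z k) = (Real.sqrt (k + 1 : ℕ) : ℂ) • modeState z (k + 1) := by
  rw [modeState, smul_smul, mul_inv_cancel₀ (sqrt_cast_succ_ne_zero k), one_smul]

theorem annih_modeState (z : Fin n → ℂ) (i : Fin n) : ∀ k : ℕ,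
    annih _ n i (modeState z (k + 1)) = ((Real.sqrt (k + 1 : ℕ) : ℂ) * z i) • modeState z k
  | 0 => by
    have h : modeState z (0 + 1) = createMode _ z (vacuum _ _) := by simp [modeState]
    rw [h, annih_createMode, modeState, annih_vacuum]
    simp
  | k + 1 => by
    rw [modeState, map_smul, annih_createMode, annih_modeState z i k, map_smul,
      createMode_modeState, exchangeSign, one_smul, smul_smul, ← add_smul, smul_smul]
    congr 1
    have h := sqrt_mul_sqrt_cast (k + 1)
    have h' := sqrt_mul_sqrt_cast (k + 1 + 1)
    have h0 := sqrt_cast_succ_ne_zero (k + 1)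
    rw [inv_mul_eq_iff_eq_mul₀ h0]
    calc _ = ((Real.sqrt (k + 1 : ℕ) : ℂ) * Real.sqrt (k + 1 : ℕ) + 1) * z i := by ring
      _ = ((Real.sqrt (k + 1 + 1 : ℕ) : ℂ) * Real.sqrt (k + 1 + 1 : ℕ)) * z i := by
        rw [h, h']; push_cast; ring
      _ = _ := by ring

theorem annihMode_modeState {z : Fin n → ℂ} (hz : star z ⬝ᵥ z = 1) (k : ℕ) :
    annihMode _ z (modeState z (k + 1)) = (Real.sqrt (k + 1 : ℕ) : ℂ) • modeState z k := by
  rw [annihMode_apply]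
  simp only [annih_modeState, smul_smul]
  rw [← Finset.sum_smul]
  congr 1
  conv_rhs => rw [← mul_one (Real.sqrt (k + 1 : ℕ) : ℂ), ← hz, dotProduct, Finset.mul_sum]
  refine Finset.sum_congr rfl fun i _ => ?_
  rw [Pi.star_apply, ← Complex.star_def]
  ring

theorem inner_modeState {z : Fin n → ℂ} (hz : star z ⬝ᵥ z = 1) : ∀ j k : ℕ,
    inner ℂ (toFock (modeState z j)) (toFock (modeState z k)) = if j = k then (1 : ℂ) else 0
  | 0, 0 => by simp [modeState]
  | 0, k + 1 => by
    rw [modeState, modeState, map_smul, inner_smul_right, ← inner_annihMode]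
    simp
  | j + 1, 0 => by
    rw [modeState, modeState, map_smul, inner_smul_left, inner_createMode]
    simp
  | j + 1, k + 1 => by
    rw [modeState, map_smul, inner_smul_left, inner_createMode, annihMode_modeState hz, map_smul,
      inner_smul_right, inner_modeState hz j k, ← Complex.ofReal_inv, Complex.conj_ofReal]
    by_cases h : j = k
    · subst h
      have := sqrt_cast_succ_ne_zero j
      simp only [if_true, mul_one]
      push_cast
      push_cast at this
      exact inv_mul_cancel₀ this
    · simp [h]

/-- A superposition of the states with less than `m` bosons in the one-particle state `z`. -/
def modeVector (z : Fin n → ℂ) (m : ℕ) (u : ℕ → ℝ) : PreFock Statistics.boson n :=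
  ∑ k ∈ Finset.range m, (u k : ℂ) • modeState z k

theorem inner_modeVector {z : Fin n → ℂ} (hz : star z ⬝ᵥ z = 1) {m m' : ℕ} (h : m ≤ m')
    (u w : ℕ → ℝ) : inner ℂ (toFock (modeVector z m u)) (toFock (modeVector z m' w)) =
      ((∑ k ∈ Finset.range m, u k * w k : ℝ) : ℂ) := by
  simp only [modeVector, map_sum, map_smul, sum_inner, inner_sum, inner_smul_left,
    inner_smul_right, inner_modeState hz, Complex.conj_ofReal]
  push_cast
  simp only [Finset.mul_sum]
  rw [Finset.sum_comm]
  refine Finset.sum_congr rfl fun k hk => ?_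
  have hk' : k < m' := (Finset.mem_range.1 hk).trans_le h
  simp [hk', mul_comm]

theorem annih_modeVector (z : Fin n → ℂ) (i : Fin n) (m : ℕ) (u : ℕ → ℝ) :
    annih _ n i (modeVector z (m + 1) u) =
      z i • modeVector z m fun k => Real.sqrt (k + 1 : ℕ) * u (k + 1) := by
  rw [modeVector, Finset.sum_range_succ', map_add, map_sum, map_smul, modeState, annih_vacuum,
    smul_zero, add_zero, modeVector, Finset.smul_sum]
  refine Finset.sum_congr rfl fun k _ => ?_
  rw [map_smul, annih_modeState, smul_smul, smul_smul]
  congr 1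
  push_cast
  ring

/-- The amplitudes of a uniform superposition over the particle numbers from `L` on. -/
def windowAmplitude (L : ℕ) (k : ℕ) : ℝ := if L ≤ k then (Real.sqrt L)⁻¹ else 0

theorem windowAmplitude_nonneg (L k : ℕ) : 0 ≤ windowAmplitude L k := by
  unfold windowAmplitude
  split_ifs <;> positivity

/-- The window has no upper cut-off of its own (it comes from the range in `modeVector`), so a
product of two amplitudes depends only on the smaller index. -/
theorem windowAmplitude_mul {L j k : ℕ} (h : k ≤ j) :
    windowAmplitude L j * windowAmplitude L k = if L ≤ k then (L : ℝ)⁻¹ else 0 := by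
  unfold windowAmplitude
  by_cases hk : L ≤ k
  · rw [if_pos hk, if_pos (hk.trans h), if_pos hk, ← mul_inv,
      Real.mul_self_sqrt (Nat.cast_nonneg L)]
  · simp [hk]

theorem sum_windowAmplitude_mul_self {L : ℕ} (hL : 0 < L) :
    ∑ k ∈ Finset.range (2 * L), windowAmplitude L k * windowAmplitude L k = 1 := by
  simp only [windowAmplitude_mul le_rfl]
  rw [← Finset.sum_filter, Finset.sum_const]
  have : (Finset.range (2 * L)).filter (fun k => L ≤ k) = Finset.Ico L (2 * L) := by
    ext k; simp; omega
  rw [this, Nat.card_Ico, show 2 * L - L = L by omega, nsmul_eq_mul,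
    mul_inv_cancel₀ (Nat.cast_pos.2 hL).ne']

/-- The anomalous density of the window state differs from its density by a bounded amount. -/
theorem abs_sum_window_le {L m : ℕ} (hL : 0 < L) (hm : m + 2 = 2 * L) :
    |(∑ k ∈ Finset.range m, (Real.sqrt (k + 1 : ℕ) * (Real.sqrt (k + 1 + 1 : ℕ) *
      windowAmplitude L (k + 1 + 1))) * windowAmplitude L k) -
      ∑ k ∈ Finset.range (m + 1), (Real.sqrt (k + 1 : ℕ) * windowAmplitude L (k + 1)) *
        (Real.sqrt (k + 1 : ℕ) * windowAmplitude L (k + 1))| ≤ 4 := by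
  set c : ℕ → ℝ := fun k => if L ≤ k then (L : ℝ)⁻¹ else 0 with hc
  have hc0 : ∀ k, 0 ≤ c k := fun k => by simp only [hc]; split_ifs <;> positivity
  have hc1 : ∀ k, c k ≤ (L : ℝ)⁻¹ := fun k => by simp only [hc]; split_ifs <;> simp
  have hcm : ∀ k, c k ≤ c (k + 2) := fun k => by
    simp only [hc]
    split_ifs with h1 h2
    · exact le_rfl
    · omega
    · positivity
    · exact le_rfl
  have e1 : ∀ k : ℕ, (Real.sqrt (k + 1 : ℕ) * windowAmplitude L (k + 1)) *
      (Real.sqrt (k + 1 : ℕ) * windowAmplitude L (k + 1)) = ((k + 1 : ℕ) : ℝ) * c (k + 1) := by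
    intro k
    rw [mul_mul_mul_comm, windowAmplitude_mul le_rfl, Real.mul_self_sqrt (Nat.cast_nonneg _)]
  have e2 : ∀ k : ℕ, (Real.sqrt (k + 1 : ℕ) * (Real.sqrt (k + 1 + 1 : ℕ) *
      windowAmplitude L (k + 1 + 1))) * windowAmplitude L k =
      (Real.sqrt (k + 1 : ℕ) * Real.sqrt (k + 1 + 1 : ℕ)) * c k := by
    intro k
    rw [← mul_assoc, mul_assoc, windowAmplitude_mul (show k ≤ k + 1 + 1 by omega)]
  simp only [e1, e2]
  -- Two shifts of the density sum sandwich the anomalous one, as `k ≤ √(k+1) √(k+2) ≤ k + 2`. The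
  -- boundary terms are at most `(2m + 1) / L ≤ 4`.
  have e3 : ∑ k ∈ Finset.range (m + 1), ((k + 1 : ℕ) : ℝ) * c (k + 1) =
      ∑ k ∈ Finset.range m, (k : ℝ) * c k + m * c m + (m + 1 : ℕ) * c (m + 1) := by
    rw [← Finset.sum_range_succ (fun k => (k : ℝ) * c k),
      ← Finset.sum_range_succ (fun k => (k : ℝ) * c k), Finset.sum_range_succ' _ (m + 1)]
    simp
  have e4 : ∑ k ∈ Finset.range (m + 1), ((k + 1 : ℕ) : ℝ) * c (k + 1) =
      ∑ k ∈ Finset.range m, ((k + 2 : ℕ) : ℝ) * c (k + 2) + c 1 := by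
    rw [Finset.sum_range_succ']
    simp only [zero_add, Nat.cast_one, one_mul]
  have hlo : ∑ k ∈ Finset.range m, (k : ℝ) * c k ≤
      ∑ k ∈ Finset.range m, (Real.sqrt (k + 1 : ℕ) * Real.sqrt (k + 1 + 1 : ℕ)) * c k := by
    refine Finset.sum_le_sum fun k _ => mul_le_mul_of_nonneg_right ?_ (hc0 k)
    calc (k : ℝ) = Real.sqrt k * Real.sqrt k := (Real.mul_self_sqrt (Nat.cast_nonneg k)).symm
      _ ≤ _ := by
        gcongr <;> omega
  have hhi : ∑ k ∈ Finset.range m, (Real.sqrt (k + 1 : ℕ) * Real.sqrt (k + 1 + 1 : ℕ)) * c k ≤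
      ∑ k ∈ Finset.range m, ((k + 2 : ℕ) : ℝ) * c (k + 2) := by
    refine Finset.sum_le_sum fun k _ => mul_le_mul ?_ (hcm k) (hc0 k) (Nat.cast_nonneg _)
    calc _ ≤ Real.sqrt (k + 2 : ℕ) * Real.sqrt (k + 2 : ℕ) := by
          gcongr; omega
      _ = _ := Real.mul_self_sqrt (Nat.cast_nonneg _)
  have hb : (m : ℝ) * c m + (m + 1 : ℕ) * c (m + 1) ≤ 4 := by
    have hLp : (0 : ℝ) < L := Nat.cast_pos.2 hL
    have h1 : (m : ℝ) + 2 = 2 * L := by exact_mod_cast hm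
    calc _ ≤ (m : ℝ) * (L : ℝ)⁻¹ + (m + 1 : ℕ) * (L : ℝ)⁻¹ :=
          add_le_add (mul_le_mul_of_nonneg_left (hc1 _) (Nat.cast_nonneg _))
            (mul_le_mul_of_nonneg_left (hc1 _) (Nat.cast_nonneg _))
      _ = (2 * m + 1) / L := by push_cast; ring
      _ ≤ 4 := by rw [div_le_iff₀ hLp]; linarith
  rw [abs_le]
  have := hc0 1
  constructor
  · rw [e3]; linarith
  · rw [e4]; linarith

/-- The uniform superposition of the states with `L, …, 2L - 1` bosons in the one-particle
state `z`. -/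
def windowState (z : Fin n → ℂ) (L : ℕ) : PreFock Statistics.boson n :=
  modeVector z (2 * L) (windowAmplitude L)

theorem norm_windowState {z : Fin n → ℂ} (hz : star z ⬝ᵥ z = 1) {L : ℕ} (hL : 0 < L) :
    ‖toFock (windowState z L)‖ = 1 := by
  have h := inner_modeVector hz (le_refl (2 * L)) (windowAmplitude L) (windowAmplitude L)
  rw [sum_windowAmplitude_mul_self hL, inner_self_eq_ofReal, Complex.ofReal_inj] at h
  exact (pow_eq_one_iff_of_nonneg (norm_nonneg _) two_ne_zero).1 h

/-- The dyadic windows `[2^r, 2^(r+1))` of particle numbers are disjoint. -/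
theorem orthonormal_windowState {z : Fin n → ℂ} (hz : star z ⬝ᵥ z = 1) :
    Orthonormal ℂ fun r : ℕ => toFock (windowState z (2 ^ r)) := by
  have h : ∀ r r' : ℕ, r < r' →
      inner ℂ (toFock (windowState z (2 ^ r))) (toFock (windowState z (2 ^ r'))) = 0 := by
    intro r r' hr
    have h1 : 2 * 2 ^ r ≤ 2 ^ r' := by
      rw [← pow_succ']; exact Nat.pow_le_pow_right two_pos hr
    rw [windowState, windowState, inner_modeVector hz (by omega)]
    rw [Complex.ofReal_eq_zero]
    refine Finset.sum_eq_zero fun k hk => ?_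
    have h2 := Finset.mem_range.1 hk
    have : ¬ 2 ^ r' ≤ k := by omega
    simp [windowAmplitude, this]
  refine ⟨fun r => norm_windowState hz (by positivity), fun r r' hr => ?_⟩
  rcases lt_or_gt_of_ne hr with h1 | h1
  · exact h r r' h1
  · rw [← inner_conj_symm, h r' r h1, map_zero]

end ModeStates

/-! ### Finite partition function and orthonormal sequences -/

section CompactResolvent

variable {s : Statistics} {n : ℕ}

/-- An operator with finite partition function is unbounded on every orthonormal sequence. -/
theorem PartitionFinite.not_quad_le {β : ℝ} (hβ : 0 < β) {A : Module.End ℂ (PreFock s n)}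
    (hA : IsHermitianOp A) (h : PartitionFinite β A) {φ : ℕ → PreFock s n}
    (hφ : Orthonormal ℂ fun r => toFock (φ r)) (B : ℝ) : ¬ ∀ r, quad A (φ r) ≤ B := by
  intro hB
  obtain ⟨⟨C, hC⟩, b, E, hE, hs⟩ := h
  -- Levels with `E j + C + 1 ≥ R` can carry at most half of the norm of a vector of energy at most
  -- `B`. The other levels are finitely many, since the Boltzmann weights tend to zero, and an
  -- orthonormal sequence leaves them by Bessel.
  set R := 2 * (|B + C + 1| + 1) with hR
  have hRpos : 0 < R := by positivity
  have hfin : {j | E j + C + 1 < R}.Finite := by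
    have h1 := hs.tendsto_cofinite_zero.eventually_lt_const
      (Real.exp_pos (-β * (R - C - 1)))
    refine h1.subset fun j hj => ?_
    simp only [Set.mem_compl_iff, Set.mem_ofPred_eq, not_lt, Real.exp_le_exp] at hj ⊢
    have h2 : β * E j ≤ β * (R - C - 1) := by
      refine mul_le_mul_of_nonneg_left ?_ hβ.le
      linarith
    linarith
  have hhalf : ∀ r, (1 / 2 : ℝ) ≤ ∑ j ∈ hfin.toFinset, ‖inner ℂ (b j) (toFock (φ r))‖ ^ 2 := by
    intro r
    obtain ⟨h1, h2⟩ := hE.bessel hA hC (hasFormValue_toFock A (φ r))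
    have h3 := hasSum_normSq_inner b (toFock (φ r))
    rw [hφ.1 r] at h2 h3
    have h4 : HasSum (fun j => if j ∈ hfin.toFinset then
        ‖inner ℂ (b j) (toFock (φ r))‖ ^ 2 else 0)
        (∑ j ∈ hfin.toFinset, ‖inner ℂ (b j) (toFock (φ r))‖ ^ 2) := by
      rw [← Finset.sum_congr rfl fun j (hj : j ∈ hfin.toFinset) =>
        (if_pos hj : (if j ∈ hfin.toFinset then ‖inner ℂ (b j) (toFock (φ r))‖ ^ 2 else 0) = _)]
      exact hasSum_sum_of_ne_finset_zero fun j hj => if_neg hj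
    have h5 := hasSum_le (fun j => ?_) h3 (h4.add (h1.hasSum.mul_left R⁻¹))
    · have h6 : R⁻¹ * ∑' j, (E j + C + 1) * ‖inner ℂ (b j) (toFock (φ r))‖ ^ 2 ≤ 1 / 2 := by
        rw [inv_mul_le_iff₀ hRpos]
        have h7 := le_abs_self (B + C + 1)
        have h8 := hB r
        simp only [hR]
        linarith
      linarith
    · have hμ : 0 ≤ E j + C + 1 := by linarith [hE.neg_le hA hC j]
      by_cases hj : j ∈ hfin.toFinset
      · rw [if_pos hj]
        have : 0 ≤ R⁻¹ * ((E j + C + 1) * ‖inner ℂ (b j) (toFock (φ r))‖ ^ 2) := by positivity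
        linarith
      · rw [if_neg hj, zero_add, ← mul_assoc]
        refine le_mul_of_one_le_left (sq_nonneg _) ?_
        rw [inv_mul_eq_div, one_le_div hRpos]
        simpa using hj
  have hlim : Tendsto (fun r => ∑ j ∈ hfin.toFinset, ‖inner ℂ (b j) (toFock (φ r))‖ ^ 2) atTop
      (𝓝 (∑ j ∈ hfin.toFinset, 0)) := by
    refine tendsto_finsetSum _ fun j _ => ?_
    have := (hφ.inner_products_summable (b j)).tendsto_atTop_zero
    simpa only [norm_inner_symm] using this
  rw [Finset.sum_const_zero] at hlim
  have := ge_of_tendsto' hlim hhalf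
  norm_num at this

end CompactResolvent

end

end RDM

namespace RDM

noncomputable section

/-! ### Second-order bosonic Hamiltonians -/

section Quadratic

variable {n : ℕ}

variable (n) in
/-- The annihilation and creation operators of bosons. -/
def ladderOp : Fin n ⊕ Fin n → Module.End ℂ (PreFock Statistics.boson n) :=
  Sum.elim (annih _ n) (create _ n)

theorem inner_ladderOp (I : Fin n ⊕ Fin n) (φ ψ : PreFock Statistics.boson n) :
    inner ℂ (toFock (ladderOp n I φ)) (toFock ψ) =
      inner ℂ (toFock φ) (toFock (ladderOp n I.swap ψ)) := by
  cases I with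
  | inl i => exact inner_annih i φ ψ
  | inr i => exact inner_create i φ ψ

theorem exists_ladderOp_comm (I J : Fin n ⊕ Fin n) : ∃ e : ℂ, ∀ φ,
    ladderOp n I (ladderOp n J φ) = ladderOp n J (ladderOp n I φ) + e • φ := by
  cases I with
  | inl i =>
    cases J with
    | inl j => exact ⟨0, fun φ => by
        simpa [exchangeSign, ladderOp] using annih_annih_apply (s := Statistics.boson) i j φ⟩
    | inr j => exact ⟨if i = j then 1 else 0, fun φ => by
        have := annih_create_apply (s := Statistics.boson) i j φ
        simp only [exchangeSign, one_smul] at this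
        simp only [ladderOp, Sum.elim_inl, Sum.elim_inr, this]
        split_ifs <;> simp⟩
  | inr i =>
    cases J with
    | inl j => exact ⟨if j = i then -1 else 0, fun φ => by
        have := annih_create_apply (s := Statistics.boson) j i φ
        simp only [exchangeSign, one_smul] at this
        simp only [ladderOp, Sum.elim_inl, Sum.elim_inr, this]
        split_ifs <;> simp⟩
    | inr j => exact ⟨0, fun φ => by
        simpa [exchangeSign, ladderOp] using create_create_apply (s := Statistics.boson) i j φ⟩

/-- The normal form of the expectation value of an operator of second order. -/
structure NormalForm (A : Module.End ℂ (PreFock Statistics.boson n))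
    (M : Matrix (Fin n ⊕ Fin n) (Fin n ⊕ Fin n) ℂ) (l : Fin n ⊕ Fin n → ℂ) (c : ℂ) : Prop where
  symm : ∀ I J, M J.swap I.swap = M I J
  form_eq : ∀ φ, form A φ φ =
    ∑ I, ∑ J, M I J * inner ℂ (toFock (ladderOp n I φ)) (toFock (ladderOp n J φ)) +
    ∑ I, l I * inner ℂ (toFock φ) (toFock (ladderOp n I φ)) + c * (‖toFock φ‖ ^ 2 : ℝ)

/-- Moving the first of two ladder operators to the left side of the inner product produces a Gram
matrix. -/
theorem exists_normalForm {A : Module.End ℂ (PreFock Statistics.boson n)}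
    (hA : A ∈ ladderPoly Statistics.boson n 2) : ∃ M l c, NormalForm A M l c := by
  refine Submodule.span_induction (p := fun A _ => ∃ M l c, NormalForm A M l c) ?_ ?_ ?_ ?_ hA
  · rintro _ ⟨L, hL, rfl⟩
    match L, hL with
    | [], _ => exact ⟨0, 0, 1, fun _ _ => rfl, fun φ => by simp [form]⟩
    | [I], _ => exact ⟨0, Pi.single I 1, 0, fun _ _ => rfl, fun φ => by
        simp [form, ladderOp, Pi.single_apply]⟩
    | [I, J], _ =>
      obtain ⟨e, he⟩ := exists_ladderOp_comm I J
      -- Averaging the two orderings gives the symmetry under exchange of creation and annihilation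
      -- that `exists_real_vector` needs; the commutator adds `e / 2` to the constant.
      refine ⟨Matrix.of fun K L => 1 / 2 * ((if K = I.swap then 1 else 0) * (if L = J then 1 else 0)
        + (if K = J.swap then 1 else 0) * (if L = I then 1 else 0)), 0, e / 2, fun K L => ?_,
        fun φ => ?_⟩
      · simp only [Matrix.of_apply]
        have h1 : ∀ P Q : Fin n ⊕ Fin n, P.swap = Q.swap ↔ P = Q :=
          fun P Q => ⟨fun h => by simpa using congrArg Sum.swap h, fun h => by rw [h]⟩
        have h2 : ∀ P Q : Fin n ⊕ Fin n, P.swap = Q ↔ P = Q.swap :=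
          fun P Q => ⟨fun h => by simpa using congrArg Sum.swap h, fun h => by rw [h]; simp⟩
        simp only [h1, h2]
        ring
      · have h3 : ∀ K L : Fin n ⊕ Fin n, ∑ P, ∑ Q, (if P = K then (1 : ℂ) else 0) *
            (if Q = L then 1 else 0) * inner ℂ (toFock (ladderOp n P φ)) (toFock (ladderOp n Q φ)) =
            inner ℂ (toFock (ladderOp n K φ)) (toFock (ladderOp n L φ)) := fun K L => by
          simp only [mul_assoc, ← Finset.mul_sum]
          simp
        simp only [Matrix.of_apply, mul_assoc (1 / 2 : ℂ), ← Finset.mul_sum, add_mul,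
          Finset.sum_add_distrib, h3]
        have h4 : form ((([I, J] : List (Fin n ⊕ Fin n)).map
            (Sum.elim (annih Statistics.boson n) (create Statistics.boson n))).prod) φ φ =
            inner ℂ (toFock φ) (toFock (ladderOp n I (ladderOp n J φ))) := by
          simp [form, ladderOp]
        rw [h4, inner_ladderOp, inner_ladderOp, Sum.swap_swap, Sum.swap_swap, he, map_add,
          inner_add_right, map_smul, inner_smul_right, inner_self_eq_ofReal]
        simp
        ring
    | _ :: _ :: _ :: _, h => simp at h
  · exact ⟨0, 0, 0, fun _ _ => rfl, fun φ => by simp [form]⟩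
  · rintro A B - - ⟨M, l, c, h⟩ ⟨M', l', c', h'⟩
    refine ⟨M + M', l + l', c + c', fun I J => ?_, fun φ => ?_⟩
    · simp [h.symm, h'.symm]
    · have h1 : form (A + B) φ φ = form A φ φ + form B φ φ := by simp [form]
      rw [h1, h.form_eq, h'.form_eq]
      simp only [Matrix.add_apply, Pi.add_apply, add_mul, Finset.sum_add_distrib]
      ring
  · rintro a A - ⟨M, l, c, h⟩
    refine ⟨a • M, a • l, a * c, fun I J => ?_, fun φ => ?_⟩
    · simp [h.symm]
    · have h1 : form (a • A) φ φ = a * form A φ φ := by simp [form]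
      rw [h1, h.form_eq]
      simp only [Matrix.smul_apply, Pi.smul_apply, smul_eq_mul, mul_assoc, ← Finset.mul_sum]
      ring

/-- The hermitian part of the normal form of second order. -/
theorem NormalForm.exists_hermitian {A : Module.End ℂ (PreFock Statistics.boson n)}
    {M : Matrix (Fin n ⊕ Fin n) (Fin n ⊕ Fin n) ℂ} {l : Fin n ⊕ Fin n → ℂ} {c : ℂ}
    (h : NormalForm A M l c) : ∃ M' : Matrix (Fin n ⊕ Fin n) (Fin n ⊕ Fin n) ℂ,
      M'.IsHermitian ∧ (∀ I J, M' J.swap I.swap = M' I J) ∧ ∀ φ, quad A φ =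
        (∑ I, ∑ J, M' I J * inner ℂ (toFock (ladderOp n I φ)) (toFock (ladderOp n J φ))).re +
        (∑ I, l I * inner ℂ (toFock φ) (toFock (ladderOp n I φ))).re + c.re * ‖toFock φ‖ ^ 2 := by
  refine ⟨(1 / 2 : ℂ) • (M + M.conjTranspose), ?_, fun I J => ?_, fun φ => ?_⟩
  · ext I J
    simp [Matrix.conjTranspose_apply, add_comm, mul_add]
  · simp [Matrix.conjTranspose_apply, h.symm]
  · rw [quad, h.form_eq, Complex.add_re, Complex.add_re, Complex.re_mul_ofReal]
    congr 2
    have h1 : (∑ I, ∑ J, M.conjTranspose I J *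
        inner ℂ (toFock (ladderOp n I φ)) (toFock (ladderOp n J φ))).re =
        (∑ I, ∑ J, M I J * inner ℂ (toFock (ladderOp n I φ)) (toFock (ladderOp n J φ))).re := by
      rw [← Complex.conj_re]
      simp only [map_sum, map_mul, inner_conj_symm, Matrix.conjTranspose_apply, ← Complex.star_def,
        star_star]
      rw [Finset.sum_comm]
    have h2 : ∑ I, ∑ J, ((1 / 2 : ℂ) • (M + M.conjTranspose)) I J *
        inner ℂ (toFock (ladderOp n I φ)) (toFock (ladderOp n J φ)) = (1 / 2 : ℝ) *
        ((∑ I, ∑ J, M I J * inner ℂ (toFock (ladderOp n I φ)) (toFock (ladderOp n J φ))) +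
        ∑ I, ∑ J, M.conjTranspose I J *
        inner ℂ (toFock (ladderOp n I φ)) (toFock (ladderOp n J φ))) := by
      simp only [Matrix.smul_apply, Matrix.add_apply, smul_eq_mul, mul_assoc, ← Finset.mul_sum,
        add_mul, Finset.sum_add_distrib]
      push_cast
      ring
    rw [h2, Complex.re_ofReal_mul, Complex.add_re, h1]
    ring

/-- Positive definiteness leaves `ε ∑ ‖a_I φ‖²`. Half of it absorbs the linear term by completing
the square, the other half bounds the number operator. -/
theorem dominatesNumber_of_posDef {A : Module.End ℂ (PreFock Statistics.boson n)}
    {M : Matrix (Fin n ⊕ Fin n) (Fin n ⊕ Fin n) ℂ} {l : Fin n ⊕ Fin n → ℂ} {c : ℝ}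
    (hM : M.IsHermitian)
    (h : ∀ φ, quad A φ =
        (∑ I, ∑ J, M I J * inner ℂ (toFock (ladderOp n I φ)) (toFock (ladderOp n J φ))).re +
        (∑ I, l I * inner ℂ (toFock φ) (toFock (ladderOp n I φ))).re + c * ‖toFock φ‖ ^ 2)
    (hpos : ∀ u : Fin n ⊕ Fin n → ℂ, u ≠ 0 → 0 < (star u ⬝ᵥ M.mulVec u).re) :
    DominatesNumber A := by
  obtain ⟨ε, hε, hle⟩ := exists_le_re_dotProduct hpos
  have hpsd : (M - (ε : ℂ) • (1 : Matrix (Fin n ⊕ Fin n) (Fin n ⊕ Fin n) ℂ)).PosSemidef := by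
    have hh : (M - (ε : ℂ) • (1 : Matrix (Fin n ⊕ Fin n) (Fin n ⊕ Fin n) ℂ)).IsHermitian := by
      refine hM.sub ?_
      rw [Matrix.IsHermitian, Matrix.conjTranspose_smul, Matrix.conjTranspose_one]
      simp
    refine Matrix.PosSemidef.of_dotProduct_mulVec_nonneg hh fun u => ?_
    have h1 : star u ⬝ᵥ (M - (ε : ℂ) • (1 : Matrix (Fin n ⊕ Fin n) (Fin n ⊕ Fin n) ℂ)).mulVec u =
        star u ⬝ᵥ M.mulVec u - ((ε * ∑ I, ‖u I‖ ^ 2 : ℝ) : ℂ) := by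
      rw [Matrix.sub_mulVec, dotProduct_sub, Matrix.smul_mulVec, Matrix.one_mulVec, dotProduct_smul,
        smul_eq_mul, Complex.ofReal_mul, dotProduct]
      congr 2
      push_cast
      refine Finset.sum_congr rfl fun I _ => ?_
      rw [Pi.star_apply, Complex.star_def, ← Complex.normSq_eq_conj_mul_self,
        Complex.normSq_eq_norm_sq]
      push_cast; rfl
    have h2 := hh.im_star_dotProduct_mulVec_self u
    rw [Complex.nonneg_iff]
    refine ⟨?_, h2.symm⟩
    rw [h1, Complex.sub_re, Complex.ofReal_re]
    linarith [hle u]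
  set Λ := ∑ I, ‖l I‖ ^ 2
  refine ⟨2 / ε, by positivity, |c| + Λ / (2 * ε), fun φ => ?_⟩
  have h1 := re_sum_mul_inner_nonneg hpsd fun I => toFock (ladderOp n I φ)
  have h2 : ∑ I, ∑ J, (M - (ε : ℂ) • (1 : Matrix (Fin n ⊕ Fin n) (Fin n ⊕ Fin n) ℂ)) I J *
      inner ℂ (toFock (ladderOp n I φ)) (toFock (ladderOp n J φ)) =
      ∑ I, ∑ J, M I J * inner ℂ (toFock (ladderOp n I φ)) (toFock (ladderOp n J φ)) -
      ((ε * ∑ I, ‖toFock (ladderOp n I φ)‖ ^ 2 : ℝ) : ℂ) := by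
    simp only [Matrix.sub_apply, Matrix.smul_apply, Matrix.one_apply, smul_eq_mul, sub_mul,
      Finset.sum_sub_distrib, mul_ite, mul_one, mul_zero, ite_mul, zero_mul, Finset.sum_ite_eq,
      Finset.mem_univ, if_true, inner_self_eq_ofReal]
    push_cast
    rw [Finset.mul_sum]
  rw [h2, Complex.sub_re, Complex.ofReal_re] at h1
  have h3 : -(∑ I, l I * inner ℂ (toFock φ) (toFock (ladderOp n I φ))).re ≤
      ε / 2 * ∑ I, ‖toFock (ladderOp n I φ)‖ ^ 2 + Λ / (2 * ε) * ‖toFock φ‖ ^ 2 := by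
    rw [← Complex.neg_re, Finset.mul_sum, Finset.sum_div, Finset.sum_mul, ← Finset.sum_add_distrib]
    refine (Complex.re_le_norm _).trans ?_
    rw [norm_neg]
    refine (norm_sum_le _ _).trans (Finset.sum_le_sum fun I _ => ?_)
    rw [norm_mul]
    have h4 := norm_inner_le_norm (𝕜 := ℂ) (toFock φ) (toFock (ladderOp n I φ))
    refine (mul_le_mul_of_nonneg_left h4 (norm_nonneg _)).trans ?_
    have h5 : 0 ≤ (ε * ‖toFock (ladderOp n I φ)‖ - ‖l I‖ * ‖toFock φ‖) ^ 2 / (2 * ε) := by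
      positivity
    have h6 : (ε * ‖toFock (ladderOp n I φ)‖ - ‖l I‖ * ‖toFock φ‖) ^ 2 / (2 * ε) =
      ε / 2 * ‖toFock (ladderOp n I φ)‖ ^ 2 + ‖l I‖ ^ 2 / (2 * ε) * ‖toFock φ‖ ^ 2 -
        ‖l I‖ * (‖toFock φ‖ * ‖toFock (ladderOp n I φ)‖) := by
      field_simp; ring
    linarith
  have h7 : quad (numberOp _ n) φ ≤ ∑ I, ‖toFock (ladderOp n I φ)‖ ^ 2 := by
    rw [quad_numberOp, Fintype.sum_sum_type]
    refine le_add_of_le_of_nonneg le_rfl (Finset.sum_nonneg fun i _ => sq_nonneg _)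
  have h8 := mul_le_mul_of_nonneg_right (neg_abs_le c) (sq_nonneg ‖toFock φ‖)
  have h9 := h φ
  rw [div_mul_eq_mul_div, le_div_iff₀ hε]
  have h10 := mul_le_mul_of_nonneg_left h7 hε.le
  linarith

/-- Only vectors of the form `(z, z̄)` occur as amplitudes of states. By the symmetry of `M`, `u`
and its swapped conjugate `y` have the same form value, and the parallelogram law gives `q(u + y) +
q(i(u - y)) = 4 q(u)`, where both vectors are of the required form. -/
theorem exists_real_vector {M : Matrix (Fin n ⊕ Fin n) (Fin n ⊕ Fin n) ℂ}
    (hM : ∀ I J, M J.swap I.swap = M I J) {u : Fin n ⊕ Fin n → ℂ} (hu : u ≠ 0)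
    (hle : (star u ⬝ᵥ M.mulVec u).re ≤ 0) :
    ∃ x : Fin n ⊕ Fin n → ℂ, x ≠ 0 ∧ (∀ I, x I.swap = (starRingEnd ℂ) (x I)) ∧
      (star x ⬝ᵥ M.mulVec x).re ≤ 0 := by
  set y : Fin n ⊕ Fin n → ℂ := fun I => (starRingEnd ℂ) (u I.swap) with hy
  have hq : star y ⬝ᵥ M.mulVec y = star u ⬝ᵥ M.mulVec u := by
    simp only [dotProduct, Matrix.mulVec, Finset.mul_sum]
    rw [Finset.sum_comm]
    refine Fintype.sum_equiv (Equiv.sumComm _ _) _ _ fun J => ?_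
    refine Fintype.sum_equiv (Equiv.sumComm _ _) _ _ fun I => ?_
    simp only [hy, Pi.star_apply, Complex.star_def, Complex.conj_conj, Equiv.sumComm_apply,
      hM]
    ring
  have hpar : (star (u + y) ⬝ᵥ M.mulVec (u + y)).re +
      (star (Complex.I • (u - y)) ⬝ᵥ M.mulVec (Complex.I • (u - y))).re =
      4 * (star u ⬝ᵥ M.mulVec u).re := by
    have h1 : star (Complex.I • (u - y)) ⬝ᵥ M.mulVec (Complex.I • (u - y)) =
        star (u - y) ⬝ᵥ M.mulVec (u - y) := by
      rw [star_smul, Matrix.mulVec_smul, smul_dotProduct, dotProduct_smul, smul_smul]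
      simp
    rw [h1, ← Complex.add_re]
    have h2 : star (u + y) ⬝ᵥ M.mulVec (u + y) + star (u - y) ⬝ᵥ M.mulVec (u - y) =
        (4 : ℝ) * star u ⬝ᵥ M.mulVec u := by
      simp only [star_add, star_sub, Matrix.mulVec_add, Matrix.mulVec_sub, add_dotProduct,
        sub_dotProduct, dotProduct_add, dotProduct_sub, hq]
      push_cast
      ring
    rw [h2, Complex.re_ofReal_mul]
  have hr1 : ∀ I, (u + y) I.swap = (starRingEnd ℂ) ((u + y) I) := fun I => by
    simp [hy, add_comm]
  have hr2 : ∀ I, (Complex.I • (u - y)) I.swap = (starRingEnd ℂ) ((Complex.I • (u - y)) I) :=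
    fun I => by simp [hy]; ring
  by_cases h1 : u + y ≠ 0 ∧ (star (u + y) ⬝ᵥ M.mulVec (u + y)).re ≤ 0
  · exact ⟨_, h1.1, hr1, h1.2⟩
  · refine ⟨_, ?_, hr2, ?_⟩
    · intro h0
      have h3 : u - y = 0 := (smul_eq_zero.1 h0).resolve_left Complex.I_ne_zero
      rw [h0] at hpar
      have h4 : (star (u + y) ⬝ᵥ M.mulVec (u + y)).re ≤ 0 := by
        simp only [star_zero, zero_dotProduct, Complex.zero_re, add_zero] at hpar
        linarith
      refine h1 ⟨fun h5 => hu ?_, h4⟩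
      have h6 : (2 : ℂ) • u = 0 := by
        rw [two_smul]
        calc u + u = (u + y) + (u - y) := by abel
          _ = 0 := by rw [h5, h3, add_zero]
      exact (smul_eq_zero.1 h6).resolve_left two_ne_zero
    · rw [not_and_or, not_not, not_le] at h1
      rcases h1 with h1 | h1
      · rw [h1] at hpar
        simp at hpar
        simp
        linarith
      · linarith

/-- The window states imitate coherent states of growing amplitude but are mutually orthogonal.
Their Gram matrix of ladder operators is `κ x̄_I x_J` with `x = (z, z̄)`, up to a bounded error, and
their linear term is `σ l·x`, with `κ, σ ≥ 0`. The energy stays bounded above along an orthonormal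
sequence. -/
theorem not_partitionFinite_of_real_vector {β : ℝ} (hβ : 0 < β)
    {A : Module.End ℂ (PreFock Statistics.boson n)} (hA : IsHermitianOp A)
    {M : Matrix (Fin n ⊕ Fin n) (Fin n ⊕ Fin n) ℂ} {l : Fin n ⊕ Fin n → ℂ} {c : ℝ}
    (h : ∀ φ, quad A φ =
        (∑ I, ∑ J, M I J * inner ℂ (toFock (ladderOp n I φ)) (toFock (ladderOp n J φ))).re +
        (∑ I, l I * inner ℂ (toFock φ) (toFock (ladderOp n I φ))).re + c * ‖toFock φ‖ ^ 2)
    {z : Fin n → ℂ} (hz : star z ⬝ᵥ z = 1)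
    (hM : (star (Sum.elim z (star z)) ⬝ᵥ M.mulVec (Sum.elim z (star z))).re ≤ 0)
    (hl : (∑ I, l I * Sum.elim z (star z) I).re ≤ 0) : ¬ PartitionFinite β A := by
  intro hZ
  refine hZ.not_quad_le hβ hA (orthonormal_windowState hz)
    (∑ I, ∑ J, ‖M I J‖ * 5 + |c|) fun r => ?_
  set x : Fin n ⊕ Fin n → ℂ := Sum.elim z (star z) with hx
  set L := 2 ^ r with hLdef
  have hL : 0 < L := by positivity
  obtain ⟨m, hm⟩ : ∃ m, m + 2 = 2 * L := ⟨2 * L - 2, by omega⟩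
  set u := windowAmplitude L with hu
  set ψ := windowState z L with hψ
  have hψ' : ψ = modeVector z (m + 2) u := by rw [hψ, windowState, hm]
  have hz1 : ∀ i, ‖z i‖ ≤ 1 := by
    intro i
    have h1 : ((∑ i, ‖z i‖ ^ 2 : ℝ) : ℂ) = 1 := by
      rw [← hz, dotProduct]
      push_cast
      refine Finset.sum_congr rfl fun i _ => ?_
      rw [Pi.star_apply, Complex.star_def, ← Complex.normSq_eq_conj_mul_self,
        Complex.normSq_eq_norm_sq]
      push_cast; rfl
    have h2 : ∑ i, ‖z i‖ ^ 2 = 1 := by exact_mod_cast h1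
    have h3 := Finset.single_le_sum (f := fun i => ‖z i‖ ^ 2) (fun i _ => sq_nonneg _)
      (Finset.mem_univ i)
    rw [h2] at h3
    exact (sq_le_one_iff₀ (norm_nonneg _)).1 h3
  set Su : ℕ → ℝ := fun k => Real.sqrt (k + 1 : ℕ) * u (k + 1) with hSu
  set SSu : ℕ → ℝ := fun k => Real.sqrt (k + 1 : ℕ) * Su (k + 1) with hSSu
  set κ : ℝ := ∑ k ∈ Finset.range (m + 1), Su k * Su k with hκ
  set κ₂ : ℝ := ∑ k ∈ Finset.range m, SSu k * u k with hκ₂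
  set σ : ℝ := ∑ k ∈ Finset.range (m + 1), Su k * u k with hσ
  have hdiff : |κ₂ - κ| ≤ 4 := abs_sum_window_le hL hm
  have hκ0 : 0 ≤ κ := Finset.sum_nonneg fun k _ => mul_self_nonneg _
  have hσ0 : 0 ≤ σ := Finset.sum_nonneg fun k _ =>
    mul_nonneg (mul_nonneg (Real.sqrt_nonneg _) (windowAmplitude_nonneg _ _))
      (windowAmplitude_nonneg _ _)
  have ha : ∀ i, annih _ n i ψ = z i • modeVector z (m + 1) Su := fun i => by
    rw [hψ', annih_modeVector]
  have haa : ∀ i j, annih _ n i (annih _ n j ψ) = (z j * z i) • modeVector z m SSu := fun i j => by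
    rw [ha, map_smul, annih_modeVector, smul_smul]
  have h11 : ∀ i j, inner ℂ (toFock (annih _ n i ψ)) (toFock (annih _ n j ψ)) =
      κ * ((starRingEnd ℂ) (z i) * z j) := fun i j => by
    rw [ha, ha, map_smul, map_smul, inner_smul_left, inner_smul_right, inner_modeVector hz le_rfl]
    ring
  have hnorm : inner ℂ (toFock ψ) (toFock ψ) = (1 : ℂ) := by
    rw [inner_self_eq_ofReal, norm_windowState hz hL]; simp
  have h22 : ∀ i j, inner ℂ (toFock (create _ n i ψ)) (toFock (create _ n j ψ)) =
      κ * ((starRingEnd ℂ) (z j) * z i) + if i = j then 1 else 0 := fun i j => by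
    rw [inner_create, annih_create_apply, exchangeSign, one_smul, map_add, inner_add_right,
      ← inner_annih, h11]
    split_ifs
    · rw [hnorm]
    · simp
  have h12 : ∀ i j, inner ℂ (toFock (annih _ n i ψ)) (toFock (create _ n j ψ)) =
      κ₂ * ((starRingEnd ℂ) (z i) * (starRingEnd ℂ) (z j)) := fun i j => by
    rw [← inner_annih, haa, map_smul, inner_smul_left, hψ', inner_modeVector hz (by omega),
      map_mul]
    ring
  have h21 : ∀ i j, inner ℂ (toFock (create _ n i ψ)) (toFock (annih _ n j ψ)) =
      κ₂ * (z i * z j) := fun i j => by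
    rw [← inner_conj_symm, h12]
    simp [mul_comm]
  have hlin : ∀ I, inner ℂ (toFock ψ) (toFock (ladderOp n I ψ)) = σ * x I := by
    have h1 : ∀ i, inner ℂ (toFock (annih _ n i ψ)) (toFock ψ) =
        σ * (starRingEnd ℂ) (z i) := fun i => by
      rw [ha, map_smul, inner_smul_left, hψ', inner_modeVector hz (by omega)]
      ring
    rintro (i | i)
    · simp only [ladderOp, Sum.elim_inl, hx]
      rw [← inner_conj_symm, h1]
      simp
    · simp only [ladderOp, Sum.elim_inr, hx]
      rw [← inner_annih, h1]
      rfl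
  have hgram : ∀ I J, ‖inner ℂ (toFock (ladderOp n I ψ)) (toFock (ladderOp n J ψ)) -
      κ * (star (x I) * x J)‖ ≤ 5 := by
    have hb : ∀ a b : ℂ, ‖a‖ ≤ 1 → ‖b‖ ≤ 1 → ‖(κ₂ : ℂ) * (a * b) - κ * (a * b)‖ ≤ 5 := by
      intro a b h1 h2
      rw [← sub_mul, ← Complex.ofReal_sub, norm_mul, norm_mul, Complex.norm_real, Real.norm_eq_abs]
      calc |κ₂ - κ| * (‖a‖ * ‖b‖) ≤ 4 * (1 * 1) := by gcongr
        _ ≤ 5 := by norm_num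
    rintro (i | i) (j | j)
    · simp only [ladderOp, Sum.elim_inl, hx, h11]
      simp
    · simp only [ladderOp, Sum.elim_inl, Sum.elim_inr, hx, h12]
      exact hb _ _ (by simpa using hz1 i) (by simpa using hz1 j)
    · simp only [ladderOp, Sum.elim_inl, Sum.elim_inr, hx, h21, Pi.star_apply, star_star]
      exact hb _ _ (hz1 i) (hz1 j)
    · simp only [ladderOp, Sum.elim_inr, hx, h22, Pi.star_apply, star_star]
      rw [Complex.star_def, mul_comm (z i), add_sub_cancel_left]
      split_ifs <;> norm_num
  rw [h ψ, norm_windowState hz hL]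
  have e1 : (∑ I, l I * inner ℂ (toFock ψ) (toFock (ladderOp n I ψ))).re ≤ 0 := by
    have : ∑ I, l I * inner ℂ (toFock ψ) (toFock (ladderOp n I ψ)) = (σ : ℂ) * ∑ I, l I * x I := by
      rw [Finset.mul_sum]
      exact Finset.sum_congr rfl fun I _ => by rw [hlin]; ring
    rw [this, Complex.re_ofReal_mul]
    exact mul_nonpos_of_nonneg_of_nonpos hσ0 hl
  have e2 : (∑ I, ∑ J, M I J *
      inner ℂ (toFock (ladderOp n I ψ)) (toFock (ladderOp n J ψ))).re ≤
      ∑ I, ∑ J, ‖M I J‖ * 5 := by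
    have h1 : ∑ I, ∑ J, M I J * inner ℂ (toFock (ladderOp n I ψ)) (toFock (ladderOp n J ψ)) =
        (κ : ℂ) * (star x ⬝ᵥ M.mulVec x) + ∑ I, ∑ J, M I J *
        (inner ℂ (toFock (ladderOp n I ψ)) (toFock (ladderOp n J ψ)) -
          κ * (star (x I) * x J)) := by
      simp only [dotProduct, Matrix.mulVec, Finset.mul_sum, ← Finset.sum_add_distrib]
      refine Finset.sum_congr rfl fun I _ => Finset.sum_congr rfl fun J _ => ?_
      rw [Pi.star_apply]
      ring
    rw [h1, Complex.add_re, Complex.re_ofReal_mul]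
    refine add_le_of_nonpos_of_le (mul_nonpos_of_nonneg_of_nonpos hκ0 hM) ?_
    refine (Complex.re_le_norm _).trans ((norm_sum_le _ _).trans (Finset.sum_le_sum fun I _ =>
      (norm_sum_le _ _).trans (Finset.sum_le_sum fun J _ => ?_)))
    rw [norm_mul]
    exact mul_le_mul_of_nonneg_left (hgram I J) (norm_nonneg _)
  have e3 := le_abs_self c
  simp only [one_pow, mul_one]
  linarith

/-- An operator of second order with finite partition function dominates the number operator. -/
theorem PartitionFinite.dominatesNumber_of_quadratic {β : ℝ} (hβ : 0 < β)
    {A : Module.End ℂ (PreFock Statistics.boson n)} (hA : IsHermitianOp A)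
    (hA2 : A ∈ ladderPoly Statistics.boson n 2) (hZ : PartitionFinite β A) :
    DominatesNumber A := by
  obtain ⟨M₀, l, c₀, h₀⟩ := exists_normalForm hA2
  obtain ⟨M, hMh, hMs, h⟩ := h₀.exists_hermitian
  by_contra hnot
  have hex : ∃ u : Fin n ⊕ Fin n → ℂ, u ≠ 0 ∧ (star u ⬝ᵥ M.mulVec u).re ≤ 0 := by
    by_contra hno
    push Not at hno
    exact hnot (dominatesNumber_of_posDef hMh h hno)
  obtain ⟨u, hu, hule⟩ := hex
  obtain ⟨x, hx0, hxr, hxle⟩ := exists_real_vector hMs hu hule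
  set N := ∑ i, ‖x (Sum.inl i)‖ ^ 2 with hN
  have hNpos : 0 < N := by
    refine lt_of_le_of_ne (Finset.sum_nonneg fun i _ => sq_nonneg _) fun h0 => hx0 ?_
    have h1 := (Finset.sum_eq_zero_iff_of_nonneg fun i _ => sq_nonneg _).1 h0.symm
    have h2 : ∀ i, x (Sum.inl i) = 0 := fun i => by simpa using h1 i (Finset.mem_univ i)
    funext I
    rcases I with i | i
    · exact h2 i
    · have := hxr (Sum.inl i)
      rw [h2, map_zero] at this
      exact this
  -- The size of `t` normalises the mode. Its sign is free, as the quadratic part is even, and is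
  -- used to make the linear term nonpositive.
  obtain ⟨t, ht, htl⟩ : ∃ t : ℝ, t ^ 2 = N⁻¹ ∧ t * (∑ I, l I * x I).re ≤ 0 := by
    rcases le_total (∑ I, l I * x I).re 0 with h1 | h1
    · exact ⟨Real.sqrt N⁻¹, Real.sq_sqrt (inv_pos.2 hNpos).le,
        mul_nonpos_of_nonneg_of_nonpos (Real.sqrt_nonneg _) h1⟩
    · exact ⟨-Real.sqrt N⁻¹, by rw [neg_sq, Real.sq_sqrt (inv_pos.2 hNpos).le],
        mul_nonpos_of_nonpos_of_nonneg (neg_nonpos.2 (Real.sqrt_nonneg _)) h1⟩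
  set z : Fin n → ℂ := fun i => (t : ℂ) * x (Sum.inl i) with hz
  have hxz : Sum.elim z (star z) = (t : ℂ) • x := by
    funext I
    rcases I with i | i
    · rfl
    · have := hxr (Sum.inl i)
      simp only [Sum.swap_inl] at this
      simp [hz, this]
  refine not_partitionFinite_of_real_vector hβ hA h (z := z) ?_ ?_ ?_ hZ
  · have h1 : star z ⬝ᵥ z = ((t ^ 2 * N : ℝ) : ℂ) := by
      rw [hN, Finset.mul_sum, dotProduct]
      push_cast
      refine Finset.sum_congr rfl fun i _ => ?_
      have : ((‖x (Sum.inl i)‖ : ℂ)) ^ 2 = (starRingEnd ℂ) (x (Sum.inl i)) * x (Sum.inl i) := by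
        rw [← Complex.normSq_eq_conj_mul_self, Complex.normSq_eq_norm_sq]
        push_cast; rfl
      rw [this]
      simp only [hz, Pi.star_apply, Complex.star_def, map_mul, Complex.conj_ofReal]
      ring
    rw [h1, ht, inv_mul_cancel₀ hNpos.ne', Complex.ofReal_one]
  · rw [hxz]
    have h1 : star ((t : ℂ) • x) ⬝ᵥ M.mulVec ((t : ℂ) • x) =
        ((t ^ 2 : ℝ) : ℂ) * (star x ⬝ᵥ M.mulVec x) := by
      rw [star_smul, Matrix.mulVec_smul, smul_dotProduct, dotProduct_smul, smul_smul,
        Complex.star_def, Complex.conj_ofReal, smul_eq_mul, sq, Complex.ofReal_mul]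
    rw [h1, Complex.re_ofReal_mul]
    exact mul_nonpos_of_nonneg_of_nonpos (sq_nonneg t) hxle
  · rw [hxz]
    have h1 : ∑ I, l I * ((t : ℂ) • x) I = (t : ℂ) * ∑ I, l I * x I := by
      rw [Finset.mul_sum]
      exact Finset.sum_congr rfl fun I _ => by simp only [Pi.smul_apply, smul_eq_mul]; ring
    rw [h1, Complex.re_ofReal_mul]
    exact htl

end Quadratic

/-! ### Domination of the number operator for the Hamiltonians at hand -/

section Domination

variable {s : Statistics} {n : ℕ}

theorem potential_mem_ladderPoly (v : HermMat n) : potential s v ∈ ladderPoly s n 2 := by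
  refine Submodule.sum_mem _ fun i _ => Submodule.sum_mem _ fun j _ => Submodule.smul_mem _ _ ?_
  exact Submodule.subset_span ⟨[Sum.inr i, Sum.inl j], by simp, by simp⟩

theorem dominatesNumber_hamiltonian {m : ℕ} (hm : 0 < m) {H : Module.End ℂ (PreFock s n)}
    (hpos : s = Statistics.boson → IsCoercive m H) : DominatesNumber H := by
  cases s with
  | boson => exact (hpos rfl).dominatesNumber hm
  | fermion =>
    have := finite_occ_fermion (n := n)
    exact dominatesNumber_of_finite H

/-- Only for bosons with `m = 1` does membership in `finitePotentials` matter: there the potential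
competes with `H` at the same order. -/
theorem dominatesNumber_of_mem_finitePotentials {m : ℕ} (hm : 0 < m) {β : ℝ} (hβ : 0 < β)
    {H : Module.End ℂ (PreFock s n)} (hpoly : H ∈ ladderPoly s n (2 * m)) (hH : IsHermitianOp H)
    (hpos : s = Statistics.boson → IsCoercive m H) {v : HermMat n}
    (hv : v ∈ finitePotentials β H) : DominatesNumber (H + potential s v) := by
  cases s with
  | fermion =>
    have := finite_occ_fermion (n := n)
    exact dominatesNumber_of_finite _
  | boson =>
    rcases lt_or_ge m 2 with h | h
    · obtain rfl : m = 1 := by omega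
      exact PartitionFinite.dominatesNumber_of_quadratic hβ (hH.add (isHermitianOp_potential v))
        (Submodule.add_mem _ hpoly (potential_mem_ladderPoly v)) hv
    · exact (hpos rfl).dominatesNumber_add_potential h v

end Domination

end

end RDM

namespace RDM

noncomputable section

/-! ### Subgradients and differentiability of convex functions -/

section ConvexAnalysis

variable {E : Type*} [NormedAddCommGroup E] [NormedSpace ℝ E] [FiniteDimensional ℝ E]

/-- A subgradient of a function on a set. -/
def IsSubgradient (D : Set E) (F : E → ℝ) (x : E) (L : E →L[ℝ] ℝ) : Prop :=
  ∀ y ∈ D, F x + L (y - x) ≤ F y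

/-- A convex function has a subgradient at the interior points of its domain. -/
theorem exists_isSubgradient {D : Set E} {F : E → ℝ} (hF : ConvexOn ℝ D F) {x : E}
    (hx : x ∈ interior D) : ∃ L, IsSubgradient D F x L := by
  have hFi : ConvexOn ℝ (interior D) F := hF.subset interior_subset hF.1.interior
  have hcont : ContinuousOn F (interior D) := hFi.continuousOn isOpen_interior
  set U : Set (E × ℝ) := {p | p.1 ∈ interior D ∧ F p.1 < p.2} with hU
  have hUc : Convex ℝ U := hFi.convex_strict_epigraph
  have hUo : IsOpen U := by
    have h1 : ContinuousOn (fun p : E × ℝ => p.2 - F p.1) (Prod.fst ⁻¹' interior D) :=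
      continuousOn_snd.sub (hcont.comp continuousOn_fst fun p hp => hp)
    have h2 := h1.isOpen_inter_preimage (isOpen_interior.preimage continuous_fst)
      (isOpen_Ioi (a := (0 : ℝ)))
    convert h2 using 1
    ext p
    simp [hU]
  -- Separating `(x, F x)` from the open strict epigraph; openness uses continuity of `F` in the
  -- interior. The separating functional is not vertical because the point `(x, F x + 1)` lies in
  -- the epigraph.
  obtain ⟨f, hf⟩ := geometric_hahn_banach_open_point hUc hUo
    (show (x, F x) ∉ U from fun h => lt_irrefl _ h.2)
  have hsplit : ∀ (y : E) (t : ℝ), f (y, t) = f (y, 0) + t * f (0, 1) := fun y t => by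
    have : ((y, t) : E × ℝ) = (y, 0) + t • (0, 1) := by simp
    rw [this, map_add, map_smul, smul_eq_mul]
  have hneg : f (0, 1) < 0 := by
    have h1 := hf (x, F x + 1) ⟨hx, by simp⟩
    rw [hsplit, hsplit x (F x)] at h1
    linarith
  set c := -f (0, 1) with hc
  have hcpos : 0 < c := by linarith
  set L : E →L[ℝ] ℝ := c⁻¹ • f.comp (ContinuousLinearMap.inl ℝ E ℝ) with hL
  have hLf : ∀ y, L y = c⁻¹ * f (y, 0) := fun y => by simp [hL]
  have hint : ∀ y ∈ interior D, F x + L (y - x) ≤ F y := by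
    intro y hy
    refine le_of_forall_pos_le_add fun ε hε => ?_
    have h1 := hf (y, F y + ε) ⟨hy, by simpa using hε⟩
    rw [hsplit, hsplit x (F x)] at h1
    have h2 : f (y, 0) - f (x, 0) ≤ c * (F y + ε - F x) := by
      rw [hc]; linarith
    rw [map_sub, hLf, hLf, ← mul_sub]
    have h3 := mul_le_mul_of_nonneg_left h2 (inv_pos.2 hcpos).le
    rw [inv_mul_cancel_left₀ hcpos.ne'] at h3
    linarith
  refine ⟨L, fun y hy => ?_⟩
  -- A boundary point of `D` is reached through a point of the segment near `x`, where the
  -- inequality is known and convexity passes it on.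
  have hseg : ∃ ε : ℝ, 0 < ε ∧ ε < 1 ∧ x + ε • (y - x) ∈ interior D := by
    have h1 : Tendsto (fun ε : ℝ => x + ε • (y - x)) (𝓝[>] 0) (𝓝 x) := by
      have : Continuous fun ε : ℝ => x + ε • (y - x) := by fun_prop
      have h2 := this.tendsto 0
      rw [zero_smul, add_zero] at h2
      exact h2.mono_left nhdsWithin_le_nhds
    obtain ⟨ε, h3, h4⟩ := ((h1.eventually (isOpen_interior.mem_nhds hx)).and
      (Ioo_mem_nhdsGT (zero_lt_one' ℝ))).exists
    exact ⟨ε, h4.1, h4.2, h3⟩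
  obtain ⟨ε, h0, h1, h2⟩ := hseg
  have h3 := hint _ h2
  have h4 := hF.2 (interior_subset hx) hy (sub_nonneg.2 h1.le) h0.le (sub_add_cancel 1 ε)
  have h5 : (1 - ε) • x + ε • y = x + ε • (y - x) := by module
  rw [h5] at h4
  rw [add_sub_cancel_left, map_smul, smul_eq_mul] at h3
  simp only [smul_eq_mul] at h4
  refine le_of_mul_le_mul_left ?_ h0
  linarith

/-- A convex function with a unique subgradient is differentiable. -/
theorem hasFDerivAt_of_unique_subgradient {D : Set E} {F : E → ℝ} (hF : ConvexOn ℝ D F) {x : E}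
    (hx : x ∈ interior D) {L : E →L[ℝ] ℝ} (hL : IsSubgradient D F x L)
    (huniq : ∀ L', IsSubgradient D F x L' → L' = L) : HasFDerivAt F L x := by
  have hFi : ConvexOn ℝ (interior D) F := hF.subset interior_subset hF.1.interior
  have hcont : ContinuousOn F (interior D) := hFi.continuousOn isOpen_interior
  have hcx : ContinuousAt F x := hcont.continuousAt (isOpen_interior.mem_nhds hx)
  obtain ⟨r, hr, hball⟩ := Metric.nhds_basis_closedBall.mem_iff.1 (isOpen_interior.mem_nhds hx)
  obtain ⟨M, hM⟩ : ∃ M, ∀ y ∈ Metric.closedBall x r, |F y| ≤ M := by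
    obtain ⟨M, hM⟩ := ((isCompact_closedBall x r).image_of_continuousOn
      (hcont.mono hball)).isBounded.exists_norm_le
    exact ⟨M, fun y hy => hM _ ⟨y, hy, rfl⟩⟩
  choose! G hG using fun y (hy : y ∈ interior D) => exists_isSubgradient hF hy
  -- Subgradients near `x` are uniformly bounded because `F` is bounded on a larger ball.
  have hbound : ∀ y ∈ Metric.closedBall x (r / 2), ‖G y‖ ≤ 2 * M / (r / 2) := by
    intro y hy
    have hy' : y ∈ Metric.closedBall x r := Metric.closedBall_subset_closedBall (by linarith) hy
    have hM0 : 0 ≤ 2 * M := by linarith [(abs_nonneg _).trans (hM y hy')]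
    have hone : ∀ u : E, ‖u‖ ≤ r / 2 → G y u ≤ 2 * M := fun u hu => by
      have h1 : y + u ∈ Metric.closedBall x r := by
        rw [mem_closedBall_iff_norm] at hy ⊢
        calc ‖y + u - x‖ = ‖(y - x) + u‖ := by congr 1; abel
          _ ≤ ‖y - x‖ + ‖u‖ := norm_add_le _ _
          _ ≤ r := by linarith
      have h2 := hG y (hball hy') (y + u) (interior_subset (hball h1))
      rw [add_sub_cancel_left] at h2
      have h3 := (abs_le.1 (hM _ h1)).2
      have h4 := (abs_le.1 (hM _ hy')).1
      linarith
    have htwo : ∀ u : E, G y u ≤ 2 * M / (r / 2) * ‖u‖ := fun u => by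
      rcases eq_or_ne u 0 with rfl | hu
      · simp
      · have hu' := norm_pos_iff.2 hu
        have h1 := hone ((r / 2 / ‖u‖) • u) (by
          rw [norm_smul, norm_div, norm_norm, Real.norm_eq_abs, abs_of_pos (half_pos hr),
            div_mul_cancel₀ _ hu'.ne'])
        rw [map_smul, smul_eq_mul, div_mul_eq_mul_div, div_le_iff₀ hu'] at h1
        rw [div_mul_eq_mul_div, le_div_iff₀ (half_pos hr)]
        linarith
    refine ContinuousLinearMap.opNorm_le_bound _ (div_nonneg hM0 (half_pos hr).le) fun u => ?_
    rw [Real.norm_eq_abs, abs_le]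
    have h1 := htwo (-u)
    rw [map_neg, norm_neg] at h1
    exact ⟨by linarith, htwo u⟩
  -- Any limit of subgradients at points tending to `x` is a subgradient at `x`, hence `L`;
  -- compactness then gives convergence.
  have hlim : Tendsto G (𝓝 x) (𝓝 L) := by
    refine tendsto_of_subseq_tendsto fun y hy => ?_
    have hmem : ∀ᶠ k in atTop, y k ∈ Metric.closedBall x (r / 2) :=
      hy.eventually (Metric.closedBall_mem_nhds x (half_pos hr))
    obtain ⟨N, hN⟩ := eventually_atTop.1 hmem
    obtain ⟨L', -, θ, hθ, hlim⟩ := (isCompact_closedBall (0 : E →L[ℝ] ℝ)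
      (2 * M / (r / 2))).tendsto_subseq (x := fun k => G (y (k + N)))
      (fun k => mem_closedBall_zero_iff.2 (hbound _ (hN (k + N) (Nat.le_add_left N k))))
    have hsub : Tendsto (fun k => θ k + N) atTop atTop :=
      (tendsto_add_atTop_nat N).comp hθ.tendsto_atTop
    have hyk : Tendsto (fun k => y (θ k + N)) atTop (𝓝 x) := hy.comp hsub
    replace hlim : Tendsto (fun k => G (y (θ k + N))) atTop (𝓝 L') := hlim
    have hL' : L' = L := huniq L' fun w hw => by
      have h1 : Tendsto (fun k => F (y (θ k + N)) + G (y (θ k + N)) (w - y (θ k + N))) atTop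
          (𝓝 (F x + L' (w - x))) :=
        (hcx.tendsto.comp hyk).add ((isBoundedBilinearMap_apply.continuous.tendsto
          (L', w - x)).comp (hlim.prodMk_nhds (tendsto_const_nhds.sub hyk)))
      refine le_of_tendsto' h1 fun k => hG _ ?_ w hw
      exact hball (Metric.closedBall_subset_closedBall (by linarith)
        (hN _ (Nat.le_add_left N _)))
    exact ⟨fun k => θ k + N, by rw [← hL']; exact hlim⟩
  rw [hasFDerivAt_iff_isLittleO, Asymptotics.isLittleO_iff]
  intro c hc
  have h1 : ∀ᶠ y in 𝓝 x, ‖G y - L‖ ≤ c := by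
    have := (tendsto_iff_norm_sub_tendsto_zero.1 hlim).eventually_lt_const hc
    exact this.mono fun y hy => hy.le
  filter_upwards [h1, isOpen_interior.mem_nhds hx] with y hy hyD
  have h2 := hL y (interior_subset hyD)
  have h3 := hG y hyD x (interior_subset hx)
  -- The subgradient inequalities at `x` and at `y` squeeze `F y - F x - L (y - x)` between `0` and
  -- `(G y - L) (y - x)`.
  have h4 : (G y - L) (y - x) ≤ ‖G y - L‖ * ‖y - x‖ :=
    (le_abs_self _).trans ((G y - L).le_opNorm _)
  have h5 := mul_le_mul_of_nonneg_right hy (norm_nonneg (y - x))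
  rw [← neg_sub y x, map_neg] at h3
  rw [_root_.sub_apply] at h4
  rw [Real.norm_eq_abs, abs_of_nonneg (by linarith)]
  linarith

end ConvexAnalysis

end

end RDM

namespace RDM

noncomputable section

/-! ### Separation and interiors of convex sets -/

section ConvexSets

variable {E : Type*} [NormedAddCommGroup E] [NormedSpace ℝ E]

theorem exists_separation {D : Set E} (hD : Convex ℝ D) {x : E} (hx : x ∉ closure D) :
    ∃ L : E →L[ℝ] ℝ, ∃ u, L x < u ∧ ∀ y ∈ D, u < L y := by
  obtain ⟨L, u, h1, h2⟩ := geometric_hahn_banach_point_closed hD.closure isClosed_closure hx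
  exact ⟨L, u, h1, fun y hy => h2 y (subset_closure hy)⟩

/-- If the closure has an interior point, the affine span of `D`, being closed, is the whole space.
So the convex set `D` itself has nonempty interior, and then it has the same interior as its
closure. -/
theorem interior_closure_subset [FiniteDimensional ℝ E] {D : Set E} (hD : Convex ℝ D) :
    interior (closure D) ⊆ interior D := by
  intro x hx
  have h1 : (interior (convexHull ℝ D)).Nonempty := by
    rw [interior_convexHull_nonempty_iff_affineSpan_eq_top]
    have h2 : closure D ⊆ affineSpan ℝ D :=
      closure_minimal (subset_affineSpan ℝ D) (AffineSubspace.closed_of_finiteDimensional _)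
    have h3 : (interior (affineSpan ℝ D : Set E)).Nonempty := ⟨x, interior_mono h2 hx⟩
    have h4 := (affineSpan ℝ D).convex.interior_nonempty_iff_affineSpan_eq_top.1 h3
    rwa [AffineSubspace.affineSpan_coe] at h4
  rw [hD.convexHull_eq] at h1
  rwa [hD.interior_closure_eq_interior_of_nonempty_interior h1] at hx

end ConvexSets

/-! ### Hermitian matrices: norm, trace pairing, spectral decomposition -/

section HermitianMatrices

variable {n : ℕ}

instance : FiniteDimensional ℝ (HermMat n) :=
  (inferInstance :
    FiniteDimensional ℝ (selfAdjoint.submodule ℝ (Matrix (Fin n) (Fin n) ℂ)))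

variable (n) in
/-- The sup norm on hermitian matrices. -/
abbrev hermMatNorm : NormedAddCommGroup (HermMat n) :=
  letI := Matrix.normedAddCommGroup (m := Fin n) (n := Fin n) (α := ℂ)
  inferInstance

variable (n) in
/-- The real normed space of hermitian matrices. -/
abbrev hermMatNormedSpace : @NormedSpace ℝ (HermMat n) _
    (hermMatNorm n).toSeminormedAddCommGroup :=
  letI := Matrix.normedAddCommGroup (m := Fin n) (n := Fin n) (α := ℂ)
  letI : NormedSpace ℝ (Matrix (Fin n) (Fin n) ℂ) := Matrix.normedSpace
  letI : NormedAddCommGroup (HermMat n) := hermMatNorm n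
  { norm_smul_le := fun c x => norm_smul_le c (x : Matrix (Fin n) (Fin n) ℂ) }

/-- The norm is supplied explicitly, so that the statement involves only the topology of `HermMat
n`. -/
theorem exists_subgradient_hermMat {D : Set (HermMat n)} {F : HermMat n → ℝ}
    (hF : ConvexOn ℝ D F) {x : HermMat n} (hx : x ∈ interior D) :
    ∃ L : HermMat n →L[ℝ] ℝ, ∀ y ∈ D, F x + L (y - x) ≤ F y :=
  @exists_isSubgradient (HermMat n) (hermMatNorm n) (hermMatNormedSpace n) _ D F hF x hx

theorem hasFDerivAt_hermMat {D : Set (HermMat n)} {F : HermMat n → ℝ}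
    (hF : ConvexOn ℝ D F) {x : HermMat n} (hx : x ∈ interior D) {L : HermMat n →L[ℝ] ℝ}
    (hL : ∀ y ∈ D, F x + L (y - x) ≤ F y)
    (huniq : ∀ L' : HermMat n →L[ℝ] ℝ, (∀ y ∈ D, F x + L' (y - x) ≤ F y) → L' = L) :
    HasFDerivAt F L x :=
  @hasFDerivAt_of_unique_subgradient (HermMat n) (hermMatNorm n) (hermMatNormedSpace n) _ D F hF x
    hx L hL huniq

theorem exists_separation_hermMat {D : Set (HermMat n)} (hD : Convex ℝ D) {x : HermMat n}
    (hx : x ∉ closure D) :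
    ∃ L : HermMat n →L[ℝ] ℝ, ∃ u, L x < u ∧ ∀ y ∈ D, u < L y :=
  @exists_separation (HermMat n) (hermMatNorm n) (hermMatNormedSpace n) D hD x hx

theorem interior_closure_subset_hermMat {D : Set (HermMat n)} (hD : Convex ℝ D) :
    interior (closure D) ⊆ interior D :=
  @interior_closure_subset (HermMat n) (hermMatNorm n) (hermMatNormedSpace n) _ D hD

theorem tracePairing_self (v : HermMat n) : tracePairing v v =
    ∑ i, ∑ j, ‖(v : Matrix (Fin n) (Fin n) ℂ) i j‖ ^ 2 := by
  have hv : (v : Matrix (Fin n) (Fin n) ℂ).IsHermitian := v.2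
  simp only [tracePairing, ContinuousLinearMap.coe_mk', LinearMap.coe_mk, AddHom.coe_mk,
    Matrix.trace, Matrix.diag, Matrix.mul_apply, Complex.re_sum]
  refine Finset.sum_congr rfl fun i _ => Finset.sum_congr rfl fun j _ => ?_
  rw [← hv.apply i j, Complex.star_def, ← Complex.normSq_eq_conj_mul_self,
    Complex.ofReal_re, Complex.normSq_eq_norm_sq]
  simp

theorem tracePairing_sub (v v' : HermMat n) :
    tracePairing (v - v') = tracePairing v - tracePairing v' := by
  ext γ
  simp [tracePairing, sub_mul, Matrix.trace_sub]

theorem tracePairing_injective : Function.Injective (tracePairing (n := n)) := by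
  intro v v' h
  rw [← sub_eq_zero]
  have h1 : tracePairing (v - v') (v - v') = 0 := by
    rw [tracePairing_sub, h, sub_self]; rfl
  rw [tracePairing_self] at h1
  apply Subtype.ext
  ext i j
  have h2 := (Finset.sum_eq_zero_iff_of_nonneg fun i _ =>
    Finset.sum_nonneg fun j _ => sq_nonneg _).1 h1 i (Finset.mem_univ i)
  have h3 := (Finset.sum_eq_zero_iff_of_nonneg fun j _ => sq_nonneg _).1 h2 j (Finset.mem_univ j)
  simpa using h3

/-- Every linear functional is a trace pairing. -/
theorem exists_tracePairing_eq (L : HermMat n →L[ℝ] ℝ) : ∃ v, tracePairing v = L := by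
  let T : HermMat n →ₗ[ℝ] Module.Dual ℝ (HermMat n) :=
    { toFun := fun v => (tracePairing v).toLinearMap
      map_add' := fun v v' => by
        ext γ
        simp [tracePairing, add_mul, Matrix.trace_add]
      map_smul' := fun c v => by
        ext γ
        simp [tracePairing, Matrix.trace_smul] }
  have hT : Function.Injective T := fun v v' h =>
    tracePairing_injective (ContinuousLinearMap.coe_injective h)
  obtain ⟨v, hv⟩ := (LinearMap.injective_iff_surjective_of_finrank_eq_finrank
    (Subspace.dual_finrank_eq (K := ℝ) (V := HermMat n)).symm).1 hT L.toLinearMap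
  exact ⟨v, ContinuousLinearMap.coe_injective hv⟩

/-- The spectral decomposition of a hermitian matrix. -/
theorem exists_eigenvectors {v : Matrix (Fin n) (Fin n) ℂ} (hv : v.IsHermitian) :
    ∃ (l : Fin n → ℝ) (u : Fin n → Fin n → ℂ),
      (∀ α β, star (u α) ⬝ᵥ u β = if α = β then 1 else 0) ∧
      ∀ i j, v i j = ∑ α, (l α : ℂ) * (u α i * (starRingEnd ℂ) (u α j)) := by
  set U := (hv.eigenvectorUnitary : Matrix (Fin n) (Fin n) ℂ) with hU
  refine ⟨hv.eigenvalues, fun α i => U i α, fun α β => ?_, fun i j => ?_⟩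
  · have h1 : star U * U = 1 := Unitary.coe_star_mul_self hv.eigenvectorUnitary
    have h2 := congrFun (congrFun h1 α) β
    rw [Matrix.mul_apply, Matrix.one_apply] at h2
    exact h2
  · have h1 := hv.spectral_theorem
    have h2 := congrFun (congrFun h1 i) j
    rw [h2]
    simp [Unitary.conjStarAlgAut_apply, Matrix.mul_apply, Matrix.diagonal_apply, hU,
      Matrix.star_apply]
    exact Finset.sum_congr rfl fun α _ => by ring

end HermitianMatrices

end

end RDM

namespace RDM

noncomputable section

/-! ### Convexity of the functional and the bosonic support function -/

section Domain

variable {s : Statistics} {n : ℕ}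

/-- The domain of the universal functional. -/
def functionalDomain (β : ℝ) (H : Module.End ℂ (PreFock s n)) : Set (HermMat n) :=
  {γ | (grandPotentialValues β H γ).Nonempty}

theorem bddBelow_grandPotentialValues {β : ℝ} (hβ : 0 < β) {H : Module.End ℂ (PreFock s n)}
    (hN : DominatesNumber H) (γ : HermMat n) : BddBelow (grandPotentialValues β H γ) := by
  obtain ⟨B, hB⟩ := exists_le_grandPotential hβ hN
  exact ⟨B, fun ω ⟨ρ, hρ, _, hω⟩ => hB ρ hρ ω hω⟩

theorem universalFunctional_eq {β : ℝ} (hβ : 0 < β) {H : Module.End ℂ (PreFock s n)}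
    (hN : DominatesNumber H) {γ : HermMat n} (hγ : γ ∈ functionalDomain β H) :
    universalFunctional β H γ = ((sInf (grandPotentialValues β H γ) : ℝ) : EReal) := by
  have hb := bddBelow_grandPotentialValues hβ hN γ
  refine le_antisymm ?_ (le_sInf ?_)
  · refine EReal.le_of_forall_lt_iff_le.1 fun y hy => ?_
    obtain ⟨ω, hω, hlt⟩ := exists_lt_of_csInf_lt hγ (EReal.coe_lt_coe_iff.1 hy)
    exact (sInf_le (Set.mem_image_of_mem _ hω)).trans (EReal.coe_le_coe_iff.2 hlt.le)
  · rintro _ ⟨ω, hω, rfl⟩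
    exact EReal.coe_le_coe_iff.2 (csInf_le hb hω)

theorem mix_mem_grandPotentialValues {β : ℝ} (hβ : 0 < β) {H : Module.End ℂ (PreFock s n)}
    (hH : IsHermitianOp H) (hN : DominatesNumber H) {γ₁ γ₂ : HermMat n} {ω₁ ω₂ : ℝ}
    (h₁ : ω₁ ∈ grandPotentialValues β H γ₁) (h₂ : ω₂ ∈ grandPotentialValues β H γ₂)
    {c : ℝ} (hc0 : 0 < c) (hc1 : c < 1) :
    ∃ ω ∈ grandPotentialValues β H ((1 - c) • γ₁ + c • γ₂), ω ≤ (1 - c) * ω₁ + c * ω₂ := by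
  obtain ⟨ρ₁, hρ₁, hγ₁, hω₁⟩ := h₁
  obtain ⟨ρ₂, hρ₂, hγ₂, hω₂⟩ := h₂
  obtain ⟨ω, hle, hω⟩ := hω₁.mix hβ hH hN hρ₁ hρ₂ hω₂ hc0 hc1
  exact ⟨ω, ⟨_, hρ₁.mix hρ₂ hc0.le hc1.le, hγ₁.mix hγ₂ c, hω⟩, hle⟩

/-- The universal functional is convex. -/
theorem convexOn_sInf_grandPotentialValues {β : ℝ} (hβ : 0 < β)
    {H : Module.End ℂ (PreFock s n)} (hH : IsHermitianOp H) (hN : DominatesNumber H) :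
    ConvexOn ℝ (functionalDomain β H) fun γ => sInf (grandPotentialValues β H γ) := by
  have hb := bddBelow_grandPotentialValues hβ hN
  rw [convexOn_iff_forall_pos]
  have key : ∀ a c : ℝ, 0 < a → 0 < c → a + c = 1 → a = 1 - c ∧ c < 1 :=
    fun a c ha hc h => ⟨by linarith, by linarith⟩
  refine ⟨convex_iff_forall_pos.2 ?_, ?_⟩
  · rintro γ₁ ⟨ω₁, h₁⟩ γ₂ ⟨ω₂, h₂⟩ a c ha hc hac
    obtain ⟨rfl, hc1⟩ := key a c ha hc hac
    obtain ⟨ω, hω, -⟩ := mix_mem_grandPotentialValues hβ hH hN h₁ h₂ hc hc1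
    exact ⟨ω, hω⟩
  · intro γ₁ h₁ γ₂ h₂ a c ha hc hac
    obtain ⟨rfl, hc1⟩ := key a c ha hc hac
    refine le_of_forall_pos_le_add fun ε hε => ?_
    obtain ⟨ω₁, hω₁, hl₁⟩ := Real.lt_sInf_add_pos h₁ hε
    obtain ⟨ω₂, hω₂, hl₂⟩ := Real.lt_sInf_add_pos h₂ hε
    obtain ⟨ω, hω, hle⟩ := mix_mem_grandPotentialValues hβ hH hN hω₁ hω₂ hc hc1
    have h3 := csInf_le (hb _) hω
    have h4 := mul_le_mul_of_nonneg_left hl₁.le ha.le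
    have h5 := mul_le_mul_of_nonneg_left hl₂.le hc.le
    simp only [smul_eq_mul]
    linarith

theorem vectorRDM_mem_functionalDomain {β : ℝ} {H : Module.End ℂ (PreFock s n)}
    (hH : IsHermitianOp H) (hN : DominatesNumber H) {φ : PreFock s n} (hφ : ‖toFock φ‖ = 1) :
    vectorRDM s ((numberSpace s n).emb φ) ∈ functionalDomain β H := by
  obtain ⟨E, -, hE⟩ := exists_hasEnergy_pure hH hN.isBoundedBelow hφ
  obtain ⟨b, w, e, S, d⟩ := hE.exists_grandPotential (β := β) hN (isDensityOp_pure hφ)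
  exact ⟨_, _, isDensityOp_pure hφ, hasOneRDM_pure φ, d.hasGrandPotential⟩

theorem tracePairing_eq_sum (v γ : HermMat n) : tracePairing v γ =
    (∑ i, ∑ j, (v : Matrix (Fin n) (Fin n) ℂ) i j * (γ : Matrix (Fin n) (Fin n) ℂ) j i).re := by
  simp [tracePairing, Matrix.trace, Matrix.mul_apply]

theorem tracePairing_nonneg {v γ : HermMat n}
    (hv : (v : Matrix (Fin n) (Fin n) ℂ).PosSemidef)
    (hγ : (γ : Matrix (Fin n) (Fin n) ℂ).PosSemidef) : 0 ≤ tracePairing v γ := by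
  open scoped MatrixOrder in
  obtain ⟨B, hB⟩ := (CStarAlgebra.nonneg_iff_eq_star_mul_self).1 hγ.nonneg
  have h := re_sum_mul_inner_nonneg hv fun i : Fin n =>
    (WithLp.toLp 2 fun k => (starRingEnd ℂ) (B k i) : EuclideanSpace ℂ (Fin n))
  rw [tracePairing_eq_sum, hB]
  convert h using 6 with i _ j _
  rw [Matrix.mul_apply, PiLp.inner_apply]
  refine Finset.sum_congr rfl fun k _ => ?_
  simp [Matrix.star_apply, mul_comm]

/-- A lower bound of a trace pairing on the one-body reduced density matrices of vectors is a lower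
bound on all representable ones, for bosons. -/
theorem le_tracePairing_boson {v : HermMat n} {c : ℝ}
    (h : ∀ φ : PreFock Statistics.boson n, ‖toFock φ‖ = 1 → c ≤ quad (potential _ v) φ)
    {γ : HermMat n} (hγ : γ ∈ NRep Statistics.boson n) : c ≤ tracePairing v γ := by
  have hc : c ≤ 0 := by
    have h1 := h (vacuum _ _) norm_vacuum
    rw [quad_potential] at h1
    simpa using h1
  have hvh : (v : Matrix (Fin n) (Fin n) ℂ).IsHermitian := v.2
  have hunit : ∀ z : Fin n → ℂ, star z ⬝ᵥ z = 1 →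
      0 ≤ (star z ⬝ᵥ (v : Matrix (Fin n) (Fin n) ℂ).mulVec z).re := by
    intro z hz
    by_contra! hneg
    set q := (star z ⬝ᵥ (v : Matrix (Fin n) (Fin n) ℂ).mulVec z).re with hq
    -- If `q < 0`, then `k` bosons in the mode `z` have one-body energy `k * q`, which eventually
    -- violates the lower bound. Hence `v ≥ 0`, and the vacuum supplies `c ≤ 0`.
    obtain ⟨k, hk⟩ := exists_nat_gt (c / q)
    have hnorm : ∀ k, ‖toFock (modeState z k)‖ = 1 := fun k => by
      have h1 := inner_modeState hz k k
      rw [if_pos rfl, inner_self_eq_ofReal] at h1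
      have h2 : ‖toFock (modeState z k)‖ ^ 2 = 1 := by exact_mod_cast h1
      exact (pow_eq_one_iff_of_nonneg (norm_nonneg _) two_ne_zero).1 h2
    have h1 := h _ (hnorm (k + 1))
    have h2 : quad (potential _ v) (modeState z (k + 1)) = (k + 1 : ℕ) * q := by
      have h3 : ∀ i j, inner ℂ (toFock (annih _ n i (modeState z (k + 1))))
          (toFock (annih _ n j (modeState z (k + 1)))) =
          ((k + 1 : ℕ) : ℂ) * ((starRingEnd ℂ) (z i) * z j) := fun i j => by
        rw [annih_modeState, annih_modeState, map_smul, map_smul, inner_smul_left,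
          inner_smul_right, inner_modeState hz, if_pos rfl, ← sqrt_mul_sqrt_cast (k + 1), map_mul,
          Complex.conj_ofReal]
        ring
      have h4 : ∑ i, ∑ j, (v : Matrix (Fin n) (Fin n) ℂ) i j *
          inner ℂ (toFock (annih _ n i (modeState z (k + 1))))
            (toFock (annih _ n j (modeState z (k + 1)))) =
          (((k + 1 : ℕ) : ℝ) : ℂ) * (star z ⬝ᵥ (v : Matrix (Fin n) (Fin n) ℂ).mulVec z) := by
        simp only [h3, dotProduct, Matrix.mulVec, Finset.mul_sum]
        refine Finset.sum_congr rfl fun i _ => Finset.sum_congr rfl fun j _ => ?_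
        simp only [Pi.star_apply, Complex.star_def, Complex.ofReal_natCast]
        ring
      rw [quad_potential, h4, Complex.re_ofReal_mul]
    rw [h2] at h1
    rw [div_lt_iff_of_neg hneg] at hk
    push_cast at h1
    nlinarith
  have hpsd : (v : Matrix (Fin n) (Fin n) ℂ).PosSemidef := by
    refine Matrix.PosSemidef.of_dotProduct_mulVec_nonneg hvh fun u => ?_
    rw [Complex.nonneg_iff]
    refine ⟨?_, (hvh.im_star_dotProduct_mulVec_self u).symm⟩
    by_cases hu : u = 0
    · simp [hu]
    have hr : star u ⬝ᵥ u = ((∑ i, ‖u i‖ ^ 2 : ℝ) : ℂ) := by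
      simp [dotProduct, Complex.conj_mul']
    have hpos : 0 < ∑ i, ‖u i‖ ^ 2 := by
      obtain ⟨i, hi⟩ := Function.ne_iff.1 hu
      exact Finset.sum_pos' (fun _ _ => sq_nonneg _)
        ⟨i, Finset.mem_univ i, pow_pos (norm_pos_iff.2 hi) 2⟩
    set r := ∑ i, ‖u i‖ ^ 2
    have hc2 : (((Real.sqrt r)⁻¹ : ℝ) : ℂ) * (((Real.sqrt r)⁻¹ : ℝ) : ℂ) = ((r⁻¹ : ℝ) : ℂ) := by
      rw [← Complex.ofReal_mul, ← mul_inv, Real.mul_self_sqrt hpos.le]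
    have hstar : star ((((Real.sqrt r)⁻¹ : ℝ) : ℂ) • u) = (((Real.sqrt r)⁻¹ : ℝ) : ℂ) • star u := by
      rw [star_smul, Complex.star_def, Complex.conj_ofReal]
    have h1 := hunit ((((Real.sqrt r)⁻¹ : ℝ) : ℂ) • u) (by
      rw [hstar, smul_dotProduct, dotProduct_smul, smul_smul, hc2, hr, smul_eq_mul,
        ← Complex.ofReal_mul, inv_mul_cancel₀ hpos.ne', Complex.ofReal_one])
    rw [hstar, Matrix.mulVec_smul, smul_dotProduct, dotProduct_smul, smul_smul, hc2, smul_eq_mul,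
      Complex.re_ofReal_mul] at h1
    exact (mul_nonneg_iff_of_pos_left (inv_pos.2 hpos)).1 h1
  exact hc.trans (tracePairing_nonneg hpsd hγ.1)

end Domain

end

end RDM

namespace RDM

noncomputable section

/-! ### The fermionic support function -/

section Fermions

variable {n : ℕ}

/-- The identity `1 - γ = (1 - γ)² + (γ - γ²)` exhibits a sum of positive matrices. -/
theorem posSemidef_one_sub {γ : HermMat n} (hγ : γ ∈ NRep Statistics.fermion n) :
    (1 - (γ : Matrix (Fin n) (Fin n) ℂ)).PosSemidef := by
  have hh : (γ : Matrix (Fin n) (Fin n) ℂ).IsHermitian := γ.2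
  have h1 := Matrix.posSemidef_conjTranspose_mul_self (1 - (γ : Matrix (Fin n) (Fin n) ℂ))
  have h2 := h1.add (hγ.2 rfl)
  rw [Matrix.conjTranspose_sub, Matrix.conjTranspose_one, hh.eq] at h2
  convert h2 using 1
  noncomm_ring

/-- The identity `M - M² = M (1 - M) M + (1 - M) M (1 - M)` does it. -/
theorem posSemidef_sub_sq {M : Matrix (Fin n) (Fin n) ℂ} (h0 : M.PosSemidef)
    (h1 : (1 - M).PosSemidef) : (M - M ^ 2).PosSemidef := by
  have h2 := h1.conjTranspose_mul_mul_same M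
  have h3 := h0.conjTranspose_mul_mul_same (1 - M)
  rw [h0.1.eq] at h2
  rw [h1.1.eq] at h3
  convert h2.add h3 using 1
  noncomm_ring

/-- Each `d α` squares to zero, so a vector not killed by it may be replaced by its image;
anticommutation keeps the operators already treated. This yields a Slater determinant without
writing one down. -/
theorem exists_ne_zero_forall_apply_eq_zero {ι V : Type*} [AddCommGroup V] [Module ℂ V]
    [Nontrivial V] {d : ι → Module.End ℂ V} (hd : ∀ α β φ, d α (d β φ) = -d β (d α φ))
    (T : Finset ι) : ∃ φ : V, φ ≠ 0 ∧ ∀ α ∈ T, d α φ = 0 := by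
  classical
  induction T using Finset.induction_on with
  | empty => simpa using exists_ne (0 : V)
  | insert a T _ ih =>
    obtain ⟨φ, hφ, h⟩ := ih
    by_cases h0 : d a φ = 0
    · exact ⟨φ, hφ, fun α hα => by
        rcases Finset.mem_insert.1 hα with rfl | hα
        exacts [h0, h α hα]⟩
    · refine ⟨d a φ, h0, fun α hα => ?_⟩
      rcases Finset.mem_insert.1 hα with rfl | hα
      · have h2 : (2 : ℂ) • d α (d α φ) = 0 := by
          rw [two_smul]
          nth_rewrite 1 [hd α α φ]
          exact neg_add_cancel _
        exact (smul_eq_zero.1 h2).resolve_left two_ne_zero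
      · rw [hd, h α hα, map_zero, neg_zero]

theorem norm_annihMode_sq_add_norm_createMode_sq (z : Fin n → ℂ)
    (φ : PreFock Statistics.fermion n) :
    ‖toFock (annihMode _ z φ)‖ ^ 2 + ‖toFock (createMode _ z φ)‖ ^ 2 =
      (star z ⬝ᵥ z).re * ‖toFock φ‖ ^ 2 := by
  have h1 : inner ℂ (toFock (annihMode _ z φ)) (toFock (annihMode _ z φ)) +
      inner ℂ (toFock (createMode _ z φ)) (toFock (createMode _ z φ)) =
      (star z ⬝ᵥ z) * inner ℂ (toFock φ) (toFock φ) := by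
    rw [inner_annihMode, inner_createMode, annihMode_createMode, exchangeSign, map_add, map_smul,
      map_smul, inner_add_right, inner_smul_right, inner_smul_right]
    ring
  rw [inner_self_eq_ofReal, inner_self_eq_ofReal, inner_self_eq_ofReal] at h1
  have h2 := congrArg Complex.re h1
  rwa [Complex.add_re, Complex.ofReal_re, Complex.ofReal_re, Complex.re_mul_ofReal] at h2

theorem quad_potential_eq_sum_eigen {s : Statistics} {v : HermMat n} {l : Fin n → ℝ}
    {u : Fin n → Fin n → ℂ} (hv : ∀ i j, (v : Matrix (Fin n) (Fin n) ℂ) i j =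
      ∑ α, (l α : ℂ) * (u α i * (starRingEnd ℂ) (u α j))) (φ : PreFock s n) :
    quad (potential s v) φ = ∑ α, l α * ‖toFock (annihMode s (u α) φ)‖ ^ 2 := by
  have h1 : ∀ α, (((‖toFock (annihMode s (u α) φ)‖ ^ 2 : ℝ)) : ℂ) = ∑ i, ∑ j,
      (u α i * (starRingEnd ℂ) (u α j)) *
        inner ℂ (toFock (annih s n i φ)) (toFock (annih s n j φ)) := fun α => by
    rw [← inner_self_eq_ofReal, annihMode_apply, map_sum, sum_inner]
    refine Finset.sum_congr rfl fun i _ => ?_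
    rw [inner_sum]
    refine Finset.sum_congr rfl fun j _ => ?_
    rw [map_smul, map_smul, inner_smul_left, inner_smul_right, Complex.conj_conj]
    ring
  have h2 : ∑ i, ∑ j, (v : Matrix (Fin n) (Fin n) ℂ) i j *
      inner ℂ (toFock (annih s n i φ)) (toFock (annih s n j φ)) =
      ((∑ α, l α * ‖toFock (annihMode s (u α) φ)‖ ^ 2 : ℝ) : ℂ) := by
    rw [Complex.ofReal_sum]
    simp_rw [Complex.ofReal_mul, h1]
    simp only [hv, Finset.sum_mul, Finset.mul_sum]
    rw [Finset.sum_comm_cycle]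
    refine Finset.sum_congr rfl fun α _ => Finset.sum_congr rfl fun i _ =>
      Finset.sum_congr rfl fun j _ => ?_
    ring
  rw [quad_potential, h2, Complex.ofReal_re]

theorem tracePairing_eq_sum_eigen {v : HermMat n} {l : Fin n → ℝ}
    {u : Fin n → Fin n → ℂ} (hv : ∀ i j, (v : Matrix (Fin n) (Fin n) ℂ) i j =
      ∑ α, (l α : ℂ) * (u α i * (starRingEnd ℂ) (u α j))) (γ : HermMat n) :
    tracePairing v γ =
      ∑ α, l α * (star (u α) ⬝ᵥ (γ : Matrix (Fin n) (Fin n) ℂ).mulVec (u α)).re := by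
  simp only [tracePairing_eq_sum, ← Complex.re_ofReal_mul, ← Complex.re_sum, hv, dotProduct,
    Matrix.mulVec, Finset.mul_sum, Finset.sum_mul]
  congr 1
  rw [Finset.sum_comm_cycle]
  refine Finset.sum_congr rfl fun α _ => ?_
  rw [Finset.sum_comm]
  refine Finset.sum_congr rfl fun j _ => Finset.sum_congr rfl fun i _ => ?_
  simp only [Pi.star_apply, Complex.star_def]
  ring

/-- A lower bound of a trace pairing on the one-body reduced density matrices of vectors is a lower
bound on all representable ones, for fermions. -/
theorem le_tracePairing_fermion {v : HermMat n} {c : ℝ}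
    (h : ∀ φ : PreFock Statistics.fermion n, ‖toFock φ‖ = 1 → c ≤ quad (potential _ v) φ)
    {γ : HermMat n} (hγ : γ ∈ NRep Statistics.fermion n) : c ≤ tracePairing v γ := by
  obtain ⟨l, u, hu, hv⟩ := exists_eigenvectors (v := (v : Matrix (Fin n) (Fin n) ℂ)) v.2
  -- A common kernel vector has every mode of negative eigenvalue filled and all others empty. Its
  -- one-body energy is the sum of the negative eigenvalues, the least value compatible with `0 ≤ γ
  -- ≤ 1`.
  set d : Fin n → Module.End ℂ (PreFock Statistics.fermion n) := fun α =>
    if l α < 0 then createMode _ (u α) else annihMode _ (u α) with hd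
  have hmix : ∀ α β φ, α ≠ β → annihMode Statistics.fermion (u α) (createMode _ (u β) φ) =
      -createMode _ (u β) (annihMode _ (u α) φ) := fun α β φ hαβ => by
    rw [annihMode_createMode, hu, if_neg hαβ, zero_smul, add_zero, exchangeSign, neg_one_smul]
  have hanti : ∀ α β φ, d α (d β φ) = -d β (d α φ) := fun α β φ => by
    simp only [hd]
    split_ifs with h1 h2 h2
    · rw [createMode_createMode, exchangeSign, neg_one_smul]
    · rw [hmix β α φ (by rintro rfl; exact h2 h1), neg_neg]
    · rw [hmix α β φ (by rintro rfl; exact h1 h2)]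
    · rw [annihMode_annihMode, exchangeSign, neg_one_smul]
  have : Nontrivial (PreFock Statistics.fermion n) := ⟨⟨_, _, vacuum_ne_zero⟩⟩
  obtain ⟨φ, hφ, h0⟩ := exists_ne_zero_forall_apply_eq_zero hanti Finset.univ
  have hn : 0 < ‖toFock φ‖ := norm_pos_iff.2 fun h => hφ (toFock_injective (by rw [h, map_zero]))
  have h1 := h ((((‖toFock φ‖)⁻¹ : ℝ) : ℂ) • φ) (by
    rw [map_smul, norm_smul, Complex.norm_real, norm_inv, norm_norm, inv_mul_cancel₀ hn.ne'])
  rw [quad_potential_eq_sum_eigen hv] at h1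
  rw [tracePairing_eq_sum_eigen hv]
  refine h1.trans (Finset.sum_le_sum fun α _ => ?_)
  rw [map_smul, map_smul, norm_smul, Complex.norm_real, norm_inv, norm_norm, mul_pow]
  have h2 := norm_annihMode_sq_add_norm_createMode_sq (u α) φ
  rw [hu, if_pos rfl, Complex.one_re, one_mul] at h2
  have h3 : 0 ≤ (star (u α) ⬝ᵥ (γ : Matrix (Fin n) (Fin n) ℂ).mulVec (u α)).re :=
    (Complex.nonneg_iff.1 (hγ.1.dotProduct_mulVec_nonneg (u α))).1
  have h4 : 0 ≤ (star (u α) ⬝ᵥ (1 - (γ : Matrix (Fin n) (Fin n) ℂ)).mulVec (u α)).re :=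
    (Complex.nonneg_iff.1 ((posSemidef_one_sub hγ).dotProduct_mulVec_nonneg (u α))).1
  rw [Matrix.sub_mulVec, Matrix.one_mulVec, dotProduct_sub, hu, if_pos rfl, Complex.sub_re,
    Complex.one_re] at h4
  have h5 := h0 α (Finset.mem_univ α)
  simp only [hd] at h5
  split_ifs at h5 with hl
  · rw [h5, map_zero, norm_zero, zero_pow two_ne_zero, add_zero] at h2
    rw [h2, ← mul_pow, inv_mul_cancel₀ hn.ne', one_pow]
    nlinarith
  · rw [h5, map_zero, norm_zero, zero_pow two_ne_zero, mul_zero, mul_zero]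
    exact mul_nonneg (not_lt.1 hl) h3

end Fermions

/-! ### Representable matrices lie in the closure of the domain -/

section Representability

variable {s : Statistics} {n : ℕ}

theorem le_tracePairing {v : HermMat n} {c : ℝ}
    (h : ∀ φ : PreFock s n, ‖toFock φ‖ = 1 → c ≤ quad (potential _ v) φ)
    {γ : HermMat n} (hγ : γ ∈ NRep s n) : c ≤ tracePairing v γ := by
  cases s with
  | boson => exact le_tracePairing_boson h hγ
  | fermion => exact le_tracePairing_fermion h hγ

/-- The universal functional is finite in the interior of the representable matrices. -/
theorem interior_NRep_subset {β : ℝ} (hβ : 0 < β) {H : Module.End ℂ (PreFock s n)}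
    (hH : IsHermitianOp H) (hN : DominatesNumber H) :
    interior (NRep s n) ⊆ interior (functionalDomain β H) := by
  have hconv := (convexOn_sInf_grandPotentialValues hβ hH hN).1
  refine (interior_mono fun γ hγ => ?_).trans (interior_closure_subset_hermMat hconv)
  by_contra hcl
  -- A functional separating `γ` from the domain is a trace pairing. It is bounded below on all
  -- density matrices of finite vectors, hence at `γ`.
  obtain ⟨L, c, h1, h2⟩ := exists_separation_hermMat hconv hcl
  obtain ⟨v, rfl⟩ := exists_tracePairing_eq L
  refine h1.not_ge (le_tracePairing (fun φ hφ => ?_) hγ)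
  have h3 := h2 _ (vectorRDM_mem_functionalDomain hH hN hφ)
  rw [← oneBody_eq_tracePairing, oneBody_emb] at h3
  exact h3.le

end Representability

end

end RDM

namespace RDM

noncomputable section

/-! ### Gibbs states generate interior points -/

section Interior

variable {s : Statistics} {n : ℕ}

/-- Strict positivity holds with a margin `ε`, which exceeds the error of a small entrywise
perturbation. -/
theorem eventually_posSemidef {γ : HermMat n} (h : ∀ u : Fin n → ℂ, u ≠ 0 →
      0 < (star u ⬝ᵥ (γ : Matrix (Fin n) (Fin n) ℂ).mulVec u).re) :
    ∀ᶠ γ' : HermMat n in 𝓝 γ, (γ' : Matrix (Fin n) (Fin n) ℂ).PosSemidef := by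
  obtain ⟨ε, hε, hle⟩ := exists_le_re_dotProduct h
  set f : HermMat n → ℝ := fun γ' => ∑ i, ∑ j,
    ‖(γ' : Matrix (Fin n) (Fin n) ℂ) i j - (γ : Matrix (Fin n) (Fin n) ℂ) i j‖ with hf
  have hcont : Continuous f := by
    refine continuous_finsetSum _ fun i _ => continuous_finsetSum _ fun j _ => ?_
    exact ((continuous_subtype_val.matrix_elem i j).sub continuous_const).norm
  have h0 : f γ < ε := by simpa [hf] using hε
  filter_upwards [hcont.continuousAt.eventually (gt_mem_nhds h0)] with γ' hγ'
  have hh : (γ' : Matrix (Fin n) (Fin n) ℂ).IsHermitian := γ'.2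
  refine Matrix.PosSemidef.of_dotProduct_mulVec_nonneg hh fun u => ?_
  rw [Complex.nonneg_iff]
  refine ⟨?_, (hh.im_star_dotProduct_mulVec_self u).symm⟩
  set r := ∑ i, ‖u i‖ ^ 2 with hr
  have h1 : ‖star u ⬝ᵥ ((γ' : Matrix (Fin n) (Fin n) ℂ) - γ).mulVec u‖ ≤ f γ' * r := by
    simp only [dotProduct, Matrix.mulVec, Finset.mul_sum, hf, Finset.sum_mul]
    refine (norm_sum_le _ _).trans (Finset.sum_le_sum fun i _ => (norm_sum_le _ _).trans
      (Finset.sum_le_sum fun j _ => ?_))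
    rw [norm_mul, norm_mul, Pi.star_apply, norm_star, Matrix.sub_apply]
    have h2 : ∀ i, ‖u i‖ ^ 2 ≤ r := fun i =>
      Finset.single_le_sum (f := fun i => ‖u i‖ ^ 2) (fun _ _ => sq_nonneg _) (Finset.mem_univ i)
    have h3 : ‖u i‖ * ‖u j‖ ≤ r := by nlinarith [h2 i, h2 j, sq_nonneg (‖u i‖ - ‖u j‖)]
    calc _ = ‖(γ' : Matrix (Fin n) (Fin n) ℂ) i j - (γ : Matrix (Fin n) (Fin n) ℂ) i j‖ *
          (‖u i‖ * ‖u j‖) := by ring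
      _ ≤ _ := mul_le_mul_of_nonneg_left h3 (norm_nonneg _)
  have h4 := (abs_le.1 ((Complex.abs_re_le_norm _).trans h1)).1
  rw [Matrix.sub_mulVec, dotProduct_sub, Complex.sub_re] at h4
  have h5 := hle u
  have h6 : f γ' * r ≤ ε * r :=
    mul_le_mul_of_nonneg_right hγ'.le (Finset.sum_nonneg fun _ _ => sq_nonneg _)
  linarith

theorem mem_interior_NRep {γ : HermMat n} (h0 : ∀ u : Fin n → ℂ, u ≠ 0 →
      0 < (star u ⬝ᵥ (γ : Matrix (Fin n) (Fin n) ℂ).mulVec u).re)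
    (h1 : s = Statistics.fermion → ∀ u : Fin n → ℂ, u ≠ 0 →
      0 < (star u ⬝ᵥ (1 - (γ : Matrix (Fin n) (Fin n) ℂ)).mulVec u).re) :
    γ ∈ interior (NRep s n) := by
  rw [mem_interior_iff_mem_nhds]
  cases s with
  | boson =>
    filter_upwards [eventually_posSemidef h0] with γ' h using ⟨h, nofun⟩
  | fermion =>
    have hsub : ∀ γ' : HermMat n, ((1 - γ' : HermMat n) : Matrix (Fin n) (Fin n) ℂ) = 1 - γ' :=
      fun γ' => by rw [AddSubgroup.coe_sub, selfAdjoint.val_one]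
    have h2 := eventually_posSemidef (γ := 1 - γ) (by rw [hsub]; exact h1 rfl)
    have h3 : Tendsto (fun γ' : HermMat n => 1 - γ') (𝓝 γ) (𝓝 (1 - γ)) :=
      (continuous_const.sub continuous_id).continuousAt
    filter_upwards [eventually_posSemidef h0, h3.eventually h2] with γ' h h'
    exact ⟨h, fun _ => posSemidef_sub_sq h (hsub γ' ▸ h')⟩

/-- The orthogonal projection, up to normalisation, on a one-particle state. -/
def modeProjection (u : Fin n → ℂ) : HermMat n :=
  ⟨Matrix.vecMulVec u (star u), by
    rw [selfAdjoint.mem_iff, Matrix.star_eq_conjTranspose, Matrix.conjTranspose_vecMulVec,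
      star_star]⟩

theorem tracePairing_modeProjection (u : Fin n → ℂ) (γ : HermMat n) :
    tracePairing (modeProjection u) γ =
      (star u ⬝ᵥ (γ : Matrix (Fin n) (Fin n) ℂ).mulVec u).re := by
  simp only [tracePairing_eq_sum, modeProjection, Matrix.vecMulVec_apply, dotProduct,
    Matrix.mulVec, Finset.mul_sum]
  rw [Finset.sum_comm]
  congr 1
  refine Finset.sum_congr rfl fun i _ => Finset.sum_congr rfl fun j _ => ?_
  simp only [Pi.star_apply]
  ring

theorem oneBody_modeProjection (u : Fin n → ℂ) (η : (numberSpace s n).carrier) :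
    oneBody (modeProjection u) η = ‖∑ i, (starRingEnd ℂ) (u i) • annihExt s i η‖ ^ 2 := by
  rw [← Complex.ofReal_re (‖_‖ ^ 2), ← inner_self_eq_ofReal, oneBody, sum_inner]
  congr 1
  refine Finset.sum_congr rfl fun i _ => ?_
  rw [inner_sum]
  refine Finset.sum_congr rfl fun j _ => ?_
  rw [inner_smul_left, inner_smul_right, Complex.conj_conj, modeProjection]
  simp only [Matrix.vecMulVec_apply, Pi.star_apply, Complex.star_def]
  ring

theorem inner_sum_annihExt (u : Fin n → ℂ) (φ : PreFock s n) (η : (numberSpace s n).carrier) :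
    inner ℂ (toFock φ) (∑ i, (starRingEnd ℂ) (u i) • annihExt s i η) =
      inner ℂ (toFock (createMode s u φ)) ((numberSpace s n).J η) := by
  simp only [createMode_apply, map_sum, map_smul, sum_inner, inner_sum, inner_smul_left,
    inner_smul_right, inner_annihExt]

theorem annihMode_createMode_vacuum_ne_zero {u : Fin n → ℂ} (hu : u ≠ 0) :
    annihMode s u (createMode s u (vacuum s n)) ≠ 0 := by
  rw [annihMode_createMode, annihMode_vacuum, map_zero, smul_zero, zero_add]
  exact smul_ne_zero (mt dotProduct_star_self_eq_zero.1 hu) vacuum_ne_zero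

theorem eq_zero_of_forall_inner_eq_zero {ι E : Type*} [NormedAddCommGroup E]
    [InnerProductSpace ℂ E] (b : HilbertBasis ι ℂ E) {x : E} (h : ∀ k, inner ℂ x (b k) = 0) :
    x = 0 := by
  refine b.repr.injective ?_
  ext k
  rw [b.repr_apply_apply, ← inner_conj_symm, h, map_zero, map_zero]
  rfl

theorem IsGibbsState.exists_numberVectors {β : ℝ} {A : Module.End ℂ (PreFock s n)} (hβ : 0 < β)
    (hA : IsHermitianOp A) (hN : DominatesNumber A) {ρ : Fock s n →L[ℂ] Fock s n}
    (h : IsGibbsState β A ρ) :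
    ∃ (b : HilbertBasis (Occ s n) ℂ (Fock s n)) (w : Occ s n → ℝ)
      (η : Occ s n → (numberSpace s n).carrier), IsDiag ρ b w ∧ (∀ k, 0 < w k) ∧ HasSum w 1 ∧
      (∀ k, (numberSpace s n).J (η k) = b k) ∧ Summable fun k => w k * ‖η k‖ ^ 2 := by
  obtain ⟨hb, b, E, hE, hs, hd⟩ := h
  obtain ⟨hZ, hw1⟩ := hasSum_gibbsWeight hs
  have hwp : ∀ k, 0 < Real.exp (-β * E k) / ∑' l, Real.exp (-β * E l) := fun k =>
    div_pos (Real.exp_pos _) hZ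
  have hEv : Summable fun k => Real.exp (-β * E k) / (∑' l, Real.exp (-β * E l)) * E k :=
    ((hE.summable_mul_exp hA hN hβ).div_const _).congr fun k => by ring
  obtain ⟨K, hK, C, hC⟩ := hN
  obtain ⟨η, hη, -, -, -, hsη, -⟩ := RDM.exists_numberVectors hC (fun k => (hwp k).le) hw1
    (fun k _ => hE.hasFormValue hA hb k) hEv.hasSum
  exact ⟨b, _, η, hd, hwp, hw1, fun k => hη k (hwp k).ne', hsη⟩

theorem exists_toFock_eq [Finite (Occ s n)] (ψ : Fock s n) : ∃ φ, toFock φ = ψ := by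
  have := Fintype.ofFinite (Occ s n)
  refine ⟨Finsupp.equivFunOnFinite.symm fun k => ψ k, ?_⟩
  ext k
  rw [toFock_apply]
  rfl

/-- Gibbs states occupy every one-particle state, and for fermions none of them completely. -/
theorem IsGibbsState.mem_interior_NRep {β : ℝ} {A : Module.End ℂ (PreFock s n)} (hβ : 0 < β)
    (hA : IsHermitianOp A) (hN : DominatesNumber A) {ρ : Fock s n →L[ℂ] Fock s n}
    (h : IsGibbsState β A ρ) {γ : HermMat n} (hγ : HasOneRDM ρ γ) :
    γ ∈ interior (NRep s n) := by
  obtain ⟨b, w, η, hd, hw, hw1, hη, hs⟩ := h.exists_numberVectors hβ hA hN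
  have hsum : ∀ u : Fin n → ℂ,
      HasSum (fun k => w k * ‖∑ i, (starRingEnd ℂ) (u i) • annihExt s i (η k)‖ ^ 2)
        (star u ⬝ᵥ (γ : Matrix (Fin n) (Fin n) ℂ).mulVec u).re := fun u => by
    rw [← tracePairing_modeProjection]
    simp only [← oneBody_modeProjection]
    exact hasSum_oneBody hd (fun k => (hw k).le) (fun k _ => hη k) hs hγ _
  have hpos : ∀ (f : Occ s n → ℝ) (S : ℝ), (∀ k, 0 ≤ f k) → HasSum (fun k => w k * f k) S →
      (∃ k, f k ≠ 0) → 0 < S := fun f S hf hS ⟨k, hk⟩ =>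
    (mul_pos (hw k) ((hf k).lt_of_ne' hk)).trans_le
      (le_hasSum hS k fun j _ => mul_nonneg (hw j).le (hf j))
  refine RDM.mem_interior_NRep (fun u hu => ?_) ?_
  · refine hpos _ _ (fun k => sq_nonneg _) (hsum u) ?_
    by_contra! hcon
    -- If the mode were empty in every eigenvector, its annihilator would vanish on a Hilbert basis,
    -- and by adjointness the creator would kill the vacuum.
    have h0 : createMode s u (vacuum s n) = 0 := by
      refine toFock_injective ((eq_zero_of_forall_inner_eq_zero b fun k => ?_).trans
        (map_zero _).symm)
      rw [← hη, ← inner_sum_annihExt, norm_eq_zero.1 (pow_eq_zero_iff two_ne_zero |>.1 (hcon k)),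
        inner_zero_right]
    exact annihMode_createMode_vacuum_ne_zero (s := s) hu (by rw [h0, map_zero])
  · rintro rfl u hu
    have := finite_occ_fermion (n := n)
    choose φ hφ using fun k => exists_toFock_eq (b k)
    have hemb : ∀ k, η k = (numberSpace _ n).emb (φ k) := fun k =>
      (numberSpace _ n).J_injective (by rw [hη, FormSpace.J_emb, hφ])
    -- The anticommutation relation turns `1 - γ` into the same kind of sum with `a†_u` in place of
    -- `a_u`, so the previous argument applies to holes.
    have h1 := ((hw1.mul_right (star u ⬝ᵥ u).re).sub (hsum u)).of_fun_eq
      (g := fun k => w k * ‖toFock (createMode _ u (φ k))‖ ^ 2) fun k => by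
        have h2 := norm_annihMode_sq_add_norm_createMode_sq u (φ k)
        rw [hφ, b.orthonormal.1 k, annihMode_apply, map_sum] at h2
        simp only [map_smul] at h2
        simp only [hemb, annihExt_emb]
        linear_combination w k * h2
    rw [Matrix.sub_mulVec, Matrix.one_mulVec, dotProduct_sub, Complex.sub_re]
    rw [one_mul] at h1
    refine hpos _ _ (fun k => sq_nonneg _) h1 ?_
    by_contra! hcon
    refine annihMode_createMode_vacuum_ne_zero (s := Statistics.fermion) hu (toFock_injective
      ((eq_zero_of_forall_inner_eq_zero b fun k => ?_).trans (map_zero _).symm))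
    rw [← hφ, inner_annihMode, norm_eq_zero.1 (pow_eq_zero_iff two_ne_zero |>.1 (hcon k)),
      inner_zero_right]

end Interior

end

end RDM

namespace RDM

noncomputable section

/-! ### Attainment in finite dimension -/

section FiniteDimensional

variable {s : Statistics} {n : ℕ} [Finite (Occ s n)]

instance finiteDimensional_fock : FiniteDimensional ℂ (Fock s n) :=
  Module.Finite.of_surjective (toFock (s := s) (n := n)) exists_toFock_eq

/-- In finite dimension every operator on the pre-Fock space is bounded. -/
theorem exists_continuousLinearMap (A : Module.End ℂ (PreFock s n)) :
    ∃ T : Fock s n →L[ℂ] Fock s n, ∀ φ, T (toFock φ) = toFock (A φ) := by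
  let e : PreFock s n ≃ₗ[ℂ] Fock s n :=
    LinearEquiv.ofBijective toFock ⟨toFock_injective, exists_toFock_eq⟩
  refine ⟨LinearMap.toContinuousLinearMap (toFock ∘ₗ A ∘ₗ e.symm.toLinearMap), fun φ => ?_⟩
  have h : e.symm (toFock φ) = φ := e.symm_apply_apply φ
  simp [h]

theorem hasFormValue_toFock_iff (A : Module.End ℂ (PreFock s n)) (φ : PreFock s n) (e : ℝ) :
    HasFormValue A (toFock φ) e ↔ e = quad A φ := by
  constructor
  · rintro ⟨φ', h1, -, h3⟩
    obtain ⟨T, hT⟩ := exists_continuousLinearMap A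
    have h4 : Continuous fun ψ : Fock s n => (inner ℂ ψ (T ψ)).re := by fun_prop
    have h5 := ((h4.tendsto _).comp h1).congr (f₂ := fun l => quad A (φ' l)) fun l => by
      simp [hT, quad, form]
    rw [tendsto_nhds_unique h3 h5, hT]
    rfl
  · rintro rfl
    exact ⟨fun _ => φ, tendsto_const_nhds, by simp [quad, form], tendsto_const_nhds⟩

theorem hasOneRDM_iff_of_finite [Fintype (Occ s n)] {ρ : Fock s n →L[ℂ] Fock s n}
    {b : HilbertBasis (Occ s n) ℂ (Fock s n)} {w : Occ s n → ℝ} (h : IsDiag ρ b w)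
    (hw : ∀ k, 0 ≤ w k) {φ : Occ s n → PreFock s n} (hφ : ∀ k, toFock (φ k) = b k)
    (γ : HermMat n) : HasOneRDM ρ γ ↔ ∀ i j, ∑ m, (w m : ℂ) *
      inner ℂ (toFock (φ m)) (toFock (create s n j (annih s n i (φ m)))) =
        (γ : Matrix (Fin n) (Fin n) ℂ) i j := by
  have h1 := fun i j => (hasSum_oneRDM (η := fun k => (numberSpace s n).emb (φ k)) h hw
    (fun k _ => by rw [FormSpace.J_emb, hφ]) (Summable.of_finite) i j).2
  simp only [annihExt_emb, tsum_fintype, inner_annih] at h1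
  exact ⟨fun h2 i j => (h1 i j).unique (h2 i j), fun h2 i j => h2 i j ▸ h1 i j⟩

theorem exists_hilbertBasis [Fintype (Occ s n)] {x : Occ s n → Fock s n} (hx : Orthonormal ℂ x) :
    ∃ b : HilbertBasis (Occ s n) ℂ (Fock s n), ∀ k, b k = x k := by
  have h1 : Module.finrank ℂ (Fock s n) = Fintype.card (Occ s n) := by
    let e : PreFock s n ≃ₗ[ℂ] Fock s n :=
      LinearEquiv.ofBijective toFock ⟨toFock_injective, exists_toFock_eq⟩
    rw [← e.finrank_eq, Module.finrank_finsupp_self]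
  have h2 := hx.linearIndependent.span_eq_top_of_card_eq_finrank' h1.symm
  exact ⟨HilbertBasis.mk hx (by rw [h2]; exact Submodule.le_topologicalClosure _),
    fun k => by rw [HilbertBasis.coe_mk]⟩

/-- In finite dimension the infimum in the universal functional is attained. -/
theorem isAttained_of_finite (β : ℝ) (A : Module.End ℂ (PreFock s n)) : IsAttained β A := by
  classical
  have := Fintype.ofFinite (Occ s n)
  intro γ _ hne
  have hnon : (grandPotentialValues β A γ).Nonempty := by
    by_contra hcon
    rw [Set.not_nonempty_iff_eq_empty] at hcon
    exact hne (by rw [universalFunctional, hcon, Set.image_empty, sInf_empty])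
  obtain ⟨T, hT⟩ := exists_continuousLinearMap A
  choose R hR using fun i j => exists_continuousLinearMap (create s n j * annih s n i)
  -- States are parametrised by orthonormal frames and probability weights. The constraint on `γ` is
  -- a closed condition, and the grand potential is continuous on this compact set because
  -- `Real.negMulLog` is.
  let K : Set ((Occ s n → Fock s n) × (Occ s n → ℝ)) :=
    {p | (∀ k l, inner ℂ (p.1 k) (p.1 l) = if k = l then (1 : ℂ) else 0) ∧ (∀ k, 0 ≤ p.2 k) ∧
      ∑ k, p.2 k = 1 ∧ ∀ i j, ∑ k, (p.2 k : ℂ) * inner ℂ (p.1 k) (R i j (p.1 k)) =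
        (γ : Matrix (Fin n) (Fin n) ℂ) i j}
  let G : (Occ s n → Fock s n) × (Occ s n → ℝ) → ℝ := fun p =>
    ∑ k, p.2 k * (inner ℂ (p.1 k) (T (p.1 k))).re - β⁻¹ * ∑ k, Real.negMulLog (p.2 k)
  have hG : Continuous G := by fun_prop
  have hK : IsClosed K := by
    simp only [K, Set.ofPred_and, Set.ofPred_forall]
    refine IsClosed.inter ?_ (IsClosed.inter ?_ (IsClosed.inter ?_ ?_))
    · exact isClosed_iInter fun k => isClosed_iInter fun l =>
        isClosed_eq (by fun_prop) continuous_const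
    · exact isClosed_iInter fun k => isClosed_le continuous_const (by fun_prop)
    · exact isClosed_eq (by fun_prop) continuous_const
    · exact isClosed_iInter fun i => isClosed_iInter fun j =>
        isClosed_eq (by fun_prop) continuous_const
  have hcompact : IsCompact K := by
    have : ProperSpace (Fock s n) := FiniteDimensional.proper ℂ _
    refine (isCompact_closedBall (0 : (Occ s n → Fock s n) × (Occ s n → ℝ)) 1).of_isClosed_subset
      hK fun p hp => ?_
    rw [mem_closedBall_zero_iff, Prod.norm_def, max_le_iff]
    refine ⟨(pi_norm_le_iff_of_nonneg zero_le_one).2 fun k => ?_,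
      (pi_norm_le_iff_of_nonneg zero_le_one).2 fun k => ?_⟩
    · have h1 := hp.1 k k
      rw [if_pos rfl, inner_self_eq_ofReal] at h1
      have h2 : ‖p.1 k‖ ^ 2 = 1 := by exact_mod_cast h1
      exact ((pow_eq_one_iff_of_nonneg (norm_nonneg _) two_ne_zero).1 h2).le
    · rw [Real.norm_of_nonneg (hp.2.1 k), ← hp.2.2.1]
      exact Finset.single_le_sum (fun j _ => hp.2.1 j) (Finset.mem_univ k)
  have hvalues : grandPotentialValues β A γ = G '' K := by
    ext ω
    constructor
    · rintro ⟨ρ, hρ, hγ, hω⟩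
      obtain ⟨b, w, e, E, S, d⟩ := hω.exists_spectralData hρ
      choose φ hφ using fun k => exists_toFock_eq (b k)
      refine ⟨(b, w), ⟨fun k l => orthonormal_iff_ite.1 b.orthonormal k l, d.nonneg, ?_, ?_⟩, ?_⟩
      · exact (hasSum_fintype w).unique d.sum_weights
      · simpa only [← hφ, hR, Module.End.mul_apply] using
          (hasOneRDM_iff_of_finite d.diag d.nonneg hφ γ).1 hγ
      · have h1 : ∑ k, w k * (inner ℂ (b k) (T (b k))).re = E := by
          refine (hasSum_fintype _).unique (d.energy.of_fun_eq fun k => ?_)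
          by_cases hk : w k = 0
          · rw [hk, zero_mul, zero_mul]
          · have h2 := d.formValue k hk
            rw [← hφ, hasFormValue_toFock_iff] at h2
            rw [h2, ← hφ, hT]
            rfl
        simp only [G]
        rw [h1, (hasSum_fintype _).unique d.entropy, d.eq]
    · rintro ⟨⟨x, w⟩, ⟨hx, hw, hw1, hγ⟩, rfl⟩
      obtain ⟨b, hb⟩ := exists_hilbertBasis (orthonormal_iff_ite.2 hx)
      obtain rfl : ⇑b = x := funext hb
      choose φ hφ using fun k => exists_toFock_eq (b k)
      obtain ⟨ρ, hρ⟩ := exists_isDiag_of_summable b hw Summable.of_finite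
      refine ⟨ρ, hρ.isDensityOp hw (hw1 ▸ hasSum_fintype w),
        (hasOneRDM_iff_of_finite hρ hw hφ γ).2
          (by simpa only [← hφ, hR, Module.End.mul_apply] using hγ),
        _, _, ⟨b, w, hρ, fun k => (inner ℂ (b k) (T (b k))).re, fun k _ => ?_, hasSum_fintype _⟩,
        ⟨b, w, hρ, hasSum_fintype _⟩, rfl⟩
      rw [← hφ, hasFormValue_toFock_iff]
      simp only [← hφ, hT]
      rfl
  obtain ⟨ω, hω, hmin⟩ := (hcompact.image hG).exists_isLeast (hvalues ▸ hnon)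
  rw [← hvalues] at hω hmin
  refine ⟨ω, hω, le_antisymm (sInf_le (Set.mem_image_of_mem _ hω)) (le_sInf ?_)⟩
  rintro _ ⟨ω', hω', rfl⟩
  exact EReal.coe_le_coe_iff.2 (hmin hω')

end FiniteDimensional

end

end RDM

namespace RDM

noncomputable section

/-! ### Potentials as subgradients -/

section Duality

variable {s : Statistics} {n : ℕ} {β : ℝ} {H : Module.End ℂ (PreFock s n)}

theorem toReal_universalFunctional (hβ : 0 < β) (hN : DominatesNumber H) {γ : HermMat n}
    (hγ : γ ∈ functionalDomain β H) :
    (universalFunctional β H γ).toReal = sInf (grandPotentialValues β H γ) := by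
  rw [universalFunctional_eq hβ hN hγ, EReal.toReal_coe]

theorem convexOn_universalFunctional (hβ : 0 < β) (hH : IsHermitianOp H)
    (hN : DominatesNumber H) :
    ConvexOn ℝ (functionalDomain β H) fun γ => (universalFunctional β H γ).toReal :=
  (convexOn_sInf_grandPotentialValues hβ hH hN).congr fun _ hγ =>
    (toReal_universalFunctional hβ hN hγ).symm

/-- A minimiser of the universal functional at `γ` is the Gibbs state of every potential that
supports the functional at `γ`. -/
theorem IsAttained.exists_isGibbsState (h : IsAttained β H) (hβ : 0 < β) (hH : IsHermitianOp H)
    (hN : DominatesNumber H) {γ : HermMat n} (hγ : γ ∈ NRep s n)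
    (hD : γ ∈ functionalDomain β H) :
    ∃ ρ, HasOneRDM ρ γ ∧ ∀ v : HermMat n, (∀ γ' ∈ functionalDomain β H,
      (universalFunctional β H γ).toReal + (-tracePairing v) (γ' - γ) ≤
        (universalFunctional β H γ').toReal) →
      v ∈ finitePotentials β H ∧ IsGibbsState β (H + potential s v) ρ := by
  obtain ⟨ω, ⟨ρ, hρ, hργ, hω⟩, hF⟩ := h γ hγ (by
    rw [universalFunctional_eq hβ hN hD]; exact EReal.coe_ne_top _)
  refine ⟨ρ, hργ, fun v hv => isGibbsState_of_minimal hβ hH hN hρ hργ hω fun γ' ω' hω' => ?_⟩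
  have h1 := hv γ' ⟨ω', hω'⟩
  rw [hF, EReal.toReal_coe, toReal_universalFunctional hβ hN ⟨ω', hω'⟩] at h1
  have h2 := csInf_le (bddBelow_grandPotentialValues hβ hN γ') hω'
  simp only [neg_apply, map_sub] at h1
  linarith

/-- A potential supports the universal functional at the one-body reduced density matrix it
generates. -/
theorem Generates.supports (hβ : 0 < β) (hH : IsHermitianOp H) (hN : DominatesNumber H)
    {v γ : HermMat n} (hNv : DominatesNumber (H + potential s v)) (h : Generates β H v γ) :
    γ ∈ functionalDomain β H ∧ ∀ γ' ∈ functionalDomain β H,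
      (universalFunctional β H γ).toReal + (-tracePairing v) (γ' - γ) ≤
        (universalFunctional β H γ').toReal := by
  obtain ⟨ρ, hρ, hγ⟩ := h
  obtain ⟨hd, γ₀, ω, hγ₀, hω, hmin⟩ := hρ.minimal hβ hH hN hNv
  obtain rfl := hγ₀.unique hγ
  have hD : ω ∈ grandPotentialValues β H γ₀ := ⟨ρ, hd, hγ, hω⟩
  refine ⟨⟨ω, hD⟩, fun γ' hγ' => ?_⟩
  rw [toReal_universalFunctional hβ hN ⟨ω, hD⟩, toReal_universalFunctional hβ hN hγ']
  refine le_csInf hγ' fun ω' hω' => ?_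
  have h1 := hmin γ' ω' hω'
  have h2 := csInf_le (bddBelow_grandPotentialValues hβ hN γ₀) hD
  simp only [neg_apply, map_sub]
  linarith

theorem hasFDerivAt_unique {E : Type*} [NormedAddCommGroup E] [NormedSpace ℝ E] {F : E → ℝ}
    {L L' : E →L[ℝ] ℝ} {x : E} (h : HasFDerivAt F L x) (h' : HasFDerivAt F L' x) : L = L' :=
  h.unique h'

theorem hasFDerivAt_unique_hermMat {F : HermMat n → ℝ} {L L' : HermMat n →L[ℝ] ℝ} {γ : HermMat n}
    (h : HasFDerivAt F L γ) (h' : HasFDerivAt F L' γ) : L = L' :=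
  @hasFDerivAt_unique (HermMat n) (hermMatNorm n) (hermMatNormedSpace n) F L L' γ h h'

theorem Generates.mem_interior_NRep (hβ : 0 < β) (hH : IsHermitianOp H) {v γ : HermMat n}
    (hNv : DominatesNumber (H + potential s v)) (h : Generates β H v γ) :
    γ ∈ interior (NRep s n) := by
  obtain ⟨ρ, hρ, hγ⟩ := h
  exact hρ.mem_interior_NRep hβ (hH.add (isHermitianOp_potential v)) hNv hγ

/-- The state attaining `F[γ]` is chosen before the subgradient, so it is the Gibbs state of every
supporting potential at once. It determines the Hamiltonian up to a constant, hence the potential;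
the subgradient is unique. -/
theorem Generates.hasFDerivAt (hatt : IsAttained β H) (hβ : 0 < β) (hH : IsHermitianOp H)
    (hN : DominatesNumber H) {v γ : HermMat n} (hNv : DominatesNumber (H + potential s v))
    (h : Generates β H v γ) :
    HasFDerivAt (fun γ' => (universalFunctional β H γ').toReal) (-tracePairing v) γ := by
  obtain ⟨hD, hv⟩ := h.supports hβ hH hN hNv
  have hint := h.mem_interior_NRep hβ hH hNv
  obtain ⟨ρ, -, hρ⟩ := hatt.exists_isGibbsState hβ hH hN (interior_subset hint) hD
  refine hasFDerivAt_hermMat (convexOn_universalFunctional hβ hH hN)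
    (interior_NRep_subset hβ hH hN hint) hv fun L hL => ?_
  obtain ⟨v', hv'⟩ := exists_tracePairing_eq (-L)
  obtain rfl : -tracePairing v' = L := by rw [hv', neg_neg]
  obtain ⟨c, hc⟩ := (hρ v hv).2.exists_sub_eq hβ (hρ v' hL).2
  have hvv : v = v' := eq_of_potential_sub_eq (s := s) (c := c) fun φ => by
    rw [← hc φ, LinearMap.add_apply, LinearMap.add_apply, add_sub_add_left_eq_sub]
  rw [hvv]

/-- An interior point of the domain has a subgradient, and its negative is the potential sought. -/
theorem IsAttained.exists_generates (hatt : IsAttained β H) (hβ : 0 < β) (hH : IsHermitianOp H)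
    (hN : DominatesNumber H) {γ : HermMat n} (hγ : γ ∈ interior (NRep s n)) :
    ∃ v ∈ finitePotentials β H, Generates β H v γ := by
  have hD := interior_NRep_subset hβ hH hN hγ
  obtain ⟨L, hL⟩ := exists_subgradient_hermMat (convexOn_universalFunctional hβ hH hN) hD
  obtain ⟨v, hv⟩ := exists_tracePairing_eq (-L)
  obtain rfl : -tracePairing v = L := by rw [hv, neg_neg]
  obtain ⟨ρ, hργ, hρ⟩ := hatt.exists_isGibbsState hβ hH hN (interior_subset hγ)
    (interior_subset hD)
  exact ⟨v, (hρ v hL).1, ρ, (hρ v hL).2, hργ⟩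

theorem exists_generates_of_mem_finitePotentials (hβ : 0 < β) (hH : IsHermitianOp H)
    {v : HermMat n} (hNv : DominatesNumber (H + potential s v)) (hv : v ∈ finitePotentials β H) :
    ∃ γ, Generates β H v γ := by
  obtain ⟨ρ, hρ⟩ := PartitionFinite.exists_isGibbsState hv
  obtain ⟨b, w, η, hd, hw, -, hη, hs⟩ :=
    hρ.exists_numberVectors hβ (hH.add (isHermitianOp_potential v)) hNv
  obtain ⟨γ, hγ⟩ := exists_hasOneRDM hd (fun k => (hw k).le) (fun k _ => hη k) hs
  exact ⟨γ, ρ, hρ, hγ⟩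

theorem Generates.unique (hH : IsHermitianOp H) {v γ γ' : HermMat n} (h : Generates β H v γ)
    (h' : Generates β H v γ') : γ = γ' := by
  obtain ⟨ρ, hρ, hγ⟩ := h
  obtain ⟨ρ', hρ', hγ'⟩ := h'
  rw [hρ'.unique (hH.add (isHermitianOp_potential v)) hρ] at hγ'
  exact hγ.unique hγ'

end Duality

end

end RDM

theorem theorem3p14 (s : RDM.Statistics) (n m : ℕ) (hm : 0 < m) (β : ℝ) (hβ : 0 < β)
    (H : Module.End ℂ (RDM.PreFock s n))
    (hpoly : H ∈ RDM.ladderPoly s n (2 * m))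
    (hherm : RDM.IsHermitianOp H)
    (hpos : s = RDM.Statistics.boson → RDM.IsCoercive m H) :
    (RDM.IsAttained β H →
      interior (RDM.NRep s n) = RDM.VRep β H ∧
      (∀ γ ∈ interior (RDM.NRep s n),
        RDM.universalFunctional β H γ ≠ ⊤ ∧ RDM.universalFunctional β H γ ≠ ⊥ ∧
        DifferentiableAt ℝ (fun γ' => (RDM.universalFunctional β H γ').toReal) γ) ∧
      (∀ v ∈ RDM.finitePotentials β H, ∀ γ, RDM.Generates β H v γ →
        HasFDerivAt (fun γ' => (RDM.universalFunctional β H γ').toReal)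
          (-RDM.tracePairing v) γ) ∧
      (∀ v ∈ RDM.finitePotentials β H,
        ∃! γ, γ ∈ interior (RDM.NRep s n) ∧ RDM.Generates β H v γ) ∧
      (∀ γ ∈ interior (RDM.NRep s n),
        ∃! v, v ∈ RDM.finitePotentials β H ∧ RDM.Generates β H v γ)) ∧
    (s = RDM.Statistics.fermion → RDM.IsAttained β H) := by
  have hN : RDM.DominatesNumber H := RDM.dominatesNumber_hamiltonian hm hpos
  have hNv : ∀ v ∈ RDM.finitePotentials β H, RDM.DominatesNumber (H + RDM.potential s v) :=
    fun v hv => RDM.dominatesNumber_of_mem_finitePotentials hm hβ hpoly hherm hpos hv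
  refine ⟨fun hatt => ?_, ?_⟩
  · have hex : ∀ γ ∈ interior (RDM.NRep s n), ∃ v ∈ RDM.finitePotentials β H,
        RDM.Generates β H v γ := fun γ hγ => hatt.exists_generates hβ hherm hN hγ
    have hint : ∀ v ∈ RDM.finitePotentials β H, ∀ γ, RDM.Generates β H v γ →
        γ ∈ interior (RDM.NRep s n) :=
      fun v hv γ h => h.mem_interior_NRep hβ hherm (hNv v hv)
    have hder : ∀ v ∈ RDM.finitePotentials β H, ∀ γ, RDM.Generates β H v γ →
        HasFDerivAt (fun γ' => (RDM.universalFunctional β H γ').toReal) (-RDM.tracePairing v) γ :=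
      fun v hv γ h => h.hasFDerivAt hatt hβ hherm hN (hNv v hv)
    refine ⟨Set.ext fun γ => ⟨fun hγ => ⟨interior_subset hγ, hex γ hγ⟩,
      fun ⟨_, v, hv, h⟩ => hint v hv γ h⟩, fun γ hγ => ?_, hder, fun v hv => ?_, fun γ hγ => ?_⟩
    · rw [RDM.universalFunctional_eq hβ hN (interior_subset
        (RDM.interior_NRep_subset hβ hherm hN hγ))]
      obtain ⟨v, hv, h⟩ := hex γ hγ
      exact ⟨EReal.coe_ne_top _, EReal.coe_ne_bot _, (hder v hv γ h).differentiableAt⟩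
    · obtain ⟨γ, h⟩ := RDM.exists_generates_of_mem_finitePotentials hβ hherm (hNv v hv) hv
      exact ⟨γ, ⟨hint v hv γ h, h⟩, fun γ' h' => h'.2.unique hherm h⟩
    · obtain ⟨v, hv, h⟩ := hex γ hγ
      -- Two potentials generating the same `γ` are both minus the gradient there.
      refine ⟨v, ⟨hv, h⟩, fun v' ⟨hv', h'⟩ => RDM.tracePairing_injective (neg_injective ?_)⟩
      exact RDM.hasFDerivAt_unique_hermMat (hder v' hv' γ h') (hder v hv γ h)
  · rintro rfl
    have := RDM.finite_occ_fermion (n := n)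
    exact RDM.isAttained_of_finite β H
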